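/- Let $M$ be a smooth $8$-manifold with a smooth Riemannian metric $g$ and let $\Omega$ be a smooth $4$-form on $M$ which defines an $\mathrm{Sp}(2)\mathrm{Sp}(1)$-structure inducing $g$: for every $p\in M$ there is a linear isometry $u:(T_pM,g_p)\to\mathbb R^8$ with $\Omega_p=u^*\Omega_0$, where $\Omega_0=\tfrac12(\omega_1\wedge\omega_1+\omega_2\wedge\omega_2+\omega_3\wedge\omega_3)$ and $$\omega_1=dx_{12}+dx_{34}+dx_{56}+dx_{78},\quad \omega_2=dx_{13}-dx_{24}+dx_{57}-dx_{68},\quad \omega_3=dx_{14}+dx_{23}+dx_{58}+dx_{67}.$$ Let $\nabla$ be the Levi-Civita connection of $g$, and let $*$ be the Hodge star of $g$ for the volume form $\tfrac1{30}\Omega\wedge\Omega$. Put $$\Lambda^2_3=\{\alpha\in\Lambda^2: *(\alpha\wedge\Omega)=5\alpha\},\quad \Lambda^2_{10}=\{\alpha: *(\alpha\wedge\Omega)=-3\alpha\},\quad \Lambda^2_{15}=\{\alpha: *(\alpha\wedge\Omega)=\alpha\},$$ so that $\Lambda^2=\Lambda^2_3\oplus\Lambda^2_{10}\oplus\Lambda^2_{15}$,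 and let $\pi^2_{15}:\Lambda^2\to\Lambda^2_{15}$ be the corresponding projection. Define linear operations by their values on simple forms: $$(\alpha\wedge\beta)\diamond\Omega=\alpha\wedge(\beta^\sharp\lrcorner\,\Omega)-\beta\wedge(\alpha^\sharp\lrcorner\,\Omega),$$ $$(\alpha_1\wedge\alpha_2\wedge\alpha_3\wedge\alpha_4)\lrcorner_3\,\kappa=\alpha_1\wedge(\alpha_2^\sharp\lrcorner\alpha_3^\sharp\lrcorner\alpha_4^\sharp\lrcorner\kappa)-\alpha_2\wedge(\alpha_1^\sharp\lrcorner\alpha_3^\sharp\lrcorner\alpha_4^\sharp\lrcorner\kappa)+\alpha_3\wedge(\alpha_1^\sharp\lrcorner\alpha_2^\sharp\lrcorner\alpha_4^\sharp\lrcorner\kappa)-\alpha_4\wedge(\alpha_1^\sharp\lrcorner\alpha_2^\sharp\lrcorner\alpha_3^\sharp\lrcorner\kappa)$$ for $4$-forms $\kappa$, where $v\lrcorner w\lrcorner z\lrcorner\kappa=v\lrcorner(w\lrcorner(z\lrcorner\kappa))$. Let $R(X,Y)=[\nabla_X,\nabla_Y]-\nabla_{[X,Y]}$ be the curvature, viewed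 as the $2$-form $(U,W)\mapsto g(U,R(X,Y)W)$. Then there is a unique tensor field $T$ (the intrinsic torsion), linear in $X\in TM$ with $T(X)\in\Lambda^2_{15}$, such that $\nabla_X\Omega=T(X)\diamond\Omega$ for all $X$; it is smooth, and for all $p\in M$ and $X,Y\in T_pM$ $$(\nabla_XT)(Y)-(\nabla_YT)(X)=\pi^2_{15}(R(X,Y))+\frac1{32}\Big((\nabla_Y\Omega)\lrcorner_3(\nabla_X\Omega)-(\nabla_X\Omega)\lrcorner_3(\nabla_Y\Omega)\Big),$$ $$\pi^2_{15}\big((\nabla_XT)(Y)-(\nabla_YT)(X)\big)=\pi^2_{15}(R(X,Y)).$$ -/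

import Mathlib

open Bundle
open scoped Manifold ContDiff

noncomputable section

namespace QK

/-- The model space `ℝ⁸` with its Euclidean inner product. -/
abbrev E8 : Type := EuclideanSpace ℝ (Fin 8)

/-! ### Exterior algebra on a Euclidean vector space

`V [⋀^Fin k]→L[ℝ] ℝ` is the space of `k`-forms on `V`.  Sums over `stdOrthonormalBasis ℝ V` do not
depend on the orthonormal basis. -/

section Algebra

variable {V : Type*} [NormedAddCommGroup V] [InnerProductSpace ℝ V]

/-- The `1`-form `v♭ = ⟨v, ·⟩`, as a linear functional. -/
def flat (v : V) : V →L[ℝ] ℝ := innerSL ℝ v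

/-- A linear functional regarded as a `1`-form. -/
def oneForm (α : V →L[ℝ] ℝ) : V [⋀^Fin 1]→L[ℝ] ℝ :=
  ContinuousAlternatingMap.ofSubsingleton ℝ V ℝ (0 : Fin 1) α

/-- The interior product `v ⌟ η = η(v, ·, …, ·)`. -/
def contract {n : ℕ} (v : V) (η : V [⋀^Fin (n + 1)]→L[ℝ] ℝ) : V [⋀^Fin n]→L[ℝ] ℝ :=
  η.curryLeft v

/-- The wedge product `α ∧ η` of a `1`-form and an `n`-form:
`(α ∧ η)(v₀, …, vₙ) = ∑ᵢ (-1)ⁱ α(vᵢ) η(v₀, …, v̂ᵢ, …, vₙ)`. -/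
def wedgeOne {n : ℕ} (α : V →L[ℝ] ℝ) (η : V [⋀^Fin n]→L[ℝ] ℝ) : V [⋀^Fin (n + 1)]→L[ℝ] ℝ :=
  ContinuousAlternatingMap.alternatizeUncurryFin (α.smulRight η)

lemma wedgeOne_add {n : ℕ} (α : V →L[ℝ] ℝ) (η ζ : V [⋀^Fin n]→L[ℝ] ℝ) :
    wedgeOne α (η + ζ) = wedgeOne α η + wedgeOne α ζ := by
  ext v
  simp [wedgeOne, ContinuousAlternatingMap.alternatizeUncurryFin_apply,
    Finset.sum_add_distrib]

lemma wedgeOne_smul {n : ℕ} (α : V →L[ℝ] ℝ) (c : ℝ) (η : V [⋀^Fin n]→L[ℝ] ℝ) :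
    wedgeOne α (c • η) = c • wedgeOne α η := by
  ext v
  simp only [wedgeOne, ContinuousAlternatingMap.alternatizeUncurryFin_apply,
    ContinuousAlternatingMap.smul_apply, ContinuousLinearMap.smulRight_apply, smul_eq_mul,
    Finset.mul_sum]
  refine Finset.sum_congr rfl fun i _ => ?_
  simp only [zsmul_eq_mul, Int.cast_pow, Int.cast_neg, Int.cast_one]
  ring

variable [FiniteDimensional ℝ V]

/-- The wedge product `α ∧ η` of a `k`-form and an `n`-form, by recursion on `k` through
`(k + 1) α = ∑ᵢ eⁱ ∧ (eᵢ ⌟ α)`; normalised so that `dx₁ ∧ dx₂ (∂₁, ∂₂) = 1`. -/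
def wedge {n : ℕ} : (k : ℕ) → V [⋀^Fin k]→L[ℝ] ℝ → V [⋀^Fin n]→L[ℝ] ℝ → V [⋀^Fin (n + k)]→L[ℝ] ℝ
  | 0, α, η => α ![] • η
  | k + 1, α, η => ((k : ℝ) + 1)⁻¹ • ∑ i, wedgeOne (flat (stdOrthonormalBasis ℝ V i))
      (wedge k (contract (stdOrthonormalBasis ℝ V i) α) η)

/-- The derivation action of an endomorphism `A` on forms by `∑ᵢ eⁱ ∧ (A eᵢ ⌟ η)`, that is
`(v₁, …, vₙ) ↦ ∑ₐ η(v₁, …, A vₐ, …, vₙ)`. -/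
def endAct {n : ℕ} (A : V →L[ℝ] V) (η : V [⋀^Fin (n + 1)]→L[ℝ] ℝ) : V [⋀^Fin (n + 1)]→L[ℝ] ℝ :=
  ∑ i, wedgeOne (flat (stdOrthonormalBasis ℝ V i)) (contract (A (stdOrthonormalBasis ℝ V i)) η)

/-- The operator `κ ↦ κ ◇ η`, the linear extension of
`(α ∧ β) ◇ η = α ∧ (β♯ ⌟ η) - β ∧ (α♯ ⌟ η)`, for `κ = ½ ∑ᵢⱼ κ(eᵢ, eⱼ) eⁱ ∧ eʲ`. -/
def diamond {n : ℕ} (κ : V [⋀^Fin 2]→L[ℝ] ℝ) (η : V [⋀^Fin (n + 1)]→L[ℝ] ℝ) :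
    V [⋀^Fin (n + 1)]→L[ℝ] ℝ :=
  letI e := stdOrthonormalBasis ℝ V
  (1 / 2 : ℝ) • ∑ i, ∑ j, κ ![e i, e j] •
    (wedgeOne (flat (e i)) (contract (e j) η) - wedgeOne (flat (e j)) (contract (e i) η))

/-- The triple contraction `ξ ⌟₃ κ` of `4`-forms, the linear extension in `ξ` of
`(α₁∧α₂∧α₃∧α₄) ⌟₃ κ = α₁∧(α₂♯⌟α₃♯⌟α₄♯⌟κ) - α₂∧(α₁♯⌟α₃♯⌟α₄♯⌟κ) + α₃∧(α₁♯⌟α₂♯⌟α₄♯⌟κ)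
  - α₄∧(α₁♯⌟α₂♯⌟α₃♯⌟κ)`, for `ξ = 1/24 ∑ ξ(eᵢ,eⱼ,eₖ,eₗ) eⁱ∧eʲ∧eᵏ∧eˡ`. -/
def tripleContr (ξ κ : V [⋀^Fin 4]→L[ℝ] ℝ) : V [⋀^Fin 2]→L[ℝ] ℝ :=
  letI e := stdOrthonormalBasis ℝ V
  (1 / 24 : ℝ) • ∑ i, ∑ j, ∑ k, ∑ l, ξ ![e i, e j, e k, e l] •
    (wedgeOne (flat (e i)) (contract (e j) (contract (e k) (contract (e l) κ)))
      - wedgeOne (flat (e j)) (contract (e i) (contract (e k) (contract (e l) κ)))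
      + wedgeOne (flat (e k)) (contract (e i) (contract (e j) (contract (e l) κ)))
      - wedgeOne (flat (e l)) (contract (e i) (contract (e j) (contract (e k) κ))))

/-- The `2`-form with components `⟨eᵢ, A eⱼ⟩`, i.e. `½ ∑ᵢⱼ ⟨eᵢ, A eⱼ⟩ eⁱ ∧ eʲ`.  For a skew
endomorphism `A` this is `(U, W) ↦ ⟨U, A W⟩`, the identification `Λ² ≅ 𝔰𝔬(V)` under which
`α ∧ β` acts by `α♯ ⊗ β - β♯ ⊗ α`. -/
def formOfEnd (A : V →L[ℝ] V) : V [⋀^Fin 2]→L[ℝ] ℝ :=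
  letI e := stdOrthonormalBasis ℝ V
  (1 / 2 : ℝ) • ∑ i, ∑ j, (inner ℝ (e i) (A (e j)) : ℝ) •
    wedgeOne (flat (e i)) (oneForm (flat (e j)))

/-- For a unit volume form `vol` on an `8`-dimensional `V`: `α = *η` for a `6`-form `η`,
i.e. `v♭ ∧ w♭ ∧ η = α(v, w) vol` for all `v`, `w`. -/
def IsHodgeStar (vol : V [⋀^Fin 8]→L[ℝ] ℝ) (η : V [⋀^Fin 6]→L[ℝ] ℝ) (α : V [⋀^Fin 2]→L[ℝ] ℝ) :
    Prop :=
  ∀ v w : V, wedgeOne (flat v) (wedgeOne (flat w) η) = α ![v, w] • vol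

/-- The volume form `(1/30) Ω ∧ Ω`. -/
def volForm (Ω : V [⋀^Fin 4]→L[ℝ] ℝ) : V [⋀^Fin 8]→L[ℝ] ℝ := (1 / 30 : ℝ) • wedge 4 Ω Ω

lemma wedge_add {n : ℕ} (k : ℕ) (α β : V [⋀^Fin k]→L[ℝ] ℝ) (η : V [⋀^Fin n]→L[ℝ] ℝ) :
    wedge k (α + β) η = wedge k α η + wedge k β η := by
  induction k with
  | zero => simp [wedge, add_smul]
  | succ k ih =>
    simp only [wedge, contract, ContinuousAlternatingMap.curryLeft_add,
      add_apply] at ih ⊢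
    simp only [ih, wedgeOne_add, Finset.sum_add_distrib, smul_add]

lemma wedge_smul {n : ℕ} (k : ℕ) (c : ℝ) (α : V [⋀^Fin k]→L[ℝ] ℝ) (η : V [⋀^Fin n]→L[ℝ] ℝ) :
    wedge k (c • α) η = c • wedge k α η := by
  induction k with
  | zero => simp [wedge, mul_smul]
  | succ k ih =>
    simp only [wedge, contract, ContinuousAlternatingMap.curryLeft_smul,
      smul_apply] at ih ⊢
    simp only [ih, wedgeOne_smul, ← Finset.smul_sum]
    rw [smul_comm]

/-- The eigenspace `{α ∈ Λ² | *(α ∧ Ω) = c α}`. -/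
def eigenForms (Ω : V [⋀^Fin 4]→L[ℝ] ℝ) (c : ℝ) : Submodule ℝ (V [⋀^Fin 2]→L[ℝ] ℝ) where
  carrier := {α | IsHodgeStar (volForm Ω) (wedge 2 α Ω) (c • α)}
  add_mem' := by
    intro α β hα hβ v w
    have h1 := hα v w
    have h2 := hβ v w
    rw [wedge_add, wedgeOne_add, wedgeOne_add, h1, h2, ← add_smul]
    simp
  zero_mem' := by
    intro v w
    have h : wedge 2 (0 : V [⋀^Fin 2]→L[ℝ] ℝ) Ω = 0 := by
      simpa using wedge_smul 2 (0 : ℝ) (0 : V [⋀^Fin 2]→L[ℝ] ℝ) Ω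
    have h' : ∀ (m : ℕ) (u : V), wedgeOne (flat u) (0 : V [⋀^Fin m]→L[ℝ] ℝ) = 0 := by
      intro m u
      simpa using wedgeOne_smul (flat u) (0 : ℝ) (0 : V [⋀^Fin m]→L[ℝ] ℝ)
    rw [h, h', h']
    simp
  smul_mem' := by
    intro r α hα v w
    have h1 := hα v w
    rw [wedge_smul, wedgeOne_smul, wedgeOne_smul, h1, smul_smul]
    simp [mul_left_comm]

/-- `Λ²₃ = {α | *(α ∧ Ω) = 5α}`. -/
abbrev lambda3 (Ω : V [⋀^Fin 4]→L[ℝ] ℝ) : Submodule ℝ (V [⋀^Fin 2]→L[ℝ] ℝ) := eigenForms Ω 5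

/-- `Λ²₁₀ = {α | *(α ∧ Ω) = -3α}`. -/
abbrev lambda10 (Ω : V [⋀^Fin 4]→L[ℝ] ℝ) : Submodule ℝ (V [⋀^Fin 2]→L[ℝ] ℝ) := eigenForms Ω (-3)

/-- `Λ²₁₅ = {α | *(α ∧ Ω) = α}`. -/
abbrev lambda15 (Ω : V [⋀^Fin 4]→L[ℝ] ℝ) : Submodule ℝ (V [⋀^Fin 2]→L[ℝ] ℝ) := eigenForms Ω 1

open Classical in
/-- The projection `π²₁₅ : Λ² → Λ²₁₅` along `Λ²₃ ⊕ Λ²₁₀`.  (The value `0` is used only when these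
subspaces do not decompose `Λ²`, which does not occur for the forms `Ω` considered here.) -/
def pi15 (Ω : V [⋀^Fin 4]→L[ℝ] ℝ) : V [⋀^Fin 2]→L[ℝ] ℝ →ₗ[ℝ] V [⋀^Fin 2]→L[ℝ] ℝ :=
  if h : IsCompl (lambda15 Ω) (lambda3 Ω ⊔ lambda10 Ω) then (lambda15 Ω).projection (lambda3 Ω ⊔ lambda10 Ω) h else 0

end Algebra

/-! ### The model form on `ℝ⁸` -/

/-- The `2`-form `dxᵢ ∧ dxⱼ` on `ℝ⁸` (coordinates numbered `0, …, 7`). -/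
def dx2 (i j : Fin 8) : E8 [⋀^Fin 2]→L[ℝ] ℝ :=
  wedgeOne (EuclideanSpace.proj i) (oneForm (EuclideanSpace.proj j))

def omega1 : E8 [⋀^Fin 2]→L[ℝ] ℝ := dx2 0 1 + dx2 2 3 + dx2 4 5 + dx2 6 7
def omega2 : E8 [⋀^Fin 2]→L[ℝ] ℝ := dx2 0 2 - dx2 1 3 + dx2 4 6 - dx2 5 7
def omega3 : E8 [⋀^Fin 2]→L[ℝ] ℝ := dx2 0 3 + dx2 1 2 + dx2 4 7 + dx2 5 6

/-- The model form `½ (ω₁ ∧ ω₁ + ω₂ ∧ ω₂ + ω₃ ∧ ω₃)`. -/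
def modelForm : E8 [⋀^Fin 4]→L[ℝ] ℝ :=
  (1 / 2 : ℝ) • (wedge 2 omega1 omega1 + wedge 2 omega2 omega2 + wedge 2 omega3 omega3)

/-! ### Tensor calculus on a Riemannian `8`-manifold

In Mathlib the tangent space at `p` is the model space `ℝ⁸`, identified through the preferred chart
at `p`.  Tensors near `p` are read in that chart, and the Levi-Civita connection is given by the
Christoffel symbols. -/

section Geometry

variable {M : Type*} [TopologicalSpace M] [ChartedSpace E8 M]

/-- The tangent space of `M` at `p`. -/
abbrev TS (p : M) : Type := TangentSpace 𝓘(ℝ, E8) p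

/-- The preferred chart at `p`, from `M` to `ℝ⁸`. -/
abbrev chart (p : M) : PartialEquiv M E8 := extChartAt 𝓘(ℝ, E8) p

/-- The differential at `x` of the inverse of the chart at `p`; it maps the `i`-th basis vector to
the coordinate vector field `∂ᵢ`. -/
def coordVec (p : M) (x : E8) : E8 →L[ℝ] TS ((chart p).symm x) :=
  mfderiv 𝓘(ℝ, E8) 𝓘(ℝ, E8) (chart p).symm x

/-- A field of `k`-forms read in the chart at `p`. -/
def inChart {k : ℕ} (η : ∀ q : M, TS q [⋀^Fin k]→L[ℝ] ℝ) (p : M) (x : E8) :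
    E8 [⋀^Fin k]→L[ℝ] ℝ :=
  (η ((chart p).symm x)).compContinuousLinearMap (coordVec p x)

/-- Smoothness of a field of `k`-forms. -/
def IsSmoothForm {k : ℕ} (η : ∀ q : M, TS q [⋀^Fin k]→L[ℝ] ℝ) : Prop :=
  ∀ p : M, ContDiffOn ℝ ∞ (inChart η p) (chart p).target

/-- A field of `2`-form valued `1`-forms, contracted with the coordinate vector field of constant
coordinates `y` in the chart at `p`, and read in that chart. -/
def inChartOneTwo (T : ∀ q : M, TS q →ₗ[ℝ] TS q [⋀^Fin 2]→L[ℝ] ℝ) (p : M) (y x : E8) :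
    E8 [⋀^Fin 2]→L[ℝ] ℝ :=
  (T ((chart p).symm x) (coordVec p x y)).compContinuousLinearMap (coordVec p x)

/-- Smoothness of a field of `2`-form valued `1`-forms. -/
def IsSmoothOneTwo (T : ∀ q : M, TS q →ₗ[ℝ] TS q [⋀^Fin 2]→L[ℝ] ℝ) : Prop :=
  ∀ (p : M) (y : E8), ContDiffOn ℝ ∞ (inChartOneTwo T p y) (chart p).target

variable [RiemannianBundle (fun p : M => TS p)]

/-- The metric coefficients `gᵢⱼ` in the chart at `p`. -/
def gram (p : M) (x : E8) : Matrix (Fin 8) (Fin 8) ℝ :=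
  Matrix.of fun i j => inner ℝ (coordVec p x (EuclideanSpace.single i 1))
    (coordVec p x (EuclideanSpace.single j 1))

/-- `∂ₖ gᵢⱼ` in the chart at `p`. -/
def dGram (p : M) (x : E8) (k i j : Fin 8) : ℝ :=
  fderiv ℝ (fun y => gram p y i j) x (EuclideanSpace.single k 1)

/-- The Christoffel symbol `Γᵏᵢⱼ = ½ ∑ₗ gᵏˡ (∂ᵢ gⱼₗ + ∂ⱼ gᵢₗ - ∂ₗ gᵢⱼ)` in the chart at `p`. -/
def christoffel (p : M) (x : E8) (k i j : Fin 8) : ℝ :=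
  (1 / 2) * ∑ l, (gram p x)⁻¹ k l * (dGram p x i j l + dGram p x j i l - dGram p x l i j)

/-- The endomorphism `v ↦ Γ(u, v)`, with `Γ(∂ᵢ, ∂ⱼ) = ∑ₖ Γᵏᵢⱼ ∂ₖ = ∇_{∂ᵢ} ∂ⱼ`. -/
def conn (p : M) (x u : E8) : E8 →L[ℝ] E8 :=
  ∑ k, ∑ i, ∑ j, (christoffel p x k i j * u i) •
    (EuclideanSpace.proj j : E8 →L[ℝ] ℝ).smulRight (EuclideanSpace.single k (1 : ℝ))

/-- The Levi-Civita derivative at `p`, in the direction `u`, of a field `η` of forms that is given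
in the chart at `p`: `∂_u η - ∑ₐ η(…, Γ(u, vₐ), …)`. -/
def covDerivChart {k : ℕ} (p : M) (η : E8 → E8 [⋀^Fin (k + 1)]→L[ℝ] ℝ) (u : E8) :
    E8 [⋀^Fin (k + 1)]→L[ℝ] ℝ :=
  fderiv ℝ η (chart p p) u - endAct (conn p (chart p p) u) (η (chart p p))

/-- `∇_X η` at `p`, for a field `η` of forms. -/
def nablaForm {k : ℕ} (η : ∀ q : M, TS q [⋀^Fin (k + 1)]→L[ℝ] ℝ) (p : M) (X : TS p) :
    TS p [⋀^Fin (k + 1)]→L[ℝ] ℝ :=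
  covDerivChart p (inChart η p) X

/-- `(∇_X T)(Y)` at `p`: with `Y` extended by constant coordinates in the chart at `p`, this is
`∇_X (T(Y)) - T(∇_X Y)`. -/
def nablaOneTwo (T : ∀ q : M, TS q →ₗ[ℝ] TS q [⋀^Fin 2]→L[ℝ] ℝ) (p : M) (X Y : TS p) :
    TS p [⋀^Fin 2]→L[ℝ] ℝ :=
  (show TS p [⋀^Fin 2]→L[ℝ] ℝ from covDerivChart p (inChartOneTwo T p Y) X)
    - T p (conn p (chart p p) X Y)

/-- The curvature endomorphism `R(X, Y) = [∇_X, ∇_Y] - ∇_{[X, Y]}` at `p`, which in the chart at `p`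
is `(∂_X Γ)(Y, ·) - (∂_Y Γ)(X, ·) + Γ(X, Γ(Y, ·)) - Γ(Y, Γ(X, ·))`. -/
def curvature (p : M) (X Y : TS p) : TS p →L[ℝ] TS p :=
  letI x₀ : E8 := chart p p
  letI R : E8 →L[ℝ] E8 :=
    fderiv ℝ (fun x => conn p x Y) x₀ X - fderiv ℝ (fun x => conn p x X) x₀ Y
      + (conn p x₀ X).comp (conn p x₀ Y) - (conn p x₀ Y).comp (conn p x₀ X)
  R

instance (p : M) : FiniteDimensional ℝ (TS p) := inferInstanceAs (FiniteDimensional ℝ E8)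

/-- `R(X, Y)` as a `2`-form: `(U, W) ↦ g(U, R(X, Y) W)`. -/
def curvForm (p : M) (X Y : TS p) : TS p [⋀^Fin 2]→L[ℝ] ℝ := formOfEnd (curvature p X Y)

/-- `Ω` is a smooth `4`-form which induces the given Riemannian metric and defines an
`Sp(2)Sp(1)`-structure: at each point some linear isometry onto `ℝ⁸` identifies it with the model. -/
structure IsSp2Sp1Structure (Ω : ∀ q : M, TS q [⋀^Fin 4]→L[ℝ] ℝ) : Prop where
  smooth : IsSmoothForm Ω
  model : ∀ p : M, ∃ u : TS p ≃ₗᵢ[ℝ] E8,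
    Ω p = modelForm.compContinuousLinearMap (u : TS p →L[ℝ] E8)

/-- `T` is the intrinsic torsion of `Ω`: it takes values in `Λ²₁₅` and `∇_X Ω = T(X) ◇ Ω`. -/
def IsIntrinsicTorsion (Ω : ∀ q : M, TS q [⋀^Fin 4]→L[ℝ] ℝ)
    (T : ∀ q : M, TS q →ₗ[ℝ] TS q [⋀^Fin 2]→L[ℝ] ℝ) : Prop :=
  ∀ (p : M) (X : TS p), T p X ∈ lambda15 (Ω p) ∧ nablaForm Ω p X = diamond (T p X) (Ω p)

end Geometry

end QK

end

/-! The theorem rests on one algebraic identity: for a form `Ω` of the model type, `(κ ◇ Ω) ⌟₃ Ω =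
32 π₁₅(κ)` for every 2-form `κ` (`tripleContr_diamond`). It inverts `κ ↦ κ ◇ Ω` on `Λ²₁₅`, so the
torsion can only be `T(X) = (1/32) (∇_X Ω) ⌟₃ Ω`. Uniqueness is immediate, and smoothness is read
off this formula.

Existence needs `∇_X Ω` to be of the form `κ ◇ Ω`. In an isometric frame, `Ω` is a family of forms
in one orbit of `O(8)`. The connection form of such a frame is skew, and a derivative along the
orbit comes from a skew endomorphism (`exists_skew_of_orbit`, `exists_skew_frame`). Since `Λ²₃ ⊕
Λ²₁₀`, that is `𝔰𝔭(1) ⊕ 𝔰𝔭(2)`, annihilates `Ω`, the form `κ` may be replaced by its `Λ²₁₅` part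
(`diamond_proj15`).

For the first formula, differentiate `T(Y) = (1/32) (∇_Y Ω) ⌟₃ Ω`. The metric is parallel, so `⌟₃`
obeys the product rule (`fderiv_tripleContr_frame`). The products of first derivatives give the
quadratic term. After antisymmetrisation the second derivatives of `Ω` give `R(X,Y) ◇ Ω` by the
Ricci identity, and the algebraic identity turns this into `32 π₁₅(R(X,Y))`. The terms `T(∇_X Y)`
cancel because the connection is torsion-free.

For the second formula, put `κ = T(X)`, `μ = T(Y)`. Equivariance of `⌟₃` under skew endomorphisms,
applied to `(μ ◇ Ω) ⌟₃ Ω = 32 μ` and with `κ`, `μ` exchanged, shows that the quadratic term is a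
combination of the bracket `κ ◇ μ` and of `π₁₅(κ ◇ μ)`. Now `[Λ²₁₅, Λ²₁₅] ⊆ Λ²₃ ⊕ Λ²₁₀`
(`proj15_diamond`): `𝔰𝔬(8)` and `𝔰𝔭(2) ⊕ 𝔰𝔭(1)` form a symmetric pair. Hence `π₁₅` kills the
quadratic term. -/

noncomputable section

set_option linter.unusedSectionVars false

namespace QK

/-! ### Forms evaluated on vectors, and the derivation action of endomorphisms. -/

section Forms

variable {V : Type*} [NormedAddCommGroup V] [InnerProductSpace ℝ V]

lemma wedgeOne_apply {n : ℕ} (α : V →L[ℝ] ℝ) (η : V [⋀^Fin n]→L[ℝ] ℝ) (v : Fin (n + 1) → V) :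
    wedgeOne α η v = ∑ i : Fin (n + 1), (-1) ^ (i : ℕ) * (α (v i) * η (i.removeNth v)) := by
  simp [wedgeOne, ContinuousAlternatingMap.alternatizeUncurryFin_apply]

@[simp]
lemma flat_apply (v w : V) : flat v w = inner ℝ v w := rfl

@[simp]
lemma oneForm_apply (α : V →L[ℝ] ℝ) (v : Fin 1 → V) : oneForm α v = α (v 0) := rfl

@[simp]
lemma contract_apply {n : ℕ} (v : V) (η : V [⋀^Fin (n + 1)]→L[ℝ] ℝ) (w : Fin n → V) :
    contract v η w = η (Matrix.vecCons v w) := rfl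

lemma wedgeOne_apply_two (α : V →L[ℝ] ℝ) (η : V [⋀^Fin 1]→L[ℝ] ℝ) (u v : V) :
    wedgeOne α η ![u, v] = α u * η ![v] - α v * η ![u] := by
  have h0 : Fin.removeNth (0 : Fin 2) ![u, v] = ![v] := by ext i; fin_cases i; rfl
  have h1 : Fin.removeNth (1 : Fin 2) ![u, v] = ![u] := by ext i; fin_cases i; rfl
  rw [wedgeOne_apply, Fin.sum_univ_two, h0, h1]
  simp [sub_eq_add_neg]

lemma twoForm_swap (κ : V [⋀^Fin 2]→L[ℝ] ℝ) (u v : V) : κ ![u, v] = -κ ![v, u] := by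
  have h := κ.toAlternatingMap.map_swap ![v, u] (i := 0) (j := 1) (by decide)
  have e : ![v, u] ∘ Equiv.swap (0 : Fin 2) 1 = ![u, v] := by
    ext i; fin_cases i <;> rfl
  rw [e] at h
  exact h

lemma twoForm_ext {κ μ : V [⋀^Fin 2]→L[ℝ] ℝ} (h : ∀ u v, κ ![u, v] = μ ![u, v]) : κ = μ := by
  ext v
  have e : v = ![v 0, v 1] := by ext i; fin_cases i <;> rfl
  rw [e]; exact h _ _

/-- The value of a `2`-form as a bilinear map. -/
def bil (κ : V [⋀^Fin 2]→L[ℝ] ℝ) : V →ₗ[ℝ] V →ₗ[ℝ] ℝ :=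
  LinearMap.mk₂ ℝ (fun u v => κ ![u, v])
    (fun u u' v => κ.toAlternatingMap.map_vecCons_add ![v] u u')
    (fun c u v => κ.toAlternatingMap.map_vecCons_smul ![v] c u)
    (fun u v v' => by
      rw [twoForm_swap κ u, twoForm_swap κ u v, twoForm_swap κ u v']
      have := κ.toAlternatingMap.map_vecCons_add ![u] v v'
      simp only [ContinuousAlternatingMap.coe_toAlternatingMap] at this
      rw [this]; ring)
    (fun c u v => by
      rw [twoForm_swap κ u, twoForm_swap κ u v]
      have := κ.toAlternatingMap.map_vecCons_smul ![u] c v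
      simp only [ContinuousAlternatingMap.coe_toAlternatingMap] at this
      rw [this]; simp)

lemma bil_apply (κ : V [⋀^Fin 2]→L[ℝ] ℝ) (u v : V) : bil κ u v = κ ![u, v] := rfl

lemma map_update_sum_smul {ι : Type*} {n : ℕ} (s : Finset ι) (η : V [⋀^Fin n]→L[ℝ] ℝ) (m : Fin n)
    (v : Fin n → V) (c : ι → ℝ) (x : ι → V) :
    η (Function.update v m (∑ i ∈ s, c i • x i))
      = ∑ i ∈ s, c i * η (Function.update v m (x i)) := by
  have := η.toAlternatingMap.toMultilinearMap.map_update_sum s m (fun i => c i • x i) v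
  simp only [MultilinearMap.map_update_smul, smul_eq_mul] at this
  exact this

lemma map_update_onb {ι : Type*} [Fintype ι] {n : ℕ} (b : OrthonormalBasis ι ℝ V)
    (η : V [⋀^Fin n]→L[ℝ] ℝ) (m : Fin n) (v : Fin n → V) (A : V →L[ℝ] V) (x : V) :
    ∑ i, inner ℝ (b i) x * η (Function.update v m (A (b i))) = η (Function.update v m (A x)) := by
  have h := map_update_sum_smul Finset.univ η m v (fun i => (inner ℝ (b i) x : ℝ)) fun i => A (b i)
  rw [← h]
  simp only [← map_smul, ← map_sum, b.sum_repr']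

/-- Expand `A (v a)` through the basis expansion of `v a`. Moving that argument to the front costs
`(-1)^a`, which cancels the sign in the wedge product. -/
lemma sum_wedgeOne_contract_apply {ι : Type*} [Fintype ι] {n : ℕ} (b : OrthonormalBasis ι ℝ V)
    (A : V →L[ℝ] V) (η : V [⋀^Fin (n + 1)]→L[ℝ] ℝ) (v : Fin (n + 1) → V) :
    (∑ i, wedgeOne (flat (b i)) (contract (A (b i)) η)) v
      = ∑ a, η (Function.update v a (A (v a))) := by
  simp only [ContinuousAlternatingMap.sum_apply, wedgeOne_apply, contract_apply, flat_apply]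
  rw [Finset.sum_comm]
  refine Finset.sum_congr rfl fun a _ => ?_
  rw [← map_update_onb b η a v A (v a)]
  refine Finset.sum_congr rfl fun i _ => ?_
  have h := η.neg_one_pow_smul_map_insertNth a (A (b i)) (a.removeNth v)
  rw [Fin.insertNth_removeNth] at h
  have h' : η (Function.update v a (A (b i)))
      = (-1) ^ (a : ℕ) * η (Matrix.vecCons (A (b i)) (a.removeNth v)) := by
    rw [← h, zsmul_eq_mul]
    push_cast
    rw [← mul_assoc, ← mul_pow]
    simp
  rw [h']
  ring

lemma fourForm_swap01 (η : V [⋀^Fin 4]→L[ℝ] ℝ) (a b c d : V) :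
    η ![b, a, c, d] = -η ![a, b, c, d] := by
  have h := η.toAlternatingMap.map_swap ![a, b, c, d] (i := 0) (j := 1) (by decide)
  have e : ![a, b, c, d] ∘ Equiv.swap (0 : Fin 4) 1 = ![b, a, c, d] := by
    funext i; fin_cases i <;> rfl
  rw [e] at h
  exact h

lemma fourForm_swap12 (η : V [⋀^Fin 4]→L[ℝ] ℝ) (a b c d : V) :
    η ![a, c, b, d] = -η ![a, b, c, d] := by
  have h := η.toAlternatingMap.map_swap ![a, b, c, d] (i := 1) (j := 2) (by decide)
  have e : ![a, b, c, d] ∘ Equiv.swap (1 : Fin 4) 2 = ![a, c, b, d] := by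
    funext i; fin_cases i <;> rfl
  rw [e] at h
  exact h

lemma fourForm_swap23 (η : V [⋀^Fin 4]→L[ℝ] ℝ) (a b c d : V) :
    η ![a, b, d, c] = -η ![a, b, c, d] := by
  have h := η.toAlternatingMap.map_swap ![a, b, c, d] (i := 2) (j := 3) (by decide)
  have e : ![a, b, c, d] ∘ Equiv.swap (2 : Fin 4) 3 = ![a, b, d, c] := by
    funext i; fin_cases i <;> rfl
  rw [e] at h
  exact h

lemma sum_mul_onb {ι : Type*} [Fintype ι] (b : OrthonormalBasis ι ℝ V) {s t : V → ℝ} {p q : V}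
    (hs : ∀ x, s x = inner ℝ p x) (ht : ∀ x, t x = inner ℝ q x) :
    ∑ i, s (b i) * t (b i) = inner ℝ p q := by
  rw [← b.sum_inner_mul_inner]
  refine Finset.sum_congr rfl fun i _ => ?_
  rw [hs, ht, real_inner_comm q]

variable [FiniteDimensional ℝ V]

lemma endAct_apply {n : ℕ} (A : V →L[ℝ] V) (η : V [⋀^Fin (n + 1)]→L[ℝ] ℝ) (v : Fin (n + 1) → V) :
    endAct A η v = ∑ a, η (Function.update v a (A (v a))) :=
  sum_wedgeOne_contract_apply _ A η v

/-- The action is the derivative at the identity of `g ↦ η ∘ g`; linearity and continuity in `A`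
follow from this. -/
lemma endAct_eq_fderiv {n : ℕ} (A : V →L[ℝ] V) (η : V [⋀^Fin (n + 1)]→L[ℝ] ℝ) :
    endAct A η = η.fderivCompContinuousLinearMap (ContinuousLinearMap.id ℝ V) A := by
  ext v
  rw [endAct_apply, ContinuousAlternatingMap.fderivCompContinuousLinearMap_apply]
  refine Finset.sum_congr rfl fun a _ => ?_
  congr 1
  funext j
  rcases eq_or_ne j a with rfl | h <;> simp [*]

lemma endAct_apply_two (A : V →L[ℝ] V) (κ : V [⋀^Fin 2]→L[ℝ] ℝ) (u v : V) :
    endAct A κ ![u, v] = κ ![A u, v] + κ ![u, A v] := by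
  rw [endAct_apply, Fin.sum_univ_two]
  congr 2 <;> (ext i; fin_cases i <;> rfl)

lemma endAct_apply_four (A : V →L[ℝ] V) (η : V [⋀^Fin 4]→L[ℝ] ℝ) (a b c d : V) :
    endAct A η ![a, b, c, d]
      = η ![A a, b, c, d] + η ![a, A b, c, d] + η ![a, b, A c, d] + η ![a, b, c, A d] := by
  have e0 : ∀ x, Function.update ![a, b, c, d] 0 x = ![x, b, c, d] := fun x => by
    funext i; fin_cases i <;> rfl
  have e1 : ∀ x, Function.update ![a, b, c, d] 1 x = ![a, x, c, d] := fun x => by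
    funext i; fin_cases i <;> rfl
  have e2 : ∀ x, Function.update ![a, b, c, d] 2 x = ![a, b, x, d] := fun x => by
    funext i; fin_cases i <;> rfl
  have e3 : ∀ x, Function.update ![a, b, c, d] 3 x = ![a, b, c, x] := fun x => by
    funext i; fin_cases i <;> rfl
  simp [endAct_apply, Fin.sum_univ_four, e0, e1, e2, e3]

lemma endAct_add {n : ℕ} (A B : V →L[ℝ] V) (η : V [⋀^Fin (n + 1)]→L[ℝ] ℝ) :
    endAct (A + B) η = endAct A η + endAct B η := by
  simp [endAct_eq_fderiv]

lemma endAct_sub {n : ℕ} (A B : V →L[ℝ] V) (η : V [⋀^Fin (n + 1)]→L[ℝ] ℝ) :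
    endAct (A - B) η = endAct A η - endAct B η := by
  simp [endAct_eq_fderiv]

lemma endAct_neg {n : ℕ} (A : V →L[ℝ] V) (η : V [⋀^Fin (n + 1)]→L[ℝ] ℝ) :
    endAct (-A) η = -endAct A η := by
  simp [endAct_eq_fderiv]

lemma endAct_smul {n : ℕ} (c : ℝ) (A : V →L[ℝ] V) (η : V [⋀^Fin (n + 1)]→L[ℝ] ℝ) :
    endAct (c • A) η = c • endAct A η := by
  simp [endAct_eq_fderiv]

lemma endAct_form_sub {n : ℕ} (A : V →L[ℝ] V) (η ζ : V [⋀^Fin (n + 1)]→L[ℝ] ℝ) :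
    endAct A (η - ζ) = endAct A η - endAct A ζ := by
  ext v; simp [endAct_apply, Finset.sum_sub_distrib]

lemma endAct_form_smul {n : ℕ} (A : V →L[ℝ] V) (c : ℝ) (η : V [⋀^Fin (n + 1)]→L[ℝ] ℝ) :
    endAct A (c • η) = c • endAct A η := by
  ext v; simp [endAct_apply, Finset.mul_sum]

/-- The derivation action is an anti-homomorphism of Lie algebras. -/
lemma endAct_comm_four (A B : V →L[ℝ] V) (η : V [⋀^Fin 4]→L[ℝ] ℝ) :
    endAct A (endAct B η) - endAct B (endAct A η) = endAct (B.comp A - A.comp B) η := by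
  refine ContinuousAlternatingMap.ext fun v => ?_
  have e : v = ![v 0, v 1, v 2, v 3] := by funext i; fin_cases i <;> rfl
  rw [e, endAct_sub, ContinuousAlternatingMap.sub_apply, ContinuousAlternatingMap.sub_apply]
  simp only [endAct_apply_four, ContinuousLinearMap.comp_apply]
  ring

/-- Pullback intertwines the derivation actions of intertwined endomorphisms. -/
lemma endAct_comp {W : Type*} [NormedAddCommGroup W] [InnerProductSpace ℝ W]
    [FiniteDimensional ℝ W] {n : ℕ} (A : V →L[ℝ] V) (B : W →L[ℝ] W) (j : V →L[ℝ] W)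
    (h : ∀ v, j (A v) = B (j v)) (η : W [⋀^Fin (n + 1)]→L[ℝ] ℝ) :
    endAct A (η.compContinuousLinearMap j) = (endAct B η).compContinuousLinearMap j := by
  ext v
  simp only [endAct_apply, ContinuousAlternatingMap.compContinuousLinearMap_apply]
  refine Finset.sum_congr rfl fun a _ => ?_
  congr 1
  funext i
  rcases eq_or_ne i a with rfl | hi <;> simp [*]

/-- A linear functional is the inner product with a vector. -/
lemma exists_inner_eq (s : V →ₗ[ℝ] ℝ) : ∃ p : V, ∀ x, s x = inner ℝ p x :=
  ⟨(InnerProductSpace.toDual ℝ V).symm (LinearMap.toContinuousLinearMap s), fun x => by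
    rw [InnerProductSpace.toDual_symm_apply]; rfl⟩

lemma fourForm_slot (η : V [⋀^Fin 4]→L[ℝ] ℝ) (v : Fin 4 → V) (m : Fin 4) :
    ∃ p : V, ∀ x, η (Function.update v m x) = inner ℝ p x :=
  exists_inner_eq (η.toMultilinearMap.toLinearMap v m)

lemma fourForm_slot1 (η : V [⋀^Fin 4]→L[ℝ] ℝ) (a c d : V) :
    ∃ p : V, ∀ x, η ![a, x, c, d] = inner ℝ p x := by
  obtain ⟨p, hp⟩ := fourForm_slot η ![a, 0, c, d] 1
  exact ⟨p, fun x => by rw [← hp]; congr 1; funext i; fin_cases i <;> rfl⟩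

lemma fourForm_slot2 (η : V [⋀^Fin 4]→L[ℝ] ℝ) (a b d : V) :
    ∃ p : V, ∀ x, η ![a, b, x, d] = inner ℝ p x := by
  obtain ⟨p, hp⟩ := fourForm_slot η ![a, b, 0, d] 2
  exact ⟨p, fun x => by rw [← hp]; congr 1; funext i; fin_cases i <;> rfl⟩

lemma fourForm_slot3 (η : V [⋀^Fin 4]→L[ℝ] ℝ) (a b c : V) :
    ∃ p : V, ∀ x, η ![a, b, c, x] = inner ℝ p x := by
  obtain ⟨p, hp⟩ := fourForm_slot η ![a, b, c, 0] 3
  exact ⟨p, fun x => by rw [← hp]; congr 1; funext i; fin_cases i <;> rfl⟩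

/-! ### The triple contraction: basis independence and equivariance. -/

section Triple

variable {ι ι' : Type*} [Fintype ι] [Fintype ι']

/-- The contraction of two `4`-forms in three arguments. -/
def contr3 (b : OrthonormalBasis ι ℝ V) (ξ κ : V [⋀^Fin 4]→L[ℝ] ℝ) (u v : V) : ℝ :=
  ∑ i, ∑ j, ∑ k, ξ ![u, b i, b j, b k] * κ ![v, b i, b j, b k]

/-- Infinitesimal invariance of the inner product: the two sums are `⟨-A p, q⟩` and `⟨p, -A q⟩` for
the vectors `p`, `q` representing `s`, `t`. -/
lemma sum_mul_onb_skew (b : OrthonormalBasis ι ℝ V) {A : V →L[ℝ] V}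
    (hA : ∀ x y, inner ℝ (A x) y = -inner ℝ x (A y)) {s t : V → ℝ} (hs : ∃ p, ∀ x, s x = inner ℝ p x)
    (ht : ∃ q, ∀ x, t x = inner ℝ q x) :
    ∑ i, s (A (b i)) * t (b i) + ∑ i, s (b i) * t (A (b i)) = 0 := by
  obtain ⟨p, hs⟩ := hs
  obtain ⟨q, ht⟩ := ht
  have h1 := sum_mul_onb b (s := fun x => s (A x)) (t := t) (p := -A p) (q := q)
    (fun x => by rw [hs, inner_neg_left, hA, neg_neg]) ht
  have h2 := sum_mul_onb b (s := s) (t := fun x => t (A x)) (p := p) (q := -A q) hs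
    (fun x => by rw [ht, inner_neg_left, hA, neg_neg])
  rw [h1, h2, inner_neg_left, inner_neg_right, hA]
  ring

lemma sum_mul_onb_indep (b : OrthonormalBasis ι ℝ V) (b' : OrthonormalBasis ι' ℝ V) {s t : V → ℝ}
    (hs : ∃ p, ∀ x, s x = inner ℝ p x) (ht : ∃ q, ∀ x, t x = inner ℝ q x) :
    ∑ i, s (b i) * t (b i) = ∑ i, s (b' i) * t (b' i) := by
  obtain ⟨p, hs⟩ := hs
  obtain ⟨q, ht⟩ := ht
  rw [sum_mul_onb b hs ht, sum_mul_onb b' hs ht]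

/-- The basis is exchanged in one slot at a time. This frees `tripleContr` from the standard basis
of its definition, so that adapted and transported bases can be used. -/
lemma contr3_indep (b : OrthonormalBasis ι ℝ V) (b' : OrthonormalBasis ι' ℝ V)
    (ξ κ : V [⋀^Fin 4]→L[ℝ] ℝ) (u v : V) : contr3 b ξ κ u v = contr3 b' ξ κ u v := by
  unfold contr3
  have h1 : ∀ x y, ∑ k, ξ ![u, x, y, b k] * κ ![v, x, y, b k]
      = ∑ k, ξ ![u, x, y, b' k] * κ ![v, x, y, b' k] := fun x y =>
    sum_mul_onb_indep b b' (fourForm_slot3 ξ _ _ _) (fourForm_slot3 κ _ _ _)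
  have h2 : ∀ x y, ∑ k, ξ ![u, x, b k, y] * κ ![v, x, b k, y]
      = ∑ k, ξ ![u, x, b' k, y] * κ ![v, x, b' k, y] := fun x y =>
    sum_mul_onb_indep b b' (fourForm_slot2 ξ _ _ _) (fourForm_slot2 κ _ _ _)
  have h3 : ∀ x y, ∑ k, ξ ![u, b k, x, y] * κ ![v, b k, x, y]
      = ∑ k, ξ ![u, b' k, x, y] * κ ![v, b' k, x, y] := fun x y =>
    sum_mul_onb_indep b b' (fourForm_slot1 ξ _ _ _) (fourForm_slot1 κ _ _ _)
  simp only [h1]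
  have h4 : ∀ x, ∑ j, ∑ k, ξ ![u, x, b j, b' k] * κ ![v, x, b j, b' k]
      = ∑ j, ∑ k, ξ ![u, x, b' j, b' k] * κ ![v, x, b' j, b' k] := fun x => by
    rw [Finset.sum_comm]
    simp only [h2]
    exact Finset.sum_comm
  simp only [h4]
  have h5 : ∀ y, ∑ i, ∑ k, ξ ![u, b i, y, b' k] * κ ![v, b i, y, b' k]
      = ∑ i, ∑ k, ξ ![u, b' i, y, b' k] * κ ![v, b' i, y, b' k] := fun y => by
    rw [Finset.sum_comm]
    simp only [h3]
    exact Finset.sum_comm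
  rw [Finset.sum_comm]
  simp only [h5]
  exact Finset.sum_comm

lemma sum_rotate {α : Type*} [AddCommMonoid α] (f : ι → ι → ι → ι → α) :
    ∑ i, ∑ j, ∑ k, ∑ l, f i j k l = ∑ j, ∑ k, ∑ l, ∑ i, f i j k l := by
  rw [Finset.sum_comm]
  refine Finset.sum_congr rfl fun j _ => ?_
  rw [Finset.sum_comm]
  exact Finset.sum_congr rfl fun k _ => Finset.sum_comm

/-- Antisymmetrising the coefficients of a sum against an antisymmetric tensor. -/
lemma sum_antisymm (x G : ι → ι → ι → ι → ℝ) (h01 : ∀ i j k l, x j i k l = -x i j k l)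
    (h12 : ∀ i j k l, x i k j l = -x i j k l) (h23 : ∀ i j k l, x i j l k = -x i j k l) :
    ∑ i, ∑ j, ∑ k, ∑ l, x i j k l * (G i j k l - G j i k l + G k i j l - G l i j k)
      = 4 * ∑ i, ∑ j, ∑ k, ∑ l, x i j k l * G i j k l := by
  have p2 : ∑ i, ∑ j, ∑ k, ∑ l, x i j k l * G j i k l
      = -∑ i, ∑ j, ∑ k, ∑ l, x i j k l * G i j k l := by
    rw [Finset.sum_comm]
    simp only [← Finset.sum_neg_distrib]
    refine Finset.sum_congr rfl fun i _ => Finset.sum_congr rfl fun j _ =>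
      Finset.sum_congr rfl fun k _ => Finset.sum_congr rfl fun l _ => ?_
    rw [h01]; ring
  have p3 : ∑ i, ∑ j, ∑ k, ∑ l, x i j k l * G k i j l
      = ∑ i, ∑ j, ∑ k, ∑ l, x i j k l * G i j k l := by
    have : ∀ i, ∑ j, ∑ k, ∑ l, x i j k l * G k i j l = ∑ k, ∑ j, ∑ l, x i j k l * G k i j l :=
      fun i => Finset.sum_comm
    simp only [this]
    rw [Finset.sum_comm]
    refine Finset.sum_congr rfl fun i _ => Finset.sum_congr rfl fun j _ =>
      Finset.sum_congr rfl fun k _ => Finset.sum_congr rfl fun l _ => ?_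
    rw [h12, h01]; ring
  have p4 : ∑ i, ∑ j, ∑ k, ∑ l, x i j k l * G l i j k
      = -∑ i, ∑ j, ∑ k, ∑ l, x i j k l * G i j k l := by
    rw [sum_rotate (fun i j k l => x i j k l * G i j k l)]
    simp only [← Finset.sum_neg_distrib]
    refine Finset.sum_congr rfl fun i _ => Finset.sum_congr rfl fun j _ =>
      Finset.sum_congr rfl fun k _ => Finset.sum_congr rfl fun l _ => ?_
    rw [h23, h12, h01]; ring
  simp only [mul_sub, mul_add, Finset.sum_sub_distrib, Finset.sum_add_distrib]
  rw [p2, p3, p4]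
  ring

/-- The four terms of the definition agree once summed against the antisymmetric `ξ`, whence `1/6 =
4/24`. -/
lemma tripleContr_apply (b : OrthonormalBasis ι ℝ V) (ξ κ : V [⋀^Fin 4]→L[ℝ] ℝ) (u v : V) :
    tripleContr ξ κ ![u, v] = (1 / 6) * (contr3 b ξ κ u v - contr3 b ξ κ v u) := by
  rw [contr3_indep b (stdOrthonormalBasis ℝ V), contr3_indep b (stdOrthonormalBasis ℝ V)]
  set e := stdOrthonormalBasis ℝ V with he
  have hc : ∀ u v, contr3 e ξ κ u v
      = ∑ i, ∑ j, ∑ k, ∑ l, ξ ![e i, e j, e k, e l] * (inner ℝ (e i) u * κ ![v, e j, e k, e l]) := by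
    intro u v
    have h : ∀ x y z, ∑ i, ξ ![e i, x, y, z] * inner ℝ (e i) u = ξ ![u, x, y, z] := fun x y z => by
      have := map_update_onb e ξ 0 ![0, x, y, z] (ContinuousLinearMap.id ℝ V) u
      have e0 : ∀ t, Function.update ![0, x, y, z] 0 t = ![t, x, y, z] := fun t => by
        funext i; fin_cases i <;> rfl
      simpa only [e0, ContinuousLinearMap.id_apply, mul_comm] using this
    rw [sum_rotate]
    simp only [contr3, ← h, Finset.sum_mul, mul_assoc]
  -- Iterated interior products feed the vectors to `κ` in reverse order; reversing four arguments
  -- is an even permutation.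
  have rev : ∀ a b c d, κ ![a, b, c, d] = κ ![d, c, b, a] := fun a b c d => by
    rw [fourForm_swap01, fourForm_swap12, fourForm_swap23, fourForm_swap01 κ c b,
      fourForm_swap12 κ c, fourForm_swap01 κ d c]
    ring
  have key : tripleContr ξ κ ![u, v] = (1 / 24) * ∑ i, ∑ j, ∑ k, ∑ l, ξ ![e i, e j, e k, e l] *
      ((fun i j k l => inner ℝ (e i) u * κ ![v, e j, e k, e l]
        - inner ℝ (e i) v * κ ![u, e j, e k, e l]) i j k l
      - (fun i j k l => inner ℝ (e i) u * κ ![v, e j, e k, e l]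
        - inner ℝ (e i) v * κ ![u, e j, e k, e l]) j i k l
      + (fun i j k l => inner ℝ (e i) u * κ ![v, e j, e k, e l]
        - inner ℝ (e i) v * κ ![u, e j, e k, e l]) k i j l
      - (fun i j k l => inner ℝ (e i) u * κ ![v, e j, e k, e l]
        - inner ℝ (e i) v * κ ![u, e j, e k, e l]) l i j k) := by
    simp only [tripleContr, ← he, ContinuousAlternatingMap.smul_apply,
      ContinuousAlternatingMap.sum_apply, ContinuousAlternatingMap.sub_apply,
      ContinuousAlternatingMap.add_apply, smul_eq_mul, wedgeOne_apply_two, contract_apply,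
      flat_apply, rev _ _ _ u, rev _ _ _ v]
  have hs := sum_antisymm (fun i j k l => ξ ![e i, e j, e k, e l])
    (fun i j k l => inner ℝ (e i) u * κ ![v, e j, e k, e l]
        - inner ℝ (e i) v * κ ![u, e j, e k, e l]) (fun i j k l => fourForm_swap01 ξ _ _ _ _)
    (fun i j k l => fourForm_swap12 ξ _ _ _ _) (fun i j k l => fourForm_swap23 ξ _ _ _ _)
  refine key.trans ((congrArg ((1 / 24 : ℝ) * ·) hs).trans ?_)
  simp only [hc u v, hc v u, mul_sub, Finset.sum_sub_distrib]
  ring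

/-- By skewness the action of `A` on each of the three contracted slots cancels between `ξ` and `κ`;
only the action on the free slots `u`, `v` remains. -/
lemma contr3_endAct (b : OrthonormalBasis ι ℝ V) {A : V →L[ℝ] V}
    (hA : ∀ x y, inner ℝ (A x) y = -inner ℝ x (A y)) (ξ κ : V [⋀^Fin 4]→L[ℝ] ℝ) (u v : V) :
    contr3 b (endAct A ξ) κ u v + contr3 b ξ (endAct A κ) u v
      = contr3 b ξ κ (A u) v + contr3 b ξ κ u (A v) := by
  have h1 : ∀ x y, ∑ i, ξ ![u, A (b i), x, y] * κ ![v, b i, x, y]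
      + ∑ i, ξ ![u, b i, x, y] * κ ![v, A (b i), x, y] = 0 := fun x y =>
    sum_mul_onb_skew b hA (fourForm_slot1 ξ _ _ _) (fourForm_slot1 κ _ _ _)
  have h2 : ∀ x y, ∑ i, ξ ![u, x, A (b i), y] * κ ![v, x, b i, y]
      + ∑ i, ξ ![u, x, b i, y] * κ ![v, x, A (b i), y] = 0 := fun x y =>
    sum_mul_onb_skew b hA (fourForm_slot2 ξ _ _ _) (fourForm_slot2 κ _ _ _)
  have h3 : ∀ x y, ∑ i, ξ ![u, x, y, A (b i)] * κ ![v, x, y, b i]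
      + ∑ i, ξ ![u, x, y, b i] * κ ![v, x, y, A (b i)] = 0 := fun x y =>
    sum_mul_onb_skew b hA (fourForm_slot3 ξ _ _ _) (fourForm_slot3 κ _ _ _)
  have k1 : ∑ i, ∑ j, ∑ k, (ξ ![u, A (b i), b j, b k] * κ ![v, b i, b j, b k]
      + ξ ![u, b i, b j, b k] * κ ![v, A (b i), b j, b k]) = 0 := by
    rw [Finset.sum_comm]
    refine Finset.sum_eq_zero fun j _ => ?_
    rw [Finset.sum_comm]
    refine Finset.sum_eq_zero fun k _ => ?_
    rw [Finset.sum_add_distrib]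
    exact h1 _ _
  have k2 : ∑ i, ∑ j, ∑ k, (ξ ![u, b i, A (b j), b k] * κ ![v, b i, b j, b k]
      + ξ ![u, b i, b j, b k] * κ ![v, b i, A (b j), b k]) = 0 := by
    refine Finset.sum_eq_zero fun i _ => ?_
    rw [Finset.sum_comm]
    refine Finset.sum_eq_zero fun k _ => ?_
    rw [Finset.sum_add_distrib]
    exact h2 _ _
  have k3 : ∑ i, ∑ j, ∑ k, (ξ ![u, b i, b j, A (b k)] * κ ![v, b i, b j, b k]
      + ξ ![u, b i, b j, b k] * κ ![v, b i, b j, A (b k)]) = 0 := by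
    refine Finset.sum_eq_zero fun i _ => Finset.sum_eq_zero fun j _ => ?_
    rw [Finset.sum_add_distrib]
    exact h3 _ _
  rw [← sub_eq_zero]
  have h0 := congrArg₂ (· + ·) (congrArg₂ (· + ·) k1 k2) k3
  simp only [add_zero] at h0
  rw [← h0]
  simp only [contr3, ← Finset.sum_add_distrib, ← Finset.sum_sub_distrib, endAct_apply_four]
  refine Finset.sum_congr rfl fun i _ => Finset.sum_congr rfl fun j _ =>
    Finset.sum_congr rfl fun k _ => ?_
  ring

end Triple

/-- The triple contraction is equivariant under skew endomorphisms. -/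
lemma endAct_tripleContr {A : V →L[ℝ] V} (hA : ∀ x y, inner ℝ (A x) y = -inner ℝ x (A y))
    (ξ κ : V [⋀^Fin 4]→L[ℝ] ℝ) :
    endAct A (tripleContr ξ κ) = tripleContr (endAct A ξ) κ + tripleContr ξ (endAct A κ) := by
  refine twoForm_ext fun u v => ?_
  have b := stdOrthonormalBasis ℝ V
  rw [ContinuousAlternatingMap.add_apply, endAct_apply_two]
  simp only [tripleContr_apply b]
  linear_combination (-1 / 6) * contr3_endAct b hA ξ κ u v + (1 / 6) * contr3_endAct b hA ξ κ v u

lemma tripleContr_comp {W : Type*} [NormedAddCommGroup W] [InnerProductSpace ℝ W]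
    [FiniteDimensional ℝ W] (j : V ≃ₗᵢ[ℝ] W) (ξ κ : W [⋀^Fin 4]→L[ℝ] ℝ) :
    tripleContr (ξ.compContinuousLinearMap (j : V →L[ℝ] W))
      (κ.compContinuousLinearMap (j : V →L[ℝ] W))
      = (tripleContr ξ κ).compContinuousLinearMap (j : V →L[ℝ] W) := by
  refine twoForm_ext fun u v => ?_
  have b := stdOrthonormalBasis ℝ V
  have e2 : (j : V →L[ℝ] W) ∘ ![u, v] = ![j u, j v] := by funext i; fin_cases i <;> rfl
  have e4 : ∀ x y z w, (j : V →L[ℝ] W) ∘ ![x, y, z, w] = ![j x, j y, j z, j w] :=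
    fun x y z w => by funext i; fin_cases i <;> rfl
  rw [ContinuousAlternatingMap.compContinuousLinearMap_apply, e2, tripleContr_apply b,
    tripleContr_apply (b.map j)]
  simp only [contr3, ContinuousAlternatingMap.compContinuousLinearMap_apply, e4,
    OrthonormalBasis.map_apply]

lemma contr3_add_left {ι : Type*} [Fintype ι] (b : OrthonormalBasis ι ℝ V)
    (ξ ξ' κ : V [⋀^Fin 4]→L[ℝ] ℝ) (u v : V) :
    contr3 b (ξ + ξ') κ u v = contr3 b ξ κ u v + contr3 b ξ' κ u v := by
  simp [contr3, add_mul, Finset.sum_add_distrib]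

lemma contr3_add_right {ι : Type*} [Fintype ι] (b : OrthonormalBasis ι ℝ V)
    (ξ κ κ' : V [⋀^Fin 4]→L[ℝ] ℝ) (u v : V) :
    contr3 b ξ (κ + κ') u v = contr3 b ξ κ u v + contr3 b ξ κ' u v := by
  simp [contr3, mul_add, Finset.sum_add_distrib]

lemma contr3_smul_left {ι : Type*} [Fintype ι] (b : OrthonormalBasis ι ℝ V) (c : ℝ)
    (ξ κ : V [⋀^Fin 4]→L[ℝ] ℝ) (u v : V) : contr3 b (c • ξ) κ u v = c * contr3 b ξ κ u v := by
  simp [contr3, Finset.mul_sum, mul_assoc]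

lemma contr3_smul_right {ι : Type*} [Fintype ι] (b : OrthonormalBasis ι ℝ V) (c : ℝ)
    (ξ κ : V [⋀^Fin 4]→L[ℝ] ℝ) (u v : V) : contr3 b ξ (c • κ) u v = c * contr3 b ξ κ u v := by
  simp [contr3, Finset.mul_sum, mul_left_comm]

/-- The triple contraction as a bilinear map. -/
def tripleContrL : (V [⋀^Fin 4]→L[ℝ] ℝ) →ₗ[ℝ] (V [⋀^Fin 4]→L[ℝ] ℝ) →ₗ[ℝ] V [⋀^Fin 2]→L[ℝ] ℝ :=
  LinearMap.mk₂ ℝ tripleContr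
    (fun ξ ξ' κ => twoForm_ext fun u v => by
      simp only [ContinuousAlternatingMap.add_apply, tripleContr_apply (stdOrthonormalBasis ℝ V),
        contr3_add_left]
      ring)
    (fun c ξ κ => twoForm_ext fun u v => by
      simp only [ContinuousAlternatingMap.smul_apply, tripleContr_apply (stdOrthonormalBasis ℝ V),
        contr3_smul_left, smul_eq_mul]
      ring)
    (fun ξ κ κ' => twoForm_ext fun u v => by
      simp only [ContinuousAlternatingMap.add_apply, tripleContr_apply (stdOrthonormalBasis ℝ V),
        contr3_add_right]
      ring)
    (fun c ξ κ => twoForm_ext fun u v => by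
      simp only [ContinuousAlternatingMap.smul_apply, tripleContr_apply (stdOrthonormalBasis ℝ V),
        contr3_smul_right, smul_eq_mul]
      ring)

lemma tripleContrL_apply (ξ κ : V [⋀^Fin 4]→L[ℝ] ℝ) : tripleContrL ξ κ = tripleContr ξ κ := rfl

/-- The endomorphism `K` with `κ(u, v) = ⟨u, K v⟩`. -/
def endOf (κ : V [⋀^Fin 2]→L[ℝ] ℝ) : V →L[ℝ] V :=
  LinearMap.toContinuousLinearMap
    (∑ i, (bil κ (stdOrthonormalBasis ℝ V i)).smulRight (stdOrthonormalBasis ℝ V i))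

lemma endOf_apply (κ : V [⋀^Fin 2]→L[ℝ] ℝ) (v : V) :
    endOf κ v = ∑ i, κ ![stdOrthonormalBasis ℝ V i, v] • stdOrthonormalBasis ℝ V i := by
  simp [endOf, bil_apply]

lemma inner_endOf (κ : V [⋀^Fin 2]→L[ℝ] ℝ) (u v : V) : inner ℝ u (endOf κ v) = κ ![u, v] := by
  set e := stdOrthonormalBasis ℝ V with he
  rw [endOf_apply, ← he, inner_sum, ← bil_apply]
  conv_rhs => rw [← e.sum_repr' u, map_sum, LinearMap.sum_apply]
  refine Finset.sum_congr rfl fun i _ => ?_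
  rw [inner_smul_right, map_smul, LinearMap.smul_apply, bil_apply, smul_eq_mul, mul_comm,
    real_inner_comm]

lemma endOf_skew (κ : V [⋀^Fin 2]→L[ℝ] ℝ) (x y : V) :
    inner ℝ (endOf κ x) y = -inner ℝ x (endOf κ y) := by
  rw [real_inner_comm, inner_endOf, inner_endOf, twoForm_swap]

lemma wedgeOne_contract_sum {n : ℕ} {ι : Type*} (s : Finset ι) (α : V →L[ℝ] ℝ) (c : ι → ℝ)
    (x : ι → V) (η : V [⋀^Fin (n + 1)]→L[ℝ] ℝ) :
    wedgeOne α (contract (∑ i ∈ s, c i • x i) η) = ∑ i ∈ s, c i • wedgeOne α (contract (x i) η) := by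
  have h : contract (∑ i ∈ s, c i • x i) η = ∑ i ∈ s, c i • contract (x i) η := by
    simp only [contract, map_sum, map_smul]
  rw [h]
  let L : (V [⋀^Fin n]→L[ℝ] ℝ) →ₗ[ℝ] V [⋀^Fin (n + 1)]→L[ℝ] ℝ :=
    { toFun := wedgeOne α
      map_add' := wedgeOne_add α
      map_smul' := wedgeOne_smul α }
  change L _ = ∑ i ∈ s, c i • L _
  rw [map_sum]
  simp only [map_smul]

/-- The two halves of the definition agree by antisymmetry and give the action of `eᵢ ↦ ∑ⱼ κ(eᵢ, eⱼ)
eⱼ`. With the convention `κ(u, v) = ⟨u, K v⟩` this is `-K`, which explains the sign. -/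
lemma diamond_eq {n : ℕ} (κ : V [⋀^Fin 2]→L[ℝ] ℝ) (η : V [⋀^Fin (n + 1)]→L[ℝ] ℝ) :
    diamond κ η = -endAct (endOf κ) η := by
  set e := stdOrthonormalBasis ℝ V with he
  have hw : ∀ i, wedgeOne (flat (e i)) (contract (endOf κ (e i)) η)
      = -∑ j, κ ![e i, e j] • wedgeOne (flat (e i)) (contract (e j) η) := by
    intro i
    rw [endOf_apply, ← he, wedgeOne_contract_sum, ← Finset.sum_neg_distrib]
    refine Finset.sum_congr rfl fun j _ => ?_
    rw [twoForm_swap]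
    module
  rw [endAct, ← he]
  simp only [hw, Finset.sum_neg_distrib, neg_neg]
  have hs : ∑ i, ∑ j, κ ![e i, e j] • wedgeOne (flat (e j)) (contract (e i) η)
      = -∑ i, ∑ j, κ ![e i, e j] • wedgeOne (flat (e i)) (contract (e j) η) := by
    rw [Finset.sum_comm]
    simp only [← Finset.sum_neg_distrib]
    refine Finset.sum_congr rfl fun i _ => Finset.sum_congr rfl fun j _ => ?_
    rw [twoForm_swap]
    module
  simp only [diamond, ← he, smul_sub, Finset.sum_sub_distrib, hs]
  module

lemma inner_formOfEnd {A : V →L[ℝ] V} (hA : ∀ x y, inner ℝ (A x) y = -inner ℝ x (A y)) (u v : V) :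
    formOfEnd A ![u, v] = inner ℝ u (A v) := by
  set e := stdOrthonormalBasis ℝ V with he
  have h : ∀ u v : V, ∑ i, ∑ j, inner ℝ (e i) (A (e j)) * (inner ℝ (e i) u * inner ℝ (e j) v)
      = inner ℝ u (A v) := by
    intro u v
    have h1 : ∀ j, ∑ i, inner ℝ (e i) (A (e j)) * (inner ℝ (e i) u * inner ℝ (e j) v)
        = inner ℝ (e j) v * inner ℝ u (A (e j)) := fun j => by
      rw [← e.sum_inner_mul_inner u, Finset.mul_sum]
      refine Finset.sum_congr rfl fun i _ => ?_
      rw [real_inner_comm (e i) u]; ring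
    rw [Finset.sum_comm]
    simp only [h1]
    conv_rhs => rw [← e.sum_repr' v, map_sum, inner_sum]
    simp only [map_smul, inner_smul_right]
  have hf : formOfEnd A ![u, v] = (1 / 2) * (inner ℝ u (A v) - inner ℝ v (A u)) := by
    rw [← h u v, ← h v u]
    simp only [formOfEnd, ← he, ContinuousAlternatingMap.smul_apply,
      ContinuousAlternatingMap.sum_apply, wedgeOne_apply_two, flat_apply, oneForm_apply,
      smul_eq_mul, Matrix.cons_val_zero, mul_sub, Finset.sum_sub_distrib]
  rw [hf, real_inner_comm, hA]
  ring

lemma endOf_formOfEnd {A : V →L[ℝ] V} (hA : ∀ x y, inner ℝ (A x) y = -inner ℝ x (A y)) :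
    endOf (formOfEnd A) = A := by
  ext v
  refine ext_inner_left ℝ fun u => ?_
  rw [inner_endOf, inner_formOfEnd hA]

end Forms

/-! ### The three complex structures and the projections of `Λ²` built from them. -/

section Quaternionic

/-- The permutation of the coordinates underlying the `s`-th complex structure of the model. -/
def unitPerm : Fin 3 → Fin 8 → Fin 8 :=
  ![![1, 0, 3, 2, 5, 4, 7, 6], ![2, 3, 0, 1, 6, 7, 4, 5], ![3, 2, 1, 0, 7, 6, 5, 4]]

/-- The signs in the `s`-th complex structure of the model. -/
def unitSign : Fin 3 → Fin 8 → ℤ :=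
  ![![-1, 1, -1, 1, -1, 1, -1, 1], ![-1, 1, 1, -1, -1, 1, 1, -1], ![-1, -1, 1, 1, -1, -1, 1, 1]]

/-- The coefficients of the `2`-forms `ω₁`, `ω₂`, `ω₃`. -/
def omegaCoeff (s : Fin 3) (i j : Fin 8) : ℤ := if i = unitPerm s j then unitSign s j else 0

/-- The coefficients of the model `4`-form. -/
def modelCoeff (i j k l : Fin 8) : ℤ :=
  ∑ s, (omegaCoeff s i j * omegaCoeff s k l - omegaCoeff s i k * omegaCoeff s j l
    + omegaCoeff s i l * omegaCoeff s j k)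

variable {V : Type*} [NormedAddCommGroup V] [InnerProductSpace ℝ V] [FiniteDimensional ℝ V]
variable (b : OrthonormalBasis (Fin 8) ℝ V)

/-- The three complex structures in an orthonormal basis. -/
def quatUnit (s : Fin 3) : V →L[ℝ] V :=
  LinearMap.toContinuousLinearMap
    (b.toBasis.constr ℝ fun j => ((unitSign s j : ℤ) : ℝ) • b (unitPerm s j))

lemma quatUnit_basis (s : Fin 3) (j : Fin 8) :
    quatUnit b s (b j) = ((unitSign s j : ℤ) : ℝ) • b (unitPerm s j) := by
  have := b.toBasis.constr_basis ℝ (fun j => ((unitSign s j : ℤ) : ℝ) • b (unitPerm s j)) j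
  rwa [OrthonormalBasis.coe_toBasis] at this

lemma inner_quatUnit_basis (s : Fin 3) (i j : Fin 8) :
    inner ℝ (b i) (quatUnit b s (b j)) = ((omegaCoeff s i j : ℤ) : ℝ) := by
  rw [quatUnit_basis, inner_smul_right, b.inner_eq_ite, omegaCoeff]
  split_ifs <;> simp

lemma clm_ext_basis {W : Type*} [NormedAddCommGroup W] [NormedSpace ℝ W] {A B : V →L[ℝ] W}
    (h : ∀ j, A (b j) = B (b j)) (v : V) : A v = B v := by
  have : (A : V →ₗ[ℝ] W) = B := b.toBasis.ext fun j => by simpa using h j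
  exact LinearMap.congr_fun this v

lemma quatUnit_skew (s : Fin 3) (u v : V) :
    inner ℝ (quatUnit b s u) v = -inner ℝ u (quatUnit b s v) := by
  have hq : ∀ s i j, omegaCoeff s j i = -omegaCoeff s i j := by decide
  have h1 : ∀ i, inner ℝ (quatUnit b s (b i)) v = -inner ℝ (b i) (quatUnit b s v) := fun i => by
    refine clm_ext_basis b (A := innerSL ℝ (quatUnit b s (b i)))
      (B := -((innerSL ℝ (b i)).comp (quatUnit b s))) (fun j => ?_) v
    change inner ℝ (quatUnit b s (b i)) (b j) = -inner ℝ (b i) (quatUnit b s (b j))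
    rw [real_inner_comm, inner_quatUnit_basis, inner_quatUnit_basis, hq]
    push_cast; rfl
  have h2 := clm_ext_basis b (A := (innerSL ℝ v).comp (quatUnit b s))
      (B := -innerSL ℝ (quatUnit b s v)) (fun i => by
        change inner ℝ v (quatUnit b s (b i)) = -inner ℝ (quatUnit b s v) (b i)
        rw [real_inner_comm, h1, real_inner_comm]) u
  change inner ℝ v (quatUnit b s u) = -inner ℝ (quatUnit b s v) u at h2
  rw [real_inner_comm, h2, real_inner_comm]

/-- Each structure is a signed permutation of the basis, so the quaternion relations become finite
checks on the tables. With these signs the first two compose to minus the third. -/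
lemma quatUnit_mul_aux (s t r : Fin 3) (e : ℤ)
    (h : ∀ j, unitPerm s (unitPerm t j) = unitPerm r j ∧
      unitSign s (unitPerm t j) * unitSign t j = e * unitSign r j) (v : V) :
    quatUnit b s (quatUnit b t v) = (e : ℝ) • quatUnit b r v := by
  refine clm_ext_basis b (A := (quatUnit b s).comp (quatUnit b t))
    (B := (e : ℝ) • quatUnit b r) (fun j => ?_) v
  change quatUnit b s (quatUnit b t (b j)) = (e : ℝ) • quatUnit b r (b j)
  rw [quatUnit_basis, map_smul, quatUnit_basis, quatUnit_basis, smul_smul, smul_smul, (h j).1,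
    mul_comm, ← Int.cast_mul, (h j).2, Int.cast_mul]

lemma quatUnit_sq (s : Fin 3) (v : V) : quatUnit b s (quatUnit b s v) = -v := by
  have h : ∀ s j, unitPerm s (unitPerm s j) = j ∧ unitSign s (unitPerm s j) * unitSign s j = -1 := by
    decide
  refine clm_ext_basis b (A := (quatUnit b s).comp (quatUnit b s))
    (B := -ContinuousLinearMap.id ℝ V) (fun j => ?_) v
  change quatUnit b s (quatUnit b s (b j)) = -b j
  rw [quatUnit_basis, map_smul, quatUnit_basis, smul_smul, (h s j).1, mul_comm, ← Int.cast_mul,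
    (h s j).2]
  simp

lemma quatUnit_01 (v : V) : quatUnit b 0 (quatUnit b 1 v) = -quatUnit b 2 v := by
  simpa using quatUnit_mul_aux b 0 1 2 (-1) (by decide) v

lemma quatUnit_10 (v : V) : quatUnit b 1 (quatUnit b 0 v) = quatUnit b 2 v := by
  simpa using quatUnit_mul_aux b 1 0 2 1 (by decide) v

lemma quatUnit_12 (v : V) : quatUnit b 1 (quatUnit b 2 v) = -quatUnit b 0 v := by
  simpa using quatUnit_mul_aux b 1 2 0 (-1) (by decide) v

lemma quatUnit_21 (v : V) : quatUnit b 2 (quatUnit b 1 v) = quatUnit b 0 v := by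
  simpa using quatUnit_mul_aux b 2 1 0 1 (by decide) v

lemma quatUnit_20 (v : V) : quatUnit b 2 (quatUnit b 0 v) = -quatUnit b 1 v := by
  simpa using quatUnit_mul_aux b 2 0 1 (-1) (by decide) v

lemma quatUnit_02 (v : V) : quatUnit b 0 (quatUnit b 2 v) = quatUnit b 1 v := by
  simpa using quatUnit_mul_aux b 0 2 1 1 (by decide) v

/-- The `2`-forms `ω₁`, `ω₂`, `ω₃` in an orthonormal basis. -/
def omegaForm (s : Fin 3) : V [⋀^Fin 2]→L[ℝ] ℝ := formOfEnd (quatUnit b s)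

lemma omegaForm_apply (s : Fin 3) (u v : V) :
    omegaForm b s ![u, v] = inner ℝ u (quatUnit b s v) :=
  inner_formOfEnd (quatUnit_skew b s) u v

lemma twoForm_smul_left (κ : V [⋀^Fin 2]→L[ℝ] ℝ) (c : ℝ) (u v : V) :
    κ ![c • u, v] = c * κ ![u, v] := LinearMap.map_smul₂ (bil κ) c u v

lemma twoForm_smul_right (κ : V [⋀^Fin 2]→L[ℝ] ℝ) (c : ℝ) (u v : V) :
    κ ![u, c • v] = c * κ ![u, v] := map_smul (bil κ u) c v

lemma twoForm_neg_left (κ : V [⋀^Fin 2]→L[ℝ] ℝ) (u v : V) : κ ![-u, v] = -κ ![u, v] :=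
  LinearMap.map_neg₂ (bil κ) u v

lemma twoForm_neg_right (κ : V [⋀^Fin 2]→L[ℝ] ℝ) (u v : V) : κ ![u, -v] = -κ ![u, v] :=
  map_neg (bil κ u) v

/-- The inner product of a `2`-form with `ωₛ`. -/
def omegaCoef (s : Fin 3) : (V [⋀^Fin 2]→L[ℝ] ℝ) →ₗ[ℝ] ℝ where
  toFun κ := (1 / 2) * ∑ j, κ ![quatUnit b s (b j), b j]
  map_add' κ μ := by simp [Finset.sum_add_distrib, mul_add]
  map_smul' c κ := by simp [← Finset.mul_sum, mul_left_comm]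

/-- Pullback of a `2`-form by the `s`-th complex structure. -/
def rotForm (s : Fin 3) : (V [⋀^Fin 2]→L[ℝ] ℝ) →ₗ[ℝ] V [⋀^Fin 2]→L[ℝ] ℝ where
  toFun κ := κ.compContinuousLinearMap (quatUnit b s)
  map_add' _ _ := rfl
  map_smul' _ _ := rfl

lemma rotForm_apply (s : Fin 3) (κ : V [⋀^Fin 2]→L[ℝ] ℝ) (u v : V) :
    rotForm b s κ ![u, v] = κ ![quatUnit b s u, quatUnit b s v] := by
  change κ _ = _
  congr 1
  funext i; fin_cases i <;> rfl

/-- The operator `α ↦ *(α ∧ Ω)`. -/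
def starWedge : (V [⋀^Fin 2]→L[ℝ] ℝ) →ₗ[ℝ] V [⋀^Fin 2]→L[ℝ] ℝ :=
  ∑ s, ((omegaCoef b s).smulRight (omegaForm b s) - rotForm b s)

/-- The projection onto `Λ²₃`. -/
def proj3 : (V [⋀^Fin 2]→L[ℝ] ℝ) →ₗ[ℝ] V [⋀^Fin 2]→L[ℝ] ℝ :=
  (1 / 4 : ℝ) • ∑ s, (omegaCoef b s).smulRight (omegaForm b s)

/-- The projection onto `Λ²₁₀`. -/
def proj10 : (V [⋀^Fin 2]→L[ℝ] ℝ) →ₗ[ℝ] V [⋀^Fin 2]→L[ℝ] ℝ :=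
  (1 / 4 : ℝ) • (LinearMap.id + ∑ s, rotForm b s)

/-- The projection onto `Λ²₁₅`. -/
def proj15 : (V [⋀^Fin 2]→L[ℝ] ℝ) →ₗ[ℝ] V [⋀^Fin 2]→L[ℝ] ℝ :=
  (1 / 4 : ℝ) • ((3 : ℝ) • LinearMap.id - ∑ s, rotForm b s
    - ∑ s, (omegaCoef b s).smulRight (omegaForm b s))

lemma starWedge_apply (κ : V [⋀^Fin 2]→L[ℝ] ℝ) (u v : V) :
    starWedge b κ ![u, v] = ∑ s, (omegaCoef b s κ * inner ℝ u (quatUnit b s v)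
      - κ ![quatUnit b s u, quatUnit b s v]) := by
  simp [starWedge, Fin.sum_univ_three, omegaForm_apply, rotForm_apply]
  ring

lemma proj3_apply (κ : V [⋀^Fin 2]→L[ℝ] ℝ) (u v : V) :
    proj3 b κ ![u, v] = (1 / 4) * ∑ s, omegaCoef b s κ * inner ℝ u (quatUnit b s v) := by
  simp [proj3, Fin.sum_univ_three, omegaForm_apply]
  ring

lemma proj10_apply (κ : V [⋀^Fin 2]→L[ℝ] ℝ) (u v : V) :
    proj10 b κ ![u, v]
      = (1 / 4) * (κ ![u, v] + ∑ s, κ ![quatUnit b s u, quatUnit b s v]) := by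
  simp [proj10, Fin.sum_univ_three, rotForm_apply]
  ring

lemma proj15_apply (κ : V [⋀^Fin 2]→L[ℝ] ℝ) (u v : V) :
    proj15 b κ ![u, v]
      = (1 / 4) * (3 * κ ![u, v] - ∑ s, κ ![quatUnit b s u, quatUnit b s v]
        - ∑ s, omegaCoef b s κ * inner ℝ u (quatUnit b s v)) := by
  simp [proj15, Fin.sum_univ_three, rotForm_apply, omegaForm_apply]

lemma proj_sum (κ : V [⋀^Fin 2]→L[ℝ] ℝ) : proj15 b κ + (proj3 b κ + proj10 b κ) = κ := by
  refine twoForm_ext fun u v => ?_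
  simp only [ContinuousAlternatingMap.add_apply, proj15_apply, proj3_apply, proj10_apply]
  ring

lemma omegaCoef_apply (s : Fin 3) (κ : V [⋀^Fin 2]→L[ℝ] ℝ) :
    omegaCoef b s κ = (1 / 2) * ∑ j, κ ![quatUnit b s (b j), b j] := rfl

lemma omegaCoef_coord (s : Fin 3) (κ : V [⋀^Fin 2]→L[ℝ] ℝ) :
    omegaCoef b s κ = (1 / 2) * ∑ j, (unitSign s j : ℝ) * κ ![b (unitPerm s j), b j] := by
  simp only [omegaCoef_apply, quatUnit_basis, twoForm_smul_left]

lemma omegaCoef_rotForm (s t : Fin 3) (κ : V [⋀^Fin 2]→L[ℝ] ℝ) :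
    omegaCoef b s (rotForm b t κ) = (if s = t then 1 else -1) * omegaCoef b s κ := by
  simp only [omegaCoef_coord, rotForm_apply, quatUnit_basis, twoForm_smul_left,
    twoForm_smul_right]
  fin_cases s <;> fin_cases t <;>
    simp [Fin.sum_univ_eight, unitPerm, unitSign] <;> ring

lemma omegaCoef_omegaForm (s t : Fin 3) :
    omegaCoef b s (omegaForm b t) = if s = t then 4 else 0 := by
  simp only [omegaCoef_coord, omegaForm_apply, inner_quatUnit_basis]
  have h : ∀ s t, ∑ j, unitSign s j * omegaCoeff t (unitPerm s j) j = if s = t then 8 else 0 := by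
    decide
  have := h s t
  rw [← Int.cast_inj (α := ℝ)] at this
  push_cast at this
  rw [this]
  split_ifs <;> norm_num

/-- Signs disappear on 2-forms, so the three pullbacks together with the identity form a Klein
four-group. The square of the sum of its three involutions is `3 + 2 · sum`. -/
lemma sum_rotForm_sq (κ : V [⋀^Fin 2]→L[ℝ] ℝ) :
    ∑ s, rotForm b s (∑ t, rotForm b t κ) = (3 : ℝ) • κ + (2 : ℝ) • ∑ s, rotForm b s κ := by
  refine twoForm_ext fun u v => ?_
  simp only [Fin.sum_univ_three, map_add, ContinuousAlternatingMap.add_apply,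
    ContinuousAlternatingMap.smul_apply, rotForm_apply, quatUnit_sq, quatUnit_01, quatUnit_10,
    quatUnit_12, quatUnit_21, quatUnit_20, quatUnit_02, twoForm_neg_left, twoForm_neg_right,
    smul_eq_mul]
  ring

lemma rotForm_omegaForm (s t : Fin 3) :
    rotForm b s (omegaForm b t) = (if s = t then (1 : ℝ) else -1) • omegaForm b t := by
  refine twoForm_ext fun u v => ?_
  simp only [rotForm_apply, omegaForm_apply, ContinuousAlternatingMap.smul_apply, smul_eq_mul]
  fin_cases s <;> fin_cases t <;>
  simp [quatUnit_skew, quatUnit_sq, quatUnit_01, quatUnit_10,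
    quatUnit_12, quatUnit_21, quatUnit_20, quatUnit_02, inner_neg_right]

end Quaternionic

/-! ### Eigenspaces of the operator `starWedge`: eigenvalues 5, -3 and 1. -/

section Eigen

variable {V : Type*} [NormedAddCommGroup V] [InnerProductSpace ℝ V] [FiniteDimensional ℝ V]
variable (b : OrthonormalBasis (Fin 8) ℝ V)

lemma starWedge_eq (κ : V [⋀^Fin 2]→L[ℝ] ℝ) :
    starWedge b κ = ∑ s, omegaCoef b s κ • omegaForm b s - ∑ s, rotForm b s κ := by
  simp [starWedge, LinearMap.sum_apply]

lemma proj3_eq (κ : V [⋀^Fin 2]→L[ℝ] ℝ) :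
    proj3 b κ = (1 / 4 : ℝ) • ∑ s, omegaCoef b s κ • omegaForm b s := by
  simp [proj3, LinearMap.sum_apply]

lemma proj10_eq (κ : V [⋀^Fin 2]→L[ℝ] ℝ) :
    proj10 b κ = (1 / 4 : ℝ) • (κ + ∑ s, rotForm b s κ) := by
  simp [proj10, LinearMap.sum_apply]

lemma proj15_eq (κ : V [⋀^Fin 2]→L[ℝ] ℝ) :
    proj15 b κ = (1 / 4 : ℝ) • ((3 : ℝ) • κ - ∑ s, rotForm b s κ
      - ∑ s, omegaCoef b s κ • omegaForm b s) := by
  simp [proj15, LinearMap.sum_apply]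

/-- The eigenvalue is `4 - (1 - 1 - 1)`: `ωₛ` has square norm 4, is fixed by its own rotation and
negated by the other two. -/
lemma starWedge_omegaForm (s : Fin 3) : starWedge b (omegaForm b s) = (5 : ℝ) • omegaForm b s := by
  simp only [starWedge_eq, omegaCoef_omegaForm, rotForm_omegaForm]
  fin_cases s <;> simp [Fin.sum_univ_three] <;> module

lemma starWedge_proj3 (κ : V [⋀^Fin 2]→L[ℝ] ℝ) :
    starWedge b (proj3 b κ) = (5 : ℝ) • proj3 b κ := by
  simp only [proj3_eq, map_smul, map_sum, starWedge_omegaForm, Finset.smul_sum]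
  refine Finset.sum_congr rfl fun s _ => ?_
  module

lemma omegaCoef_proj10 (s : Fin 3) (κ : V [⋀^Fin 2]→L[ℝ] ℝ) : omegaCoef b s (proj10 b κ) = 0 := by
  simp only [proj10_eq, map_smul, map_add, map_sum, omegaCoef_rotForm]
  fin_cases s <;> simp [Fin.sum_univ_three]

/-- `proj10` is the average over the Klein four-group, so each rotation fixes its image. -/
lemma sum_rotForm_proj10 (κ : V [⋀^Fin 2]→L[ℝ] ℝ) :
    ∑ s, rotForm b s (proj10 b κ) = (3 : ℝ) • proj10 b κ := by
  simp only [proj10_eq, map_smul, map_add, Finset.sum_add_distrib, ← Finset.smul_sum,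
    sum_rotForm_sq]
  module

lemma starWedge_proj10 (κ : V [⋀^Fin 2]→L[ℝ] ℝ) :
    starWedge b (proj10 b κ) = (-3 : ℝ) • proj10 b κ := by
  rw [starWedge_eq, sum_rotForm_proj10]
  simp only [omegaCoef_proj10, zero_smul, Finset.sum_const_zero]
  module

lemma omegaCoef_proj15 (s : Fin 3) (κ : V [⋀^Fin 2]→L[ℝ] ℝ) : omegaCoef b s (proj15 b κ) = 0 := by
  have h := congrArg (omegaCoef b s) (proj_sum b κ)
  rw [map_add, map_add, omegaCoef_proj10] at h
  have h3 : omegaCoef b s (proj3 b κ) = omegaCoef b s κ := by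
    simp [proj3_eq, omegaCoef_omegaForm]
    ring
  rw [h3] at h
  linarith

/-- On the image of `proj15` all coefficients along the `ωₛ` vanish and the rotations sum to `-1`.
-/
lemma starWedge_proj15 (κ : V [⋀^Fin 2]→L[ℝ] ℝ) : starWedge b (proj15 b κ) = proj15 b κ := by
  have h1 : ∑ s, rotForm b s (∑ t, omegaCoef b t κ • omegaForm b t)
      = -∑ t, omegaCoef b t κ • omegaForm b t := by
    simp only [map_sum, map_smul, rotForm_omegaForm]
    simp [Fin.sum_univ_three]
    module
  have hr : ∑ s, rotForm b s (proj15 b κ) = -proj15 b κ := by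
    simp only [proj15_eq, map_smul, map_sub, Finset.sum_sub_distrib, ← Finset.smul_sum,
      sum_rotForm_sq, h1]
    module
  rw [starWedge_eq, hr]
  simp [omegaCoef_proj15]

/-- Independence of eigenvectors: applying the operator to `κ = α + β` gives `5α - 3β = α + β`, so
`α = β`, a vector with both eigenvalues 5 and -3. -/
lemma eq_zero_of_starWedge {κ α β : V [⋀^Fin 2]→L[ℝ] ℝ} (h : starWedge b κ = κ)
    (hα : starWedge b α = (5 : ℝ) • α) (hβ : starWedge b β = (-3 : ℝ) • β) (hs : κ = α + β) :
    α = 0 ∧ β = 0 := by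
  have h1 : (5 : ℝ) • α + (-3 : ℝ) • β = α + β := by rw [← hα, ← hβ, ← map_add, ← hs, h]
  have h2 : (4 : ℝ) • (α - β) = 0 := by
    have : (4 : ℝ) • (α - β) = ((5 : ℝ) • α + (-3 : ℝ) • β) - (α + β) := by module
    rw [this, h1, sub_self]
  obtain rfl : α = β := sub_eq_zero.1 ((smul_eq_zero.1 h2).resolve_left (by norm_num))
  have h3 : (8 : ℝ) • α = 0 := by
    have : (8 : ℝ) • α = (5 : ℝ) • α - (-3 : ℝ) • α := by module
    rw [this, ← hα, ← hβ, sub_self]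
  have h4 : α = 0 := (smul_eq_zero.1 h3).resolve_left (by norm_num)
  exact ⟨h4, h4⟩

lemma proj15_of_starWedge {κ : V [⋀^Fin 2]→L[ℝ] ℝ} (h : starWedge b κ = κ) : proj15 b κ = κ := by
  have h0 := eq_zero_of_starWedge b (κ := κ - proj15 b κ) (by rw [map_sub, h, starWedge_proj15])
    (starWedge_proj3 b κ) (starWedge_proj10 b κ) (by
      nth_rewrite 1 [← proj_sum b κ]; abel)
  have := proj_sum b κ
  rw [h0.1, h0.2] at this
  simpa using this

lemma proj15_proj15 (κ : V [⋀^Fin 2]→L[ℝ] ℝ) : proj15 b (proj15 b κ) = proj15 b κ :=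
  proj15_of_starWedge b (starWedge_proj15 b κ)

end Eigen

/-! ### Contractions of the adapted 4-form with itself and the constant 32. -/

section Tensor

variable {V : Type*} [NormedAddCommGroup V] [InnerProductSpace ℝ V] [FiniteDimensional ℝ V]

/-- In the orthonormal basis `b`, the `4`-form `Ω` is the model form. -/
def IsAdapted (b : OrthonormalBasis (Fin 8) ℝ V) (Ω : V [⋀^Fin 4]→L[ℝ] ℝ) : Prop :=
  ∀ x y z w, Ω ![x, y, z, w] = ∑ s, (inner ℝ x (quatUnit b s y) * inner ℝ z (quatUnit b s w)
    - inner ℝ x (quatUnit b s z) * inner ℝ y (quatUnit b s w)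
    + inner ℝ x (quatUnit b s w) * inner ℝ y (quatUnit b s z))

variable {b : OrthonormalBasis (Fin 8) ℝ V} {Ω : V [⋀^Fin 4]→L[ℝ] ℝ}

lemma sum_inner_mul_inner_clm (S : V →L[ℝ] V) (u q : V) :
    ∑ i, inner ℝ u (S (b i)) * inner ℝ q (b i) = inner ℝ u (S q) := by
  conv_rhs => rw [← b.sum_repr' q, map_sum, inner_sum]
  refine Finset.sum_congr rfl fun i _ => ?_
  rw [map_smul, inner_smul_right, real_inner_comm q, mul_comm]

lemma sum_twoForm_left (κ : V [⋀^Fin 2]→L[ℝ] ℝ) (x y : V) :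
    ∑ i, κ ![b i, y] * inner ℝ (b i) x = κ ![x, y] := by
  conv_rhs => rw [← b.sum_repr' x, ← bil_apply, map_sum, LinearMap.sum_apply]
  refine Finset.sum_congr rfl fun i _ => ?_
  rw [map_smul, LinearMap.smul_apply, bil_apply, smul_eq_mul, mul_comm]

lemma sum_twoForm_right (κ : V [⋀^Fin 2]→L[ℝ] ℝ) (x y : V) :
    ∑ j, κ ![x, b j] * inner ℝ (b j) y = κ ![x, y] := by
  rw [twoForm_swap, ← sum_twoForm_left (b := b), ← Finset.sum_neg_distrib]
  refine Finset.sum_congr rfl fun i _ => ?_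
  rw [twoForm_swap]; ring

lemma sum_twoForm_omega (κ : V [⋀^Fin 2]→L[ℝ] ℝ) (s : Fin 3) :
    ∑ i, ∑ j, κ ![b i, b j] * inner ℝ (b i) (quatUnit b s (b j)) = 2 * omegaCoef b s κ := by
  rw [Finset.sum_comm]
  simp only [sum_twoForm_left, omegaCoef_apply]
  ring

/-- The contraction of `Ω` with a `2`-form. -/
lemma sum_twoForm_mul (hΩ : IsAdapted b Ω) (κ : V [⋀^Fin 2]→L[ℝ] ℝ) (v w : V) :
    ∑ i, ∑ j, κ ![b i, b j] * Ω ![b i, b j, v, w] = 2 * starWedge b κ ![v, w] := by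
  have h1 : ∀ s, ∑ i, ∑ j, κ ![b i, b j] * (inner ℝ (b i) (quatUnit b s (b j)) *
      inner ℝ v (quatUnit b s w)) = 2 * omegaCoef b s κ * inner ℝ v (quatUnit b s w) := fun s => by
    simp only [← mul_assoc, ← Finset.sum_mul, sum_twoForm_omega]
  have h2 : ∀ x y, ∑ i, ∑ j, κ ![b i, b j] * (inner ℝ (b i) x * inner ℝ (b j) y)
      = κ ![x, y] := fun x y => by
    simp only [mul_left_comm, ← Finset.mul_sum, sum_twoForm_right]
    rw [← sum_twoForm_left (b := b)]
    exact Finset.sum_congr rfl fun i _ => mul_comm _ _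
  have h3 : ∀ s, ∑ i, ∑ j, κ ![b i, b j] * (inner ℝ (b i) (quatUnit b s v) *
      inner ℝ (b j) (quatUnit b s w)) = κ ![quatUnit b s v, quatUnit b s w] := fun s => h2 _ _
  have h4 : ∀ s, ∑ i, ∑ j, κ ![b i, b j] * (inner ℝ (b i) (quatUnit b s w) *
      inner ℝ (b j) (quatUnit b s v)) = -κ ![quatUnit b s v, quatUnit b s w] := fun s => by
    rw [h2, twoForm_swap]
  simp only [hΩ _ _ _ _, Finset.mul_sum, mul_add, mul_sub]
  simp only [Fin.sum_univ_three, Finset.sum_add_distrib, Finset.sum_sub_distrib, h1, h3, h4,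
    starWedge_apply]
  ring

lemma fourForm_pair_symm (η : V [⋀^Fin 4]→L[ℝ] ℝ) (x y z w : V) :
    η ![x, y, z, w] = η ![z, w, x, y] := by
  rw [fourForm_swap12, fourForm_swap01, fourForm_swap23, fourForm_swap12]
  ring

/-- The double contraction of `Ω` with itself. -/
lemma sum_modelForm_mul (hΩ : IsAdapted b Ω) (u w v a : V) :
    ∑ i, ∑ j, Ω ![u, w, b i, b j] * Ω ![v, a, b i, b j]
      = 2 * (6 * ∑ s, inner ℝ u (quatUnit b s w) * inner ℝ v (quatUnit b s a)
        + 3 * (inner ℝ u v * inner ℝ w a) + 2 * ∑ s, inner ℝ u (quatUnit b s v) *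
          inner ℝ w (quatUnit b s a) - 3 * (inner ℝ u a * inner ℝ w v)
        - 2 * ∑ s, inner ℝ u (quatUnit b s a) * inner ℝ w (quatUnit b s v)) := by
  -- Contracting this 2-form with `Ω` is again an instance of `sum_twoForm_mul`. Its coefficient
  -- along `ωₛ` is known because `ωₛ` is an eigenvector with eigenvalue 5.
  let μ : V [⋀^Fin 2]→L[ℝ] ℝ := contract w (contract u Ω)
  have hμ : ∀ x y, μ ![x, y] = Ω ![u, w, x, y] := fun x y => rfl
  have hc : ∀ s, omegaCoef b s μ = 5 * inner ℝ u (quatUnit b s w) := fun s => by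
    have h := sum_twoForm_mul hΩ (omegaForm b s) u w
    rw [starWedge_omegaForm, ContinuousAlternatingMap.smul_apply, omegaForm_apply] at h
    have h' := sum_twoForm_omega (b := b) μ s
    simp only [hμ, fourForm_pair_symm Ω u w] at h'
    simp only [omegaForm_apply, mul_comm (inner ℝ (b _) (quatUnit b s (b _))), h'] at h
    rw [smul_eq_mul] at h
    linarith
  have h := sum_twoForm_mul hΩ μ v a
  simp only [hμ, fourForm_pair_symm Ω (b _) (b _) v a] at h
  rw [h, starWedge_apply]
  simp only [hc, hμ, hΩ _ _ _ _, Fin.sum_univ_three, quatUnit_skew, quatUnit_sq, quatUnit_01, quatUnit_10,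
    quatUnit_12, quatUnit_21, quatUnit_20, quatUnit_02, inner_neg_right, map_neg]
  ring

/-- Trace of the double contraction: the terms contribute `2 (18 + 24 - 3 + 6) = 90`, the summand
with `⟨bᵢ, Iₛ bᵢ⟩` being zero. -/
lemma contr3_modelForm (hΩ : IsAdapted b Ω) (u v : V) :
    contr3 b Ω Ω u v = 90 * inner ℝ u v := by
  have h1 : ∀ s, ∑ i, inner ℝ u (quatUnit b s (b i)) * inner ℝ v (quatUnit b s (b i))
      = inner ℝ u v := fun s => by
    have := sum_inner_mul_inner_clm (b := b) (quatUnit b s) u (-quatUnit b s v)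
    simp only [inner_neg_left, quatUnit_skew, map_neg, quatUnit_sq, neg_neg] at this
    exact this
  have h2 : ∀ s, ∑ i, inner ℝ u (quatUnit b s (b i)) * inner ℝ (b i) (quatUnit b s v)
      = -inner ℝ u v := fun s => by
    have := sum_inner_mul_inner_clm (b := b) (quatUnit b s) u (quatUnit b s v)
    simp only [quatUnit_sq, inner_neg_right, real_inner_comm (b _)] at this
    simpa only [real_inner_comm] using this
  have h3 : ∑ i, inner ℝ u (b i) * inner ℝ (b i) v = inner ℝ u v := b.sum_inner_mul_inner u v
  have h4 : ∀ i s, inner ℝ (b i) (quatUnit b s (b i)) = 0 := fun i s => by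
    have := quatUnit_skew b s (b i) (b i)
    rw [real_inner_comm] at this
    linarith
  simp only [contr3, sum_modelForm_mul hΩ, h4, mul_zero, Finset.sum_const_zero]
  simp only [← Finset.mul_sum, Finset.sum_sub_distrib, Finset.sum_add_distrib, add_zero,
    Fin.sum_univ_three, h1, h2, h3, b.inner_eq_one]
  simp
  ring

/-- The action on the free slot gives `-90 κ`. Those on the three contracted slots are equal by
antisymmetry, and the double contraction evaluates them to `18 κ` plus 24 times the rotations and
the `ωₛ` components of `κ`. The sum is exactly a multiple of `proj15`. -/
lemma contr3_endAct_modelForm (hΩ : IsAdapted b Ω) (κ : V [⋀^Fin 2]→L[ℝ] ℝ) (u v : V) :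
    contr3 b (endAct (endOf κ) Ω) Ω u v = -96 * proj15 b κ ![u, v] := by
  set K := endOf κ with hK
  have key : contr3 b (endAct K Ω) Ω u v
      = contr3 b Ω Ω (K u) v + 3 * ∑ i, ∑ j, ∑ k,
        Ω ![u, K (b i), b j, b k] * Ω ![v, b i, b j, b k] := by
    have e2 : ∑ i, ∑ j, ∑ k, Ω ![u, b i, K (b j), b k] * Ω ![v, b i, b j, b k]
        = ∑ i, ∑ j, ∑ k, Ω ![u, K (b i), b j, b k] * Ω ![v, b i, b j, b k] := by
      rw [Finset.sum_comm]
      refine Finset.sum_congr rfl fun i _ => Finset.sum_congr rfl fun j _ =>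
        Finset.sum_congr rfl fun k _ => ?_
      rw [fourForm_swap12, fourForm_swap12 Ω v]; ring
    have e3 : ∑ i, ∑ j, ∑ k, Ω ![u, b i, b j, K (b k)] * Ω ![v, b i, b j, b k]
        = ∑ i, ∑ j, ∑ k, Ω ![u, b i, K (b j), b k] * Ω ![v, b i, b j, b k] := by
      refine Finset.sum_congr rfl fun i _ => ?_
      rw [Finset.sum_comm]
      refine Finset.sum_congr rfl fun j _ => Finset.sum_congr rfl fun k _ => ?_
      rw [fourForm_swap23, fourForm_swap23 Ω v]; ring
    simp only [contr3, endAct_apply_four, add_mul, Finset.sum_add_distrib]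
    rw [e3, e2]; ring
  have hsk : ∀ x y, inner ℝ (K x) y = -inner ℝ x (K y) := endOf_skew κ
  have hin : ∀ x y, inner ℝ x (K y) = κ ![x, y] := inner_endOf κ
  have h1 : ∀ s, ∑ i, inner ℝ u (quatUnit b s (K (b i))) * inner ℝ v (quatUnit b s (b i))
      = κ ![quatUnit b s u, quatUnit b s v] := fun s => by
    have := sum_inner_mul_inner_clm (b := b) ((quatUnit b s).comp K) u (-quatUnit b s v)
    simp only [inner_neg_left, quatUnit_skew, map_neg, neg_neg,
      ContinuousLinearMap.comp_apply] at this
    rw [this, ← hin, quatUnit_skew, inner_neg_right]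
  have h2 : ∑ i, inner ℝ (K (b i)) (b i) = 0 := by
    refine Finset.sum_eq_zero fun i _ => ?_
    have := hsk (b i) (b i)
    rw [real_inner_comm] at this ⊢
    linarith
  have h3 : ∀ s, ∑ i, inner ℝ (K (b i)) (quatUnit b s (b i)) = 2 * omegaCoef b s κ := fun s => by
    rw [omegaCoef_apply]
    simp only [real_inner_comm _ (K _), hin]
    ring
  have h4 : ∑ i, inner ℝ u (b i) * inner ℝ (K (b i)) v = -κ ![u, v] := by
    simp only [hsk, mul_neg, Finset.sum_neg_distrib, b.sum_inner_mul_inner]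
    rw [hin]
  have h5 : ∀ s, ∑ i, inner ℝ u (quatUnit b s (b i)) * inner ℝ (K (b i)) (quatUnit b s v)
      = κ ![quatUnit b s u, quatUnit b s v] := fun s => by
    have h : ∀ i, inner ℝ u (quatUnit b s (b i)) * inner ℝ (K (b i)) (quatUnit b s v)
        = inner ℝ (quatUnit b s u) (b i) * inner ℝ (b i) (K (quatUnit b s v)) := fun i => by
      rw [hsk, quatUnit_skew]; ring
    simp only [h, b.sum_inner_mul_inner]
    rw [hin]
  rw [key, contr3_modelForm hΩ, hsk, hin]
  simp only [sum_modelForm_mul hΩ]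
  simp only [← Finset.mul_sum, Finset.sum_sub_distrib, Finset.sum_add_distrib,
    Fin.sum_univ_three, h1, h2, h3, h4, h5, proj15_apply]
  ring

/-- The projection onto `Λ²₁₅` through the triple contraction. -/
lemma tripleContr_diamond (hΩ : IsAdapted b Ω) (κ : V [⋀^Fin 2]→L[ℝ] ℝ) :
    tripleContr (diamond κ Ω) Ω = (32 : ℝ) • proj15 b κ := by
  refine twoForm_ext fun u v => ?_
  have h : diamond κ Ω = (-1 : ℝ) • endAct (endOf κ) Ω := by rw [diamond_eq]; module
  rw [h, tripleContr_apply b, contr3_smul_left, contr3_smul_left, contr3_endAct_modelForm hΩ,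
    contr3_endAct_modelForm hΩ, twoForm_swap _ v u, ContinuousAlternatingMap.smul_apply, smul_eq_mul]
  ring

end Tensor

/-! ### The stabiliser of the 4-form, and brackets of elements of `Λ²₁₅`. -/

section Bracket

variable {V : Type*} [NormedAddCommGroup V] [InnerProductSpace ℝ V] [FiniteDimensional ℝ V]
variable {b : OrthonormalBasis (Fin 8) ℝ V} {Ω : V [⋀^Fin 4]→L[ℝ] ℝ}

lemma fourForm_ext {η ζ : V [⋀^Fin 4]→L[ℝ] ℝ}
    (h : ∀ x y z w, η ![x, y, z, w] = ζ ![x, y, z, w]) : η = ζ := by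
  refine ContinuousAlternatingMap.ext fun v => ?_
  have e : v = ![v 0, v 1, v 2, v 3] := by funext i; fin_cases i <;> rfl
  rw [e]
  exact h _ _ _ _

lemma endOf_add (κ μ : V [⋀^Fin 2]→L[ℝ] ℝ) : endOf (κ + μ) = endOf κ + endOf μ := by
  ext v
  refine ext_inner_left ℝ fun u => ?_
  simp [inner_endOf, inner_add_right]

lemma endOf_smul (c : ℝ) (κ : V [⋀^Fin 2]→L[ℝ] ℝ) : endOf (c • κ) = c • endOf κ := by
  ext v
  refine ext_inner_left ℝ fun u => ?_
  simp [inner_endOf, inner_smul_right]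

/-- The operation `κ ↦ κ ◇ η` as a linear map. -/
def diamondL {n : ℕ} (η : V [⋀^Fin (n + 1)]→L[ℝ] ℝ) :
    (V [⋀^Fin 2]→L[ℝ] ℝ) →ₗ[ℝ] V [⋀^Fin (n + 1)]→L[ℝ] ℝ where
  toFun κ := diamond κ η
  map_add' κ μ := by simp only [diamond_eq, endOf_add, endAct_add]; abel
  map_smul' c κ := by simp only [diamond_eq, endOf_smul, endAct_smul, RingHom.id_apply]; module

lemma diamondL_apply {n : ℕ} (η : V [⋀^Fin (n + 1)]→L[ℝ] ℝ) (κ : V [⋀^Fin 2]→L[ℝ] ℝ) :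
    diamondL η κ = diamond κ η := rfl

/-- Each complex structure kills its own `ω` and rotates the other two into each other, so the sum
of the squares is invariant. -/
lemma endAct_quatUnit (hΩ : IsAdapted b Ω) (s : Fin 3) : endAct (quatUnit b s) Ω = 0 := by
  refine fourForm_ext fun x y z w => ?_
  rw [endAct_apply_four]
  simp only [hΩ _ _ _ _, Fin.sum_univ_three]
  fin_cases s <;>
  simp [quatUnit_skew, quatUnit_sq, quatUnit_01, quatUnit_10,
    quatUnit_12, quatUnit_21, quatUnit_20, quatUnit_02, inner_neg_right] <;> ring

/-- The hypothesis says that `K` annihilates each `ωₛ` separately. -/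
lemma endAct_of_commute (hΩ : IsAdapted b Ω) {K : V →L[ℝ] V}
    (h : ∀ s x y, inner ℝ (K x) (quatUnit b s y) = -inner ℝ x (quatUnit b s (K y))) :
    endAct K Ω = 0 := by
  refine fourForm_ext fun x y z w => ?_
  rw [endAct_apply_four]
  simp only [hΩ _ _ _ _, Fin.sum_univ_three, h]
  change _ = (0 : ℝ)
  ring

lemma rotForm_proj10 (s : Fin 3) (κ : V [⋀^Fin 2]→L[ℝ] ℝ) :
    rotForm b s (proj10 b κ) = proj10 b κ := by
  refine twoForm_ext fun u v => ?_
  simp only [rotForm_apply, proj10_apply, Fin.sum_univ_three]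
  fin_cases s <;>
  simp [quatUnit_sq, quatUnit_01, quatUnit_10, quatUnit_12, quatUnit_21, quatUnit_20, quatUnit_02,
    twoForm_neg_left, twoForm_neg_right] <;> ring

/-- `Λ²₃` acts by combinations of the complex structures. The endomorphisms of `Λ²₁₀` commute with
them. Both annihilate `Ω`, so only the third component contributes. -/
lemma diamond_proj15 (hΩ : IsAdapted b Ω) (κ : V [⋀^Fin 2]→L[ℝ] ℝ) :
    diamond (proj15 b κ) Ω = diamond κ Ω := by
  have h3 : diamondL Ω (proj3 b κ) = 0 := by
    have hs : ∀ s, diamondL Ω (omegaForm b s) = 0 := fun s => by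
      rw [diamondL_apply, diamond_eq, omegaForm, endOf_formOfEnd (quatUnit_skew b s),
        endAct_quatUnit hΩ, neg_zero]
    simp [proj3_eq, hs]
  have h10 : diamondL Ω (proj10 b κ) = 0 := by
    rw [diamondL_apply, diamond_eq, endAct_of_commute hΩ, neg_zero]
    intro s x y
    rw [endOf_skew, inner_endOf, ← rotForm_proj10 s, rotForm_apply, quatUnit_sq, twoForm_neg_right,
      rotForm_proj10, neg_neg, ← inner_endOf, quatUnit_skew]
  have := congrArg (diamondL Ω) (proj_sum b κ)
  simp only [map_add, h3, h10, add_zero] at this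
  exact this

/-- The equations of `Λ²₁₅` in coordinates. -/
structure IsCoord15 (k : Fin 8 → Fin 8 → ℝ) : Prop where
  skew : ∀ i j, k j i = -k i j
  rot : ∀ i j, ∑ s, (unitSign s i * unitSign s j : ℝ) * k (unitPerm s i) (unitPerm s j) = -k i j
  coef : ∀ s, ∑ j, (unitSign s j : ℝ) * k (unitPerm s j) j = 0

/-- The coordinates of an element of `Λ²₁₅` in terms of fifteen of them. -/
lemma IsCoord15.solve {k : Fin 8 → Fin 8 → ℝ} (h : IsCoord15 k) :
    (∀ i, k i i = 0) ∧ (k 2 3 = k 0 1 ∧ k 1 3 = -k 0 2 ∧ k 1 2 = k 0 3) ∧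
    (k 4 5 = -k 0 1 ∧ k 4 6 = -k 0 2 ∧ k 4 7 = -k 0 3 ∧
      k 6 7 = -k 0 1 ∧ k 5 7 = k 0 2 ∧ k 5 6 = -k 0 3) ∧
    (k 0 4 = -k 1 5 - k 2 6 - k 3 7 ∧ k 0 5 = k 1 4 - k 3 6 + k 2 7 ∧
      k 0 6 = k 2 4 + k 3 5 - k 1 7 ∧ k 0 7 = k 3 4 - k 2 5 + k 1 6) := by
  have sk := h.skew
  have hd : ∀ i, k i i = 0 := fun i => by linarith [sk i i]
  have r01 := h.rot 0 1
  have r02 := h.rot 0 2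
  have r03 := h.rot 0 3
  have r45 := h.rot 4 5
  have r46 := h.rot 4 6
  have r47 := h.rot 4 7
  have r04 := h.rot 0 4
  have r05 := h.rot 0 5
  have r06 := h.rot 0 6
  have r07 := h.rot 0 7
  have c0 := h.coef 0
  have c1 := h.coef 1
  have c2 := h.coef 2
  simp [Fin.sum_univ_three, Fin.sum_univ_eight, unitPerm, unitSign] at r01 r02 r03 r45 r46 r47 r04 r05 r06 r07 c0 c1 c2
  simp only [sk 0 1, sk 2 3, sk 4 5, sk 6 7, sk 0 2, sk 1 3, sk 4 6, sk 5 7, sk 0 3, sk 1 2,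
    sk 4 7, sk 5 6] at r01 r02 r03 r45 r46 r47 c0 c1 c2
  refine ⟨hd, ⟨?_, ?_, ?_⟩, ⟨?_, ?_, ?_, ?_, ?_, ?_⟩, ?_, ?_, ?_, ?_⟩ <;> linarith

/-- Equations satisfied by the commutator of two endomorphisms in `Λ²₁₅`. -/
lemma commutator_equations {k l : Fin 8 → Fin 8 → ℝ} (hk : IsCoord15 k) (hl : IsCoord15 l)
    {m : Fin 8 → Fin 8 → ℝ} (hm : ∀ i j, m i j = ∑ p, (k i p * l p j - l i p * k p j)) :
    (m 0 1 + m 2 3 = m 4 5 + m 6 7 ∧ m 0 2 - m 1 3 = m 4 6 - m 5 7 ∧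
      m 0 3 + m 1 2 = m 4 7 + m 5 6) ∧ (m 1 5 = m 0 4 ∧ m 2 6 = m 0 4 ∧ m 3 7 = m 0 4) ∧
      (m 1 4 = -m 0 5 ∧ m 2 7 = -m 0 5 ∧ m 3 6 = m 0 5) ∧
      (m 1 7 = m 0 6 ∧ m 2 4 = -m 0 6 ∧ m 3 5 = -m 0 6) ∧
      (m 1 6 = -m 0 7 ∧ m 2 5 = m 0 7 ∧ m 3 4 = -m 0 7) := by
  obtain ⟨kd, ⟨k1, k2, k3⟩, ⟨k4, k5, k6, k7, k8, k9⟩, k10, k11, k12, k13⟩ := hk.solve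
  obtain ⟨ld, ⟨l1, l2, l3⟩, ⟨l4, l5, l6, l7, l8, l9⟩, l10, l11, l12, l13⟩ := hl.solve
  have hks : ∀ {i j}, i < j → k j i = -k i j := fun {i j} _ => hk.skew i j
  have hls : ∀ {i j}, i < j → l j i = -l i j := fun {i j} _ => hl.skew i j
  simp only [hm, Fin.sum_univ_eight]
  -- These 15 linear equations cut out `Λ²₃ ⊕ Λ²₁₀`, of dimension 13, in the 28-dimensional `Λ²`.
  -- After substituting the solved coordinates each is a polynomial identity in the free ones.
  refine ⟨⟨?_, ?_, ?_⟩, ⟨?_, ?_, ?_⟩, ⟨?_, ?_, ?_⟩, ⟨?_, ?_, ?_⟩, ?_, ?_, ?_⟩ <;>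
  simp [hks, hls, kd, ld, k1, k2, k3, k4, k5, k6, k7, k8, k9, k10, k11, k12, k13,
    l1, l2, l3, l4, l5, l6, l7, l8, l9, l10, l11, l12, l13] <;>
  ring

set_option maxHeartbeats 1000000 in
/-- The commutator of two endomorphisms in `Λ²₁₅` has no component in `Λ²₁₅`. -/
lemma commutator_coord {k l : Fin 8 → Fin 8 → ℝ} (hk : IsCoord15 k) (hl : IsCoord15 l)
    {m : Fin 8 → Fin 8 → ℝ} (hm : ∀ i j, m i j = ∑ p, (k i p * l p j - l i p * k p j)) (i j : Fin 8) :
    3 * m i j - ∑ s, (unitSign s i * unitSign s j : ℝ) * m (unitPerm s i) (unitPerm s j)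
      - ∑ s, ((1 / 2) * ∑ p, (unitSign s p : ℝ) * m (unitPerm s p) p) * (omegaCoeff s i j : ℝ)
      = 0 := by
  have ms : ∀ i j, m j i = -m i j := fun i j => by
    rw [hm, hm, ← Finset.sum_neg_distrib]
    refine Finset.sum_congr rfl fun p _ => ?_
    rw [hk.skew p j, hl.skew i p, hl.skew p j, hk.skew i p]
    ring
  have md : ∀ i, m i i = 0 := fun i => by linarith [ms i i]
  obtain ⟨⟨e1, e2, e3⟩, ⟨e4, e5, e6⟩, ⟨e7, e8, e9⟩, ⟨e10, e11, e12⟩, e13, e14, e15⟩ :=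
    commutator_equations hk hl hm
  have hms : ∀ {i j}, i < j → m j i = -m i j := fun {i j} _ => ms i j
  -- Only the linear equations on `m` are needed from here on.
  clear hm
  fin_cases i <;> fin_cases j <;>
    simp [Fin.sum_univ_three, Fin.sum_univ_eight, unitPerm, unitSign, omegaCoeff, hms, md] <;>
    linarith

lemma isCoord15_of_proj15 {κ : V [⋀^Fin 2]→L[ℝ] ℝ} (h : proj15 b κ = κ) :
    IsCoord15 fun i j => κ ![b i, b j] where
  skew i j := twoForm_swap κ _ _
  coef s := by
    have := omegaCoef_proj15 b s κ
    rw [h, omegaCoef_coord] at this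
    linarith
  rot i j := by
    have hs := starWedge_proj15 b κ
    have hc : ∀ s, omegaCoef b s κ = 0 := fun s => by rw [← h, omegaCoef_proj15]
    rw [h] at hs
    have := congrArg (fun μ => μ ![b i, b j]) hs
    simp only [starWedge_apply, hc, zero_mul, zero_sub, Finset.sum_neg_distrib, quatUnit_basis,
      twoForm_smul_left, twoForm_smul_right] at this
    rw [← this, neg_neg]
    exact Finset.sum_congr rfl fun s _ => by ring

/-- On 2-forms `◇` is the Lie bracket of `𝔰𝔬(V)`. -/
lemma endOf_diamond (κ μ : V [⋀^Fin 2]→L[ℝ] ℝ) :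
    endOf (diamond κ μ) = (endOf κ).comp (endOf μ) - (endOf μ).comp (endOf κ) := by
  ext v
  refine ext_inner_left ℝ fun u => ?_
  rw [inner_endOf, diamond_eq, ContinuousAlternatingMap.neg_apply, endAct_apply_two,
    ← inner_endOf μ, ← inner_endOf μ, endOf_skew κ, sub_apply, inner_sub_right,
    ContinuousLinearMap.comp_apply, ContinuousLinearMap.comp_apply]
  ring

/-- For `κ`, `μ` in `Λ²₁₅` the bracket `κ ◇ μ` has no component in `Λ²₁₅`. -/
lemma proj15_diamond {κ μ : V [⋀^Fin 2]→L[ℝ] ℝ} (hκ : proj15 b κ = κ) (hμ : proj15 b μ = μ) :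
    proj15 b (diamond κ μ) = 0 := by
  have hm : ∀ i j, diamond κ μ ![b i, b j]
      = ∑ p, (κ ![b i, b p] * μ ![b p, b j] - μ ![b i, b p] * κ ![b p, b j]) := fun i j => by
    have h : ∀ κ μ : V [⋀^Fin 2]→L[ℝ] ℝ, inner ℝ (b i) (endOf κ (endOf μ (b j)))
        = ∑ p, κ ![b i, b p] * μ ![b p, b j] := fun κ μ => by
      rw [inner_endOf, ← sum_twoForm_right (b := b)]
      simp only [inner_endOf]
    rw [← inner_endOf, endOf_diamond, sub_apply, inner_sub_right,
      ContinuousLinearMap.comp_apply, ContinuousLinearMap.comp_apply, h, h, Finset.sum_sub_distrib]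
  have key := commutator_coord (isCoord15_of_proj15 hκ) (isCoord15_of_proj15 hμ) hm
  have hz : ∀ i j, proj15 b (diamond κ μ) ![b i, b j] = 0 := fun i j => by
    have h := key i j
    have e : ∀ s, diamond κ μ ![quatUnit b s (b i), quatUnit b s (b j)]
        = (unitSign s i * unitSign s j : ℝ) * diamond κ μ ![b (unitPerm s i), b (unitPerm s j)] :=
      fun s => by
        rw [quatUnit_basis, quatUnit_basis, twoForm_smul_left, twoForm_smul_right]; ring
    simp only [proj15_apply, omegaCoef_coord, inner_quatUnit_basis, e]
    rw [h, mul_zero]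
  refine twoForm_ext fun u v => ?_
  rw [← sum_twoForm_right (b := b)]
  simp only [← sum_twoForm_left (b := b) _ u, hz]
  simp

/-- For `κ`, `μ` in `Λ²₁₅` the antisymmetrised triple contraction has no component in `Λ²₁₅`. -/
lemma proj15_tripleContr_sub (hΩ : IsAdapted b Ω) {κ μ : V [⋀^Fin 2]→L[ℝ] ℝ}
    (hκ : proj15 b κ = κ) (hμ : proj15 b μ = μ) :
    proj15 b (tripleContr (diamond μ Ω) (diamond κ Ω) - tripleContr (diamond κ Ω) (diamond μ Ω))
      = 0 := by
  have d : ∀ (κ : V [⋀^Fin 2]→L[ℝ] ℝ) {n : ℕ} (η : V [⋀^Fin (n + 1)]→L[ℝ] ℝ),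
      endAct (endOf κ) η = -diamond κ η := fun κ _ η => by rw [diamond_eq, neg_neg]
  have h1 := endAct_tripleContr (endOf_skew κ) (diamond μ Ω) Ω
  have h2 := endAct_tripleContr (endOf_skew μ) (diamond κ Ω) Ω
  rw [tripleContr_diamond hΩ, hμ, endAct_form_smul] at h1
  rw [tripleContr_diamond hΩ, hκ, endAct_form_smul] at h2
  have hs : diamond μ κ = -diamond κ μ := by
    refine twoForm_ext fun u v => ?_
    rw [ContinuousAlternatingMap.neg_apply, ← inner_endOf, ← inner_endOf, endOf_diamond,
      endOf_diamond, ← inner_neg_right]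
    simp
  have hb : diamond κ (diamond μ Ω) - diamond μ (diamond κ Ω) = diamond (diamond κ μ) Ω := by
    have h := endAct_comm_four (endOf κ) (endOf μ) Ω
    rw [diamond_eq (diamond κ μ), endOf_diamond, ← endAct_neg, neg_sub, ← h]
    simp only [diamond_eq]
    rw [← neg_one_smul ℝ (endAct (endOf μ) Ω), ← neg_one_smul ℝ (endAct (endOf κ) Ω),
      endAct_form_smul, endAct_form_smul]
    module
  -- Equivariance gives `(μ◇Ω) ⌟₃ (κ◇Ω) = 32 κ◇μ - (κ◇(μ◇Ω)) ⌟₃ Ω`. Subtracting the same relation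
  -- with `κ` and `μ` exchanged doubles the first term, and the iterated actions combine into the
  -- action of the bracket.
  have hD : tripleContr (diamond μ Ω) (diamond κ Ω) - tripleContr (diamond κ Ω) (diamond μ Ω)
      = (64 : ℝ) • diamond κ μ - tripleContr (diamond (diamond κ μ) Ω) Ω := by
    rw [← hb]
    simp only [d, hs] at h1 h2
    simp only [← tripleContrL_apply, map_sub, map_neg, LinearMap.sub_apply,
      LinearMap.neg_apply] at h1 h2 ⊢
    have e1 : tripleContrL (diamond μ Ω) (diamond κ Ω) = (32 : ℝ) • diamond κ μ
        - tripleContrL (diamond κ (diamond μ Ω)) Ω := by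
      rw [smul_neg] at h1
      rw [eq_comm, sub_eq_iff_eq_add, ← neg_inj, h1]; abel
    have e2 : tripleContrL (diamond κ Ω) (diamond μ Ω) = -((32 : ℝ) • diamond κ μ)
        - tripleContrL (diamond μ (diamond κ Ω)) Ω := by
      rw [neg_neg] at h2
      rw [h2]; abel
    rw [e1, e2]
    module
  rw [hD, tripleContr_diamond hΩ, map_sub, map_smul, map_smul, proj15_diamond hκ hμ]
  simp

end Bracket

/-! ### Shuffle formulas for the wedge product. -/

section Wedge

variable {V : Type*} [NormedAddCommGroup V] [InnerProductSpace ℝ V] [FiniteDimensional ℝ V]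

/-- The basis in the recursive definition drops out because `x ↦ (x ⌟ α) ∧ η` is linear. -/
lemma wedge_succ_apply {n k : ℕ} (α : V [⋀^Fin (k + 1)]→L[ℝ] ℝ) (η : V [⋀^Fin n]→L[ℝ] ℝ)
    (v : Fin (n + k + 1) → V) :
    wedge (k + 1) α η v = ((k : ℝ) + 1)⁻¹ * ∑ a : Fin (n + k + 1), (-1) ^ (a : ℕ) *
      wedge k (contract (v a) α) η (a.removeNth v) := by
  set e := stdOrthonormalBasis ℝ V with he
  change (((k : ℝ) + 1)⁻¹ • ∑ i, wedgeOne (flat (e i)) (wedge k (contract (e i) α) η)) v = _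
  let L : V →ₗ[ℝ] V [⋀^Fin (n + k)]→L[ℝ] ℝ :=
    { toFun := fun x => wedge k (contract x α) η
      map_add' := fun x y => by
        rw [← wedge_add]; simp only [contract, map_add]
      map_smul' := fun c x => by
        rw [RingHom.id_apply, ← wedge_smul]; simp only [contract, map_smul] }
  have hL : ∀ (x : V) (w : Fin (n + k) → V), ∑ i, inner ℝ (e i) x *
      wedge k (contract (e i) α) η w = wedge k (contract x α) η w := fun x w => by
    have h : L x = ∑ i, (inner ℝ (e i) x : ℝ) • L (e i) := by
      simp only [← map_smul, ← map_sum, e.sum_repr']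
    have := congrArg (fun ζ => ζ w) h
    simp only [ContinuousAlternatingMap.sum_apply, ContinuousAlternatingMap.smul_apply,
      smul_eq_mul] at this
    exact this.symm
  simp only [ContinuousAlternatingMap.smul_apply, ContinuousAlternatingMap.sum_apply, smul_eq_mul,
    wedgeOne_apply, flat_apply]
  rw [Finset.sum_comm]
  congr 1
  refine Finset.sum_congr rfl fun a _ => ?_
  rw [← Finset.mul_sum, hL]

lemma wedge_zero_apply {n : ℕ} (α : V [⋀^Fin 0]→L[ℝ] ℝ) (η : V [⋀^Fin n]→L[ℝ] ℝ)
    (v : Fin n → V) : wedge 0 α η v = α ![] * η v := rfl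

lemma wedge_two_apply {n : ℕ} (α : V [⋀^Fin 2]→L[ℝ] ℝ) (η : V [⋀^Fin n]→L[ℝ] ℝ)
    (v : Fin (n + 2) → V) :
    wedge 2 α η v = (1 / 2) * ∑ a : Fin (n + 2), ∑ c : Fin (n + 1), (-1) ^ (a : ℕ) * (-1) ^ (c : ℕ) *
      (α ![v a, v (a.succAbove c)] * η fun i => v (a.succAbove (c.succAbove i))) := by
  rw [wedge_succ_apply]
  simp only [wedge_succ_apply (k := 0), wedge_zero_apply, contract_apply, Finset.mul_sum]
  refine Finset.sum_congr rfl fun a _ => Finset.sum_congr rfl fun c _ => ?_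
  simp only [Fin.removeNth]
  norm_num
  ring_nf
  rfl

lemma wedge_two_two_apply (α β : V [⋀^Fin 2]→L[ℝ] ℝ) (x y z w : V) :
    wedge 2 α β ![x, y, z, w] = α ![x, y] * β ![z, w] - α ![x, z] * β ![y, w]
      + α ![x, w] * β ![y, z] + α ![y, z] * β ![x, w] - α ![y, w] * β ![x, z]
      + α ![z, w] * β ![x, y] := by
  have h2 : ∀ (a : Fin 4) (c : Fin 3), β (fun i => ![x, y, z, w] (a.succAbove (c.succAbove i)))
      = β ![![x, y, z, w] (a.succAbove (c.succAbove 0)),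
        ![x, y, z, w] (a.succAbove (c.succAbove 1))] := fun a c => by
    congr 1; funext i; fin_cases i <;> rfl
  rw [wedge_two_apply]
  simp only [h2]
  change (1 / 2) * ∑ a : Fin 4, ∑ c : Fin 3, _ = _
  simp only [Fin.sum_univ_four, Fin.sum_univ_three]
  have s4 : ∀ (a : Fin 4) (c : Fin 3), a.succAbove c = ![![1, 2, 3], ![0, 2, 3], ![0, 1, 3],
      ![0, 1, 2]] a c := by decide
  have s3 : ∀ (a : Fin 3) (c : Fin 2), a.succAbove c = ![![1, 2], ![0, 2], ![0, 1]] a c := by decide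
  simp only [s4, s3, Matrix.cons_val]
  simp only [Fin.val_zero, Fin.val_one, Fin.val_two, show ((3 : Fin 4) : ℕ) = 3 from rfl]
  rw [twoForm_swap α y x, twoForm_swap α z x, twoForm_swap α w x, twoForm_swap α z y,
    twoForm_swap α w y, twoForm_swap α w z]
  ring

end Wedge

/-! ### The model form and adapted bases. -/

section Model

lemma dx2_apply (i j : Fin 8) (u v : E8) : dx2 i j ![u, v] = u i * v j - v i * u j := by
  rw [dx2, wedgeOne_apply_two]
  rfl

variable {V : Type*} [NormedAddCommGroup V] [InnerProductSpace ℝ V] [FiniteDimensional ℝ V]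

lemma inner_quatUnit (b : OrthonormalBasis (Fin 8) ℝ V) (s : Fin 3) (u v : V) :
    inner ℝ u (quatUnit b s v)
      = ∑ j, (unitSign s j : ℝ) * (inner ℝ (b (unitPerm s j)) u * inner ℝ (b j) v) := by
  conv_lhs => rw [← b.sum_repr' v, map_sum, inner_sum]
  refine Finset.sum_congr rfl fun j _ => ?_
  rw [map_smul, inner_smul_right, quatUnit_basis, inner_smul_right,
    real_inner_comm (b (unitPerm s j))]
  ring

lemma isAdapted_modelForm : IsAdapted (EuclideanSpace.basisFun (Fin 8) ℝ) modelForm := by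
  have hi : ∀ (j : Fin 8) (u : E8), inner ℝ (EuclideanSpace.basisFun (Fin 8) ℝ j) u = u j :=
    fun j u => by
      rw [EuclideanSpace.basisFun_apply, EuclideanSpace.inner_single_left]; simp
  have h1 : ∀ u v : E8, omega1 ![u, v]
      = inner ℝ u (quatUnit (EuclideanSpace.basisFun (Fin 8) ℝ) 0 v) := fun u v => by
    simp only [inner_quatUnit, hi, omega1, ContinuousAlternatingMap.add_apply, dx2_apply]
    simp [Fin.sum_univ_eight, unitPerm, unitSign]
    ring
  have h2 : ∀ u v : E8, omega2 ![u, v]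
      = inner ℝ u (quatUnit (EuclideanSpace.basisFun (Fin 8) ℝ) 1 v) := fun u v => by
    simp only [inner_quatUnit, hi, omega2, ContinuousAlternatingMap.add_apply,
      ContinuousAlternatingMap.sub_apply, dx2_apply]
    simp [Fin.sum_univ_eight, unitPerm, unitSign]
    ring
  have h3 : ∀ u v : E8, omega3 ![u, v]
      = inner ℝ u (quatUnit (EuclideanSpace.basisFun (Fin 8) ℝ) 2 v) := fun u v => by
    simp only [inner_quatUnit, hi, omega3, ContinuousAlternatingMap.add_apply, dx2_apply]
    simp [Fin.sum_univ_eight, unitPerm, unitSign]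
    ring
  intro x y z w
  simp only [modelForm, ContinuousAlternatingMap.add_apply, ContinuousAlternatingMap.smul_apply,
    wedge_two_two_apply, h1, h2, h3, Fin.sum_univ_three, smul_eq_mul]
  ring

/-- A form isometric to the model form has an adapted orthonormal basis. -/
lemma exists_isAdapted {Ω : V [⋀^Fin 4]→L[ℝ] ℝ}
    (h : ∃ u : V ≃ₗᵢ[ℝ] E8, Ω = modelForm.compContinuousLinearMap (u : V →L[ℝ] E8)) :
    ∃ b : OrthonormalBasis (Fin 8) ℝ V, IsAdapted b Ω := by
  obtain ⟨u, rfl⟩ := h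
  set eb := EuclideanSpace.basisFun (Fin 8) ℝ
  set b := eb.map u.symm
  have hb : ∀ j v, inner ℝ (b j) v = inner ℝ (eb j) (u v) := fun j v => by
    rw [OrthonormalBasis.map_apply, ← u.inner_map_map, u.apply_symm_apply]
  have hq : ∀ s v w, inner ℝ v (quatUnit b s w) = inner ℝ (u v) (quatUnit eb s (u w)) :=
    fun s v w => by simp only [inner_quatUnit, hb]
  refine ⟨b, fun x y z w => ?_⟩
  have e4 : (u : V →L[ℝ] E8) ∘ ![x, y, z, w] = ![u x, u y, u z, u w] := by
    funext i; fin_cases i <;> rfl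
  rw [ContinuousAlternatingMap.compContinuousLinearMap_apply, e4, isAdapted_modelForm]
  simp only [hq, eb]

end Model

/-! ### Self-duality, the volume form and the Hodge star description of the eigenspaces. -/

section Hodge

variable {V : Type*} [NormedAddCommGroup V] [InnerProductSpace ℝ V] [FiniteDimensional ℝ V]
variable {b : OrthonormalBasis (Fin 8) ℝ V} {Ω : V [⋀^Fin 4]→L[ℝ] ℝ}

lemma IsAdapted.apply_basis (hΩ : IsAdapted b Ω) (i j k l : Fin 8) :
    Ω ![b i, b j, b k, b l] = (modelCoeff i j k l : ℤ) := by
  rw [hΩ, modelCoeff]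
  simp only [inner_quatUnit_basis]
  push_cast
  rfl

/-- The self-duality of the model form. -/
lemma modelCoeff_dual : ∀ (a : Fin 8) (c : Fin 7) (d : Fin 6) (e : Fin 5),
    (-1) ^ (a + c + d + e : ℕ) * modelCoeff (a.succAbove (c.succAbove (d.succAbove (e.succAbove 0))))
      (a.succAbove (c.succAbove (d.succAbove (e.succAbove 1))))
      (a.succAbove (c.succAbove (d.succAbove (e.succAbove 2))))
      (a.succAbove (c.succAbove (d.succAbove (e.succAbove 3))))
    = modelCoeff a (a.succAbove c) (a.succAbove (c.succAbove d))
      (a.succAbove (c.succAbove (d.succAbove e))) := by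
  decide +kernel

end Hodge

/-- Iterated `succAbove` runs over the quadruples of distinct indices; the omitted summands have a
repeated index and vanish by hypothesis. -/
lemma sum_succAbove_four (F : Fin 8 → Fin 8 → Fin 8 → Fin 8 → ℝ)
    (h01 : ∀ i k l, F i i k l = 0) (h02 : ∀ i k l, F i k i l = 0) (h03 : ∀ i k l, F i k l i = 0)
    (h12 : ∀ i k l, F k i i l = 0) (h13 : ∀ i k l, F k i l i = 0) (h23 : ∀ i k l, F k l i i = 0) :
    ∑ a : Fin 8, ∑ c : Fin 7, ∑ d : Fin 6, ∑ e : Fin 5,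
      F a (a.succAbove c) (a.succAbove (c.succAbove d))
        (a.succAbove (c.succAbove (d.succAbove e)))
      = ∑ a, ∑ c, ∑ d, ∑ e, F a c d e := by
  have s1 : ∀ (f : Fin 8 → ℝ) (a : Fin 8), f a = 0 → ∑ c, f (a.succAbove c) = ∑ c, f c :=
    fun f a h => by rw [Fin.sum_univ_succAbove f a, h, zero_add]
  have s2 : ∀ (f : Fin 8 → ℝ) (a : Fin 8) (c : Fin 7), f a = 0 → f (a.succAbove c) = 0 →
      ∑ d, f (a.succAbove (c.succAbove d)) = ∑ d, f d := fun f a c h h' => by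
    rw [← s1 f a h, Fin.sum_univ_succAbove (fun i => f (a.succAbove i)) c, h', zero_add]
  have s3 : ∀ (f : Fin 8 → ℝ) (a : Fin 8) (c : Fin 7) (d : Fin 6), f a = 0 →
      f (a.succAbove c) = 0 → f (a.succAbove (c.succAbove d)) = 0 →
      ∑ e, f (a.succAbove (c.succAbove (d.succAbove e))) = ∑ d, f d := fun f a c d h h' h'' => by
    rw [← s2 f a c h h', Fin.sum_univ_succAbove (fun i => f (a.succAbove (c.succAbove i))) d,
      h'', zero_add]
  refine Finset.sum_congr rfl fun a _ => ?_
  rw [← s1 (fun c => ∑ d, ∑ e, F a c d e) a (by simp [h01])]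
  refine Finset.sum_congr rfl fun c _ => ?_
  rw [← s2 (fun d => ∑ e, F a (a.succAbove c) d e) a c (by simp [h02]) (by simp [h12])]
  refine Finset.sum_congr rfl fun d _ => ?_
  exact s3 (fun e => F a (a.succAbove c) (a.succAbove (c.succAbove d)) e) a c d (h03 _ _ _)
    (h13 _ _ _) (h23 _ _ _)

section Hodge

variable {V : Type*} [NormedAddCommGroup V] [InnerProductSpace ℝ V] [FiniteDimensional ℝ V]
variable {b : OrthonormalBasis (Fin 8) ℝ V} {Ω : V [⋀^Fin 4]→L[ℝ] ℝ}

/-- This is `*Ω = Ω` in components: the product of signs is the sign of the permutation that puts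
the four chosen indices in front of the remaining ones in increasing order. -/
lemma IsAdapted.dual_apply (hΩ : IsAdapted b Ω) (a : Fin 8) (c : Fin 7) (d : Fin 6) (e : Fin 5) :
    (-1) ^ (a : ℕ) * (-1) ^ (c : ℕ) * (-1) ^ (d : ℕ) * (-1) ^ (e : ℕ) *
      Ω (fun i => b (a.succAbove (c.succAbove (d.succAbove (e.succAbove i)))))
      = Ω ![b a, b (a.succAbove c), b (a.succAbove (c.succAbove d)),
        b (a.succAbove (c.succAbove (d.succAbove e)))] := by
  have h : (fun i => b (a.succAbove (c.succAbove (d.succAbove (e.succAbove i)))))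
      = ![b (a.succAbove (c.succAbove (d.succAbove (e.succAbove 0)))),
        b (a.succAbove (c.succAbove (d.succAbove (e.succAbove 1)))),
        b (a.succAbove (c.succAbove (d.succAbove (e.succAbove 2)))),
        b (a.succAbove (c.succAbove (d.succAbove (e.succAbove 3))))] := by
    funext i; fin_cases i <;> rfl
  rw [h, hΩ.apply_basis, hΩ.apply_basis, ← modelCoeff_dual]
  push_cast
  ring

lemma sum_modelCoeff_sq : ∑ a : Fin 8, ∑ c : Fin 8, ∑ d : Fin 8, ∑ e : Fin 8,
    modelCoeff a c d e ^ 2 = 720 := by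
  decide +kernel

lemma fourForm_eq01 (η : V [⋀^Fin 4]→L[ℝ] ℝ) (x y z : V) : η ![x, x, y, z] = 0 := by
  linarith [fourForm_swap01 η x x y z]

lemma fourForm_eq02 (η : V [⋀^Fin 4]→L[ℝ] ℝ) (x y z : V) : η ![x, y, x, z] = 0 := by
  rw [fourForm_swap12, fourForm_eq01, neg_zero]

lemma fourForm_eq03 (η : V [⋀^Fin 4]→L[ℝ] ℝ) (x y z : V) : η ![x, y, z, x] = 0 := by
  rw [fourForm_swap23, fourForm_eq02, neg_zero]

lemma fourForm_eq12 (η : V [⋀^Fin 4]→L[ℝ] ℝ) (x y z : V) : η ![y, x, x, z] = 0 := by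
  rw [fourForm_swap01, fourForm_eq02, neg_zero]

lemma fourForm_eq13 (η : V [⋀^Fin 4]→L[ℝ] ℝ) (x y z : V) : η ![y, x, z, x] = 0 := by
  rw [fourForm_swap01, fourForm_eq03, neg_zero]

lemma fourForm_eq23 (η : V [⋀^Fin 4]→L[ℝ] ℝ) (x y z : V) : η ![y, z, x, x] = 0 := by
  linarith [fourForm_swap23 η y z x x]

/-- By self-duality every term of `Ω ∧ Ω` is the square of a component. The squares sum to 720 over
ordered quadruples, and `720 / 24 = 30`. -/
lemma IsAdapted.volForm_apply (hΩ : IsAdapted b Ω) : volForm Ω b = 1 := by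
  have h1 : wedge 4 Ω Ω b = (1 / 24) * ∑ a : Fin 8, ∑ c : Fin 7, ∑ d : Fin 6, ∑ e : Fin 5,
      Ω ![b a, b (a.succAbove c), b (a.succAbove (c.succAbove d)),
        b (a.succAbove (c.succAbove (d.succAbove e)))] ^ 2 := by
    rw [wedge_succ_apply]
    simp only [wedge_succ_apply (k := 2), wedge_succ_apply (k := 1), wedge_succ_apply (k := 0),
      wedge_zero_apply, contract_apply, Finset.mul_sum]
    refine Finset.sum_congr rfl fun a _ => Finset.sum_congr rfl fun c _ =>
      Finset.sum_congr rfl fun d _ => Finset.sum_congr rfl fun e _ => ?_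
    have hd := hΩ.dual_apply a c d e
    change _ * (_ * (_ * (_ * (_ * (_ * (_ * (_ * (Ω ![b a, b (a.succAbove c),
      b (a.succAbove (c.succAbove d)), b (a.succAbove (c.succAbove (d.succAbove e)))] *
      Ω (fun i => b (a.succAbove (c.succAbove (d.succAbove (e.succAbove i))))))))))))) = _
    rw [sq]
    nth_rewrite 3 [← hd]
    push_cast
    ring
  have h2 := sum_succAbove_four (fun i j k l => Ω ![b i, b j, b k, b l] ^ 2)
    (fun i k l => by simp [fourForm_eq01]) (fun i k l => by simp [fourForm_eq02])
    (fun i k l => by simp [fourForm_eq03]) (fun i k l => by simp [fourForm_eq12])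
    (fun i k l => by simp [fourForm_eq13]) (fun i k l => by simp [fourForm_eq23])
  have h3 : ∑ a, ∑ c, ∑ d, ∑ e, Ω ![b a, b c, b d, b e] ^ 2 = 720 := by
    have := congrArg (fun z : ℤ => (z : ℝ)) sum_modelCoeff_sq
    push_cast at this
    rw [← this]
    simp only [hΩ.apply_basis]
  change (1 / 30 : ℝ) * wedge 4 Ω Ω b = 1
  rw [h1, h2, h3]
  norm_num

/-- Self-duality replaces the complementary component of `Ω` by `Ω(bᵢ, bⱼ, bₖ, bₗ)`, so the value is
half the contraction of `κ` with `Ω`. This identifies `starWedge` with `α ↦ *(α ∧ Ω)`. -/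
lemma IsAdapted.wedgeOne_wedge_apply (hΩ : IsAdapted b Ω) (κ : V [⋀^Fin 2]→L[ℝ] ℝ) (v w : V) :
    wedgeOne (flat v) (wedgeOne (flat w) (wedge 2 κ Ω)) b = starWedge b κ ![v, w] := by
  have h1 : wedgeOne (flat v) (wedgeOne (flat w) (wedge 2 κ Ω)) b
      = (1 / 2) * ∑ a : Fin 8, ∑ c : Fin 7, ∑ d : Fin 6, ∑ e : Fin 5,
      (fun i j k l => inner ℝ v (b i) * inner ℝ w (b j) *
        (κ ![b k, b l] * Ω ![b i, b j, b k, b l])) a (a.succAbove c) (a.succAbove (c.succAbove d))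
        (a.succAbove (c.succAbove (d.succAbove e))) := by
    simp only [wedgeOne_apply, wedge_two_apply, flat_apply, Finset.mul_sum]
    refine Finset.sum_congr rfl fun a _ => Finset.sum_congr rfl fun c _ =>
      Finset.sum_congr rfl fun d _ => Finset.sum_congr rfl fun e _ => ?_
    rw [← hΩ.dual_apply]
    simp only [Fin.removeNth]
    ring
  rw [h1, sum_succAbove_four (fun i j k l => inner ℝ v (b i) * inner ℝ w (b j) *
        (κ ![b k, b l] * Ω ![b i, b j, b k, b l])) (fun i k l => by simp [fourForm_eq01])
    (fun i k l => by simp [fourForm_eq02])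
    (fun i k l => by simp [fourForm_eq03]) (fun i k l => by simp [fourForm_eq12])
    (fun i k l => by simp [fourForm_eq13]) (fun i k l => by simp [fourForm_eq23])]
  have h2 : ∀ i j, ∑ k, ∑ l, inner ℝ v (b i) * inner ℝ w (b j) *
      (κ ![b k, b l] * Ω ![b i, b j, b k, b l])
      = inner ℝ v (b i) * inner ℝ w (b j) * (2 * starWedge b κ ![b i, b j]) := fun i j => by
    rw [← sum_twoForm_mul hΩ]
    simp only [Finset.mul_sum]
    refine Finset.sum_congr rfl fun k _ => Finset.sum_congr rfl fun l _ => ?_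
    rw [fourForm_pair_symm]
  simp only [h2]
  have h3 : starWedge b κ ![v, w]
      = ∑ i, ∑ j, inner ℝ v (b i) * inner ℝ w (b j) * starWedge b κ ![b i, b j] := by
    rw [← bil_apply]
    conv_lhs => rw [← b.sum_repr' v, ← b.sum_repr' w]
    simp only [map_sum, map_smul, LinearMap.sum_apply, LinearMap.smul_apply, smul_eq_mul,
      bil_apply, Finset.mul_sum]
    rw [Finset.sum_comm]
    refine Finset.sum_congr rfl fun k _ => Finset.sum_congr rfl fun l _ => ?_
    rw [real_inner_comm v, real_inner_comm w]
    ring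
  rw [h3, Finset.mul_sum]
  refine Finset.sum_congr rfl fun i _ => ?_
  rw [Finset.mul_sum]
  refine Finset.sum_congr rfl fun j _ => ?_
  ring

/-- A top form is determined by its value on a basis. -/
lemma topForm_ext (b : OrthonormalBasis (Fin 8) ℝ V) {η η' : V [⋀^Fin 8]→L[ℝ] ℝ}
    (h : η b = η' b) : η = η' := by
  have h1 := η.toAlternatingMap.eq_smul_basis_det b.toBasis
  have h2 := η'.toAlternatingMap.eq_smul_basis_det b.toBasis
  refine ContinuousAlternatingMap.toAlternatingMap_injective ?_
  rw [h1, h2]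
  congr 1

lemma IsAdapted.mem_eigenForms (hΩ : IsAdapted b Ω) (κ : V [⋀^Fin 2]→L[ℝ] ℝ) (c : ℝ) :
    κ ∈ eigenForms Ω c ↔ starWedge b κ = c • κ := by
  change (∀ v w : V, _ = _) ↔ _
  have h : ∀ v w, (wedgeOne (flat v) (wedgeOne (flat w) (wedge 2 κ Ω))
      = (c • κ) ![v, w] • volForm Ω) ↔ starWedge b κ ![v, w] = (c • κ) ![v, w] := fun v w => by
    rw [← hΩ.wedgeOne_wedge_apply κ v w]
    refine ⟨fun h => ?_, fun h => topForm_ext b ?_⟩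
    · rw [h, ContinuousAlternatingMap.smul_apply, hΩ.volForm_apply, smul_eq_mul, mul_one]
    · rw [h, ContinuousAlternatingMap.smul_apply, ContinuousAlternatingMap.smul_apply,
        hΩ.volForm_apply, smul_eq_mul _ (1 : ℝ), mul_one]
  exact ⟨fun h' => twoForm_ext fun u v => (h u v).1 (h' u v), fun h' u v => (h u v).2 (by rw [h'])⟩

lemma IsAdapted.mem_lambda15 (hΩ : IsAdapted b Ω) (κ : V [⋀^Fin 2]→L[ℝ] ℝ) :
    κ ∈ lambda15 Ω ↔ proj15 b κ = κ := by
  rw [lambda15, hΩ.mem_eigenForms, one_smul]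
  exact ⟨proj15_of_starWedge b, fun h => by rw [← h, starWedge_proj15]⟩

lemma IsAdapted.isCompl (hΩ : IsAdapted b Ω) :
    IsCompl (lambda15 Ω) (lambda3 Ω ⊔ lambda10 Ω) := by
  have h3 := fun κ => (hΩ.mem_eigenForms (proj3 b κ) 5).2 (starWedge_proj3 b κ)
  have h10 := fun κ => (hΩ.mem_eigenForms (proj10 b κ) (-3)).2 (starWedge_proj10 b κ)
  have h15 := fun κ => (hΩ.mem_lambda15 (proj15 b κ)).2 (proj15_proj15 b κ)
  constructor
  · rw [Submodule.disjoint_def]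
    intro κ hκ hκ'
    obtain ⟨α, hα, β, hβ, rfl⟩ := Submodule.mem_sup.1 hκ'
    have h := (hΩ.mem_eigenForms _ _).1 hκ
    rw [one_smul] at h
    have h0 := eq_zero_of_starWedge b h ((hΩ.mem_eigenForms _ _).1 hα)
      ((hΩ.mem_eigenForms _ _).1 hβ) rfl
    rw [h0.1, h0.2, add_zero]
  · rw [codisjoint_iff, eq_top_iff]
    rintro κ -
    rw [← proj_sum b κ]
    exact Submodule.add_mem_sup (h15 κ) (Submodule.add_mem_sup (h3 κ) (h10 κ))

/-- The explicit projection has the right image and the complement has the right eigenvalues. In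
particular the default branch of `pi15` is never taken for an adapted form. -/
lemma IsAdapted.pi15_eq (hΩ : IsAdapted b Ω) : pi15 Ω = proj15 b := by
  refine LinearMap.ext fun κ => ?_
  have h3 := (hΩ.mem_eigenForms (proj3 b κ) 5).2 (starWedge_proj3 b κ)
  have h10 := (hΩ.mem_eigenForms (proj10 b κ) (-3)).2 (starWedge_proj10 b κ)
  have h15 := (hΩ.mem_lambda15 (proj15 b κ)).2 (proj15_proj15 b κ)
  have h0 : (lambda15 Ω).projection _ hΩ.isCompl (proj3 b κ + proj10 b κ) = 0 :=
    (Submodule.projection_apply_eq_zero_iff hΩ.isCompl).2 (Submodule.add_mem_sup h3 h10)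
  rw [pi15, dif_pos hΩ.isCompl]
  nth_rewrite 1 [← proj_sum b κ]
  rw [map_add, h0, add_zero, Submodule.projection_apply_of_mem_left _ h15]

end Hodge

open Filter Topology Asymptotics

/-! ### Tangent vectors to orbits of the orthogonal group on forms. -/

section Orbit

variable {V : Type*} [NormedAddCommGroup V] [InnerProductSpace ℝ V] [FiniteDimensional ℝ V]

lemma comp_hasFDerivAt {n : ℕ} (w : V [⋀^Fin (n + 1)]→L[ℝ] ℝ) (m : V →L[ℝ] V) :
    HasFDerivAt (fun g : V →L[ℝ] V => w.compContinuousLinearMap g)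
      (w.fderivCompContinuousLinearMap m) m := by
  have h := (hasFDerivAt_const w m).continuousAlternatingMapCompContinuousLinearMap
    (hasFDerivAt_id m)
  refine h.congr_fderiv ?_
  ext s v
  simp

lemma fderivComp_mul {n : ℕ} (w : V [⋀^Fin (n + 1)]→L[ℝ] ℝ) (s m : V →L[ℝ] V) :
    w.fderivCompContinuousLinearMap m (s.comp m) = (endAct s w).compContinuousLinearMap m := by
  ext v
  rw [ContinuousAlternatingMap.fderivCompContinuousLinearMap_apply,
    ContinuousAlternatingMap.compContinuousLinearMap_apply, endAct_apply]
  refine Finset.sum_congr rfl fun a _ => ?_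
  congr 1
  funext j
  rcases eq_or_ne j a with rfl | h <;> simp [*]

lemma exp_isometry {s : V →L[ℝ] V} (hs : ∀ x y, inner ℝ (s x) y = -inner ℝ x (s y)) (t : ℝ)
    (x y : V) : inner ℝ (NormedSpace.exp (t • s) x) (NormedSpace.exp (t • s) y) = inner ℝ x y := by
  have := FiniteDimensional.complete ℝ V
  have hd : ∀ z t, HasDerivAt (fun u : ℝ => NormedSpace.exp (u • s) z)
      (s (NormedSpace.exp (t • s) z)) t := fun z t => by
    have h := hasDerivAt_exp_smul_const' s t
    exact h.clm_apply (hasDerivAt_const t z) |>.congr_deriv (by simp)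
  have h1 : ∀ t, HasDerivAt (fun u : ℝ => inner ℝ (NormedSpace.exp (u • s) x)
      (NormedSpace.exp (u • s) y) : ℝ → ℝ) 0 t := fun t =>
    ((hd x t).inner ℝ (hd y t)).congr_deriv (by rw [hs]; ring)
  have h2 := is_const_of_deriv_eq_zero (fun t => (h1 t).differentiableAt) (fun t => (h1 t).deriv) t 0
  simpa using h2

/-- The derivative of the curve of pullbacks is the pullback of `endAct s w`, which is zero. -/
lemma comp_exp {n : ℕ} {w : V [⋀^Fin (n + 1)]→L[ℝ] ℝ} {s : V →L[ℝ] V} (hw : endAct s w = 0)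
    (t : ℝ) : w.compContinuousLinearMap (NormedSpace.exp (t • s)) = w := by
  have := FiniteDimensional.complete ℝ V
  have h1 : ∀ t, HasDerivAt (fun u : ℝ => w.compContinuousLinearMap (NormedSpace.exp (u • s)))
      0 t := fun t => by
    have h := (comp_hasFDerivAt w (NormedSpace.exp (t • s))).comp_hasDerivAt t
      (hasDerivAt_exp_smul_const' s t)
    refine h.congr_deriv ?_
    have := fderivComp_mul w s (NormedSpace.exp (t • s))
    rw [hw] at this
    exact this
  have h2 := is_const_of_deriv_eq_zero (fun t => (h1 t).differentiableAt) (fun t => (h1 t).deriv) t 0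
  rw [h2]
  ext v
  simp

/-- The linear isometries of `V`. -/
def isometries (V : Type*) [NormedAddCommGroup V] [InnerProductSpace ℝ V] : Set (V →L[ℝ] V) :=
  {m | ∀ x y, inner ℝ (m x) (m y) = (inner ℝ x y : ℝ)}

lemma isCompact_isometries : IsCompact (isometries V) := by
  have := FiniteDimensional.complete ℝ V
  have : ProperSpace (V →L[ℝ] V) := FiniteDimensional.proper_real _
  refine Metric.isCompact_of_isClosed_isBounded ?_ ?_
  · have : isometries V = ⋂ x, ⋂ y, {m : V →L[ℝ] V | inner ℝ (m x) (m y) = (inner ℝ x y : ℝ)} := by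
      ext m; simp [isometries]
    rw [this]
    exact isClosed_iInter fun x => isClosed_iInter fun y =>
      isClosed_eq (by fun_prop) continuous_const
  · refine (Metric.isBounded_iff_subset_closedBall 0).2 ⟨1, fun m hm => ?_⟩
    rw [mem_closedBall_zero_iff]
    refine ContinuousLinearMap.opNorm_le_bound _ zero_le_one fun x => ?_
    rw [one_mul, norm_eq_sqrt_real_inner, hm, ← norm_eq_sqrt_real_inner]

variable {ι : Type*} [Fintype ι] (b : OrthonormalBasis ι ℝ V)

/-- The trace form of two endomorphisms. -/
def hs (s m : V →L[ℝ] V) : ℝ := ∑ i, inner ℝ (s (b i)) (m (b i))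

lemma norm_le_sum (e : V →L[ℝ] V) : ‖e‖ ≤ ∑ i, ‖e (b i)‖ := by
  refine ContinuousLinearMap.opNorm_le_bound _ (by positivity) fun x => ?_
  conv_lhs => rw [← b.sum_repr' x, map_sum]
  refine (norm_sum_le _ _).trans ?_
  rw [Finset.sum_mul]
  refine Finset.sum_le_sum fun i _ => ?_
  rw [map_smul, norm_smul, mul_comm]
  gcongr
  exact (norm_inner_le_norm _ _).trans (by simp)

/-- Among isometries, maximising the trace amounts to minimising the distance to the identity. -/
lemma sum_norm_sub_sq {m : V →L[ℝ] V} (hm : m ∈ isometries V) :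
    ∑ i, ‖m (b i) - b i‖ ^ 2 = 2 * (Fintype.card ι - hs b (ContinuousLinearMap.id ℝ V) m) := by
  have h : ∀ i, ‖m (b i) - b i‖ ^ 2 = 2 - 2 * inner ℝ (b i) (m (b i)) := fun i => by
    rw [norm_sub_sq_real, ← real_inner_self_eq_norm_sq, hm, real_inner_self_eq_norm_sq,
      b.norm_eq_one, real_inner_comm]
    norm_num
    ring
  simp only [h, hs, Finset.sum_sub_distrib, ← Finset.mul_sum]
  simp
  ring

/-- The isometries that carry `w` to a form close to `w` and are closest to the identity among the
isometries with this property are close to the identity. -/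
lemma tendsto_of_maximal {n : ℕ} (w : V [⋀^Fin (n + 1)]→L[ℝ] ℝ) {α : Type*} {l : Filter α}
    {m : α → V →L[ℝ] V} (hm : ∀ᶠ t in l, m t ∈ isometries V)
    (hmax : ∀ᶠ t in l, ∀ g ∈ isometries V,
      w.compContinuousLinearMap g = w.compContinuousLinearMap (m t) →
        hs b (ContinuousLinearMap.id ℝ V) g ≤ hs b (ContinuousLinearMap.id ℝ V) (m t))
    (hw : Tendsto (fun t => w.compContinuousLinearMap (m t)) l (𝓝 w)) :
    Tendsto m l (𝓝 (ContinuousLinearMap.id ℝ V)) := by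
  have := FiniteDimensional.complete ℝ V
  have hadj : ∀ g ∈ isometries V, (ContinuousLinearMap.adjoint g).comp g = ContinuousLinearMap.id ℝ V :=
    fun g hg => ContinuousLinearMap.ext fun x => ext_inner_right ℝ fun y => by
      rw [ContinuousLinearMap.comp_apply, ContinuousLinearMap.adjoint_inner_left, hg]; rfl
  have hadj' : ∀ g ∈ isometries V, g.comp (ContinuousLinearMap.adjoint g) = ContinuousLinearMap.id ℝ V :=
    fun g hg => by
      have h := (mul_eq_one_comm (M := V →ₗ[ℝ] V)).1
        (congrArg (fun z : V →L[ℝ] V => (z : V →ₗ[ℝ] V)) (hadj g hg))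
      exact ContinuousLinearMap.coe_injective h
  have key : ∀ δ > 0, ∀ᶠ t in l, Fintype.card ι - δ < hs b (ContinuousLinearMap.id ℝ V) (m t) := by
    intro δ hδ
    -- `U` is a neighbourhood of the stabiliser of `w`. The isometries outside it form a compact set
    -- whose image in the orbit is closed and misses `w`, so eventually `m t` lies in `U`, close to
    -- some stabilising `h`.
    set U : Set (V →L[ℝ] V) := ⋃ h ∈ {h ∈ isometries V | w.compContinuousLinearMap h = w},
      {g | Fintype.card ι - δ < hs b h g} with hU
    have hUo : IsOpen U := isOpen_biUnion fun h _ =>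
      isOpen_lt continuous_const (by unfold hs; fun_prop)
    have hc : IsCompact (isometries V \ U) := isCompact_isometries.diff hUo
    have hcont : Continuous fun g : V →L[ℝ] V => w.compContinuousLinearMap g :=
      continuous_iff_continuousAt.2 fun g => (comp_hasFDerivAt w g).continuousAt
    have hcl := (hc.image hcont).isClosed
    have hnot : w ∉ (fun g : V →L[ℝ] V => w.compContinuousLinearMap g) '' (isometries V \ U) := by
      rintro ⟨g, ⟨hg, hgU⟩, hgw⟩
      refine hgU (Set.mem_biUnion (x := g) ⟨hg, hgw⟩ ?_)
      have : hs b g g = Fintype.card ι := by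
        unfold hs
        simp only [hg _ _, real_inner_self_eq_norm_sq, b.norm_eq_one]
        simp
      change _ < hs b g g
      rw [this]; linarith
    filter_upwards [hm, hmax, hw.eventually (hcl.isOpen_compl.mem_nhds hnot)] with t h1 h2 h3
    have h4 : m t ∈ U := by
      by_contra h
      exact h3 ⟨m t, ⟨h1, h⟩, rfl⟩
    rw [hU, Set.mem_iUnion₂] at h4
    obtain ⟨h, ⟨hh, hhw⟩, h5⟩ := h4
    -- The competitor `h* ∘ m t` has the same pullback of `w` and trace above `card ι - δ`;
    -- maximality passes this bound to `m t`.
    have h6 : hs b h (m t) = hs b (ContinuousLinearMap.id ℝ V)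
        ((ContinuousLinearMap.adjoint h).comp (m t)) := by
      unfold hs
      refine Finset.sum_congr rfl fun i _ => ?_
      rw [ContinuousLinearMap.comp_apply, ContinuousLinearMap.adjoint_inner_right]; rfl
    have h7 : w.compContinuousLinearMap (ContinuousLinearMap.adjoint h) = w := by
      conv_lhs => rw [← hhw]
      change w.compContinuousLinearMap (h.comp (ContinuousLinearMap.adjoint h)) = w
      rw [hadj' h hh]
      rfl
    refine (lt_of_lt_of_le h5 (h6.le.trans (h2 _ ?_ ?_)))
    · intro x y
      rw [ContinuousLinearMap.comp_apply, ContinuousLinearMap.comp_apply,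
        ContinuousLinearMap.adjoint_inner_left, ← ContinuousLinearMap.comp_apply h, hadj' h hh,
        ContinuousLinearMap.id_apply, h1]
    · conv_rhs => rw [← h7]
      rfl
  have hle : ∀ᶠ t in l, hs b (ContinuousLinearMap.id ℝ V) (m t) ≤ Fintype.card ι := by
    filter_upwards [hm] with t ht
    have := sum_norm_sub_sq b ht
    have h0 : 0 ≤ ∑ i, ‖m t (b i) - b i‖ ^ 2 := by positivity
    linarith
  have htr : Tendsto (fun t => hs b (ContinuousLinearMap.id ℝ V) (m t)) l (𝓝 (Fintype.card ι)) := by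
    refine tendsto_order.2 ⟨fun a ha => ?_, fun a ha => ?_⟩
    · filter_upwards [key (Fintype.card ι - a) (by linarith)] with t ht
      linarith
    · filter_upwards [hle] with t ht
      linarith
  have hsum : Tendsto (fun t => ∑ i, ‖m t (b i) - b i‖ ^ 2) l (𝓝 0) := by
    have h0 : Tendsto (fun t => 2 * (Fintype.card ι - hs b (ContinuousLinearMap.id ℝ V) (m t))) l
        (𝓝 (2 * ((Fintype.card ι : ℝ) - Fintype.card ι))) := (htr.const_sub _).const_mul _
    rw [sub_self, mul_zero] at h0
    refine h0.congr' ?_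
    filter_upwards [hm] with t ht
    rw [sum_norm_sub_sq b ht]
  have hi : ∀ i, Tendsto (fun t => ‖m t (b i) - b i‖) l (𝓝 0) := fun i => by
    have h1 : Tendsto (fun t => ‖m t (b i) - b i‖ ^ 2) l (𝓝 0) :=
      squeeze_zero (fun t => by positivity)
        (fun t => Finset.single_le_sum (f := fun i => ‖m t (b i) - b i‖ ^ 2)
          (fun j _ => by positivity) (Finset.mem_univ i)) hsum
    have h2 := h1.sqrt
    simpa using h2
  rw [tendsto_iff_norm_sub_tendsto_zero]
  refine squeeze_zero (fun t => norm_nonneg _) (fun t => norm_le_sum b _) ?_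
  have := tendsto_finsetSum Finset.univ fun i (_ : i ∈ Finset.univ) => hi i
  simpa using this

/-- The skew endomorphisms. -/
def skew (V : Type*) [NormedAddCommGroup V] [InnerProductSpace ℝ V] : Submodule ℝ (V →L[ℝ] V) where
  carrier := {a | ∀ x y, inner ℝ (a x) y = -(inner ℝ x (a y) : ℝ)}
  add_mem' := fun {a c} ha hc x y => by
    simp only [add_apply, inner_add_left, inner_add_right, ha x y, hc x y]; ring
  zero_mem' := fun x y => by simp
  smul_mem' := fun r a ha x y => by
    simp only [smul_apply, inner_smul_left, inner_smul_right, ha x y]; simp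

/-- The derivation action on a fixed form. -/
def endActL {n : ℕ} (w : V [⋀^Fin (n + 1)]→L[ℝ] ℝ) : (V →L[ℝ] V) →ₗ[ℝ] V [⋀^Fin (n + 1)]→L[ℝ] ℝ where
  toFun a := endAct a w
  map_add' a c := endAct_add a c w
  map_smul' r a := endAct_smul r a w

/-- The skew endomorphisms that are orthogonal to the stabiliser algebra of `w`. -/
def transverse {n : ℕ} (w : V [⋀^Fin (n + 1)]→L[ℝ] ℝ) : Submodule ℝ (V →L[ℝ] V) where
  carrier := {a | a ∈ skew V ∧ ∀ s ∈ skew V, endAct s w = 0 → hs b s a = 0}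
  add_mem' := fun {a c} ha hc => ⟨add_mem ha.1 hc.1, fun s h h' => by
    have h1 := ha.2 s h h'
    have h2 := hc.2 s h h'
    unfold hs at h1 h2 ⊢
    simp only [add_apply, inner_add_right, Finset.sum_add_distrib, h1, h2, add_zero]⟩
  zero_mem' := ⟨zero_mem _, fun s _ _ => by simp [hs]⟩
  smul_mem' := fun r a ha => ⟨Submodule.smul_mem _ _ ha.1, fun s h h' => by
    have h1 := ha.2 s h h'
    unfold hs at h1 ⊢
    simp only [smul_apply, inner_smul_right, ← Finset.mul_sum, h1, mul_zero]⟩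

/-- A transverse element that kills `w` lies in the stabiliser algebra, hence is orthogonal to
itself. The action is thus injective on the transverse space, and in finite dimension bounded below.
-/
lemma exists_norm_le_endAct {n : ℕ} (w : V [⋀^Fin (n + 1)]→L[ℝ] ℝ) :
    ∃ K : ℝ, 0 < K ∧ ∀ a ∈ transverse b w, ‖a‖ ≤ K * ‖endAct a w‖ := by
  obtain ⟨K, hK, h⟩ := LinearMap.exists_antilipschitzWith (𝕜 := ℝ)
    (E := transverse b w) (F := V [⋀^Fin (n + 1)]→L[ℝ] ℝ)
    ((endActL w).comp (transverse b w).subtype)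
    (by
      rw [LinearMap.ker_eq_bot']
      rintro ⟨a, ha⟩ h0
      have h1 : hs b a a = 0 := ha.2 a ha.1 h0
      unfold hs at h1
      rw [Finset.sum_eq_zero_iff_of_nonneg fun i _ => real_inner_self_nonneg] at h1
      have h2 : ∀ i, a (b i) = 0 := fun i => inner_self_eq_zero.1 (h1 i (Finset.mem_univ i))
      have h3 : ‖a‖ ≤ 0 := (norm_le_sum b a).trans (by simp [h2])
      exact Subtype.ext (norm_le_zero_iff.1 h3))
  refine ⟨K, hK, fun a ha => ?_⟩
  have hz : endAct (0 : V →L[ℝ] V) w = 0 := (endActL w).map_zero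
  have := h.le_mul_dist ⟨a, ha⟩ 0
  simpa [endActL, hz] using this

lemma hs_adjoint {s : V →L[ℝ] V} (h : s ∈ skew V) {g g' : V →L[ℝ] V}
    (hg : ∀ x y, inner ℝ (g' x) y = (inner ℝ x (g y) : ℝ)) : hs b s g' = -hs b s g := by
  have h1 : ∀ i, inner ℝ (s (b i)) (g' (b i))
      = ∑ j, inner ℝ (s (b i)) (b j) * inner ℝ (b i) (g (b j)) := fun i => by
    rw [← b.sum_inner_mul_inner]
    refine Finset.sum_congr rfl fun j _ => ?_
    rw [← hg, real_inner_comm (g' (b i)) (b j)]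
  unfold hs
  simp only [h1]
  rw [Finset.sum_comm, ← Finset.sum_neg_distrib]
  refine Finset.sum_congr rfl fun j _ => ?_
  rw [← b.sum_inner_mul_inner, ← Finset.sum_neg_distrib]
  refine Finset.sum_congr rfl fun i _ => ?_
  rw [h (b i), real_inner_comm (s (b j))]
  ring

/-- First-order condition for the maximum along `u ↦ exp(u s) ∘ m`, whose members all pull `w` back
to the same form. -/
lemma hs_maximal {n : ℕ} (w : V [⋀^Fin (n + 1)]→L[ℝ] ℝ) {m : V →L[ℝ] V} (hm : m ∈ isometries V)
    (hmax : ∀ g ∈ isometries V, w.compContinuousLinearMap g = w.compContinuousLinearMap m →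
      hs b (ContinuousLinearMap.id ℝ V) g ≤ hs b (ContinuousLinearMap.id ℝ V) m)
    {s : V →L[ℝ] V} (h : s ∈ skew V) (hw : endAct s w = 0) : hs b s m = 0 := by
  have := FiniteDimensional.complete ℝ V
  have hd : HasDerivAt (fun u : ℝ => hs b (ContinuousLinearMap.id ℝ V)
      ((NormedSpace.exp (u • s)).comp m)) (-hs b s m) 0 := by
    unfold hs
    rw [← Finset.sum_neg_distrib]
    refine HasDerivAt.fun_sum fun i _ => ?_
    have h1 := (hasDerivAt_exp_smul_const' s (0 : ℝ)).clm_apply (hasDerivAt_const 0 (m (b i)))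
    have h2 := (hasDerivAt_const (0 : ℝ) (b i)).inner ℝ h1
    refine h2.congr_deriv ?_
    simp [h (b i)]
  have hl : IsLocalMax (fun u : ℝ => hs b (ContinuousLinearMap.id ℝ V)
      ((NormedSpace.exp (u • s)).comp m)) 0 := by
    refine Filter.Eventually.of_forall fun u => ?_
    have h0 : (NormedSpace.exp ((0 : ℝ) • s)).comp m = m := by
      rw [zero_smul, NormedSpace.exp_zero]; rfl
    change _ ≤ hs b (ContinuousLinearMap.id ℝ V) ((NormedSpace.exp ((0 : ℝ) • s)).comp m)
    rw [h0]
    refine hmax _ (fun x y => ?_) ?_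
    · rw [ContinuousLinearMap.comp_apply, ContinuousLinearMap.comp_apply, exp_isometry h, hm]
    · conv_rhs => rw [← comp_exp hw u]
      rfl
  have := hl.hasDerivAt_eq_zero hd
  linarith

/-- The tangent vectors to the orbit of a form under the orthogonal group come from skew
endomorphisms. -/
theorem exists_skew_of_orbit {n : ℕ} {w : V [⋀^Fin (n + 1)]→L[ℝ] ℝ}
    {η : ℝ → V [⋀^Fin (n + 1)]→L[ℝ] ℝ} {η' : V [⋀^Fin (n + 1)]→L[ℝ] ℝ} (hη : HasDerivAt η η' 0)
    (h0 : η 0 = w) (hm : ∀ᶠ t in 𝓝 0, ∃ m ∈ isometries V, w.compContinuousLinearMap m = η t) :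
    ∃ a ∈ skew V, η' = endAct a w := by
  have := FiniteDimensional.complete ℝ V
  set b := stdOrthonormalBasis ℝ V
  have hcont : Continuous fun g : V →L[ℝ] V => w.compContinuousLinearMap g :=
    continuous_iff_continuousAt.2 fun g => (comp_hasFDerivAt w g).continuousAt
  -- The curve is only differentiable at 0 and no smooth lift is available, so for each `t` the lift
  -- closest to the identity is chosen. Off the orbit the value 0 is irrelevant.
  have hex : ∀ t, ∃ m, (∃ m ∈ isometries V, w.compContinuousLinearMap m = η t) →
      m ∈ isometries V ∧ w.compContinuousLinearMap m = η t ∧ ∀ g ∈ isometries V,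
        w.compContinuousLinearMap g = w.compContinuousLinearMap m →
          hs b (ContinuousLinearMap.id ℝ V) g ≤ hs b (ContinuousLinearMap.id ℝ V) m := by
    intro t
    by_cases h : ∃ m ∈ isometries V, w.compContinuousLinearMap m = η t
    · obtain ⟨m, hm, hmw⟩ := h
      have hc : IsCompact (isometries V ∩ {g | w.compContinuousLinearMap g = η t}) :=
        isCompact_isometries.inter_right (isClosed_eq hcont continuous_const)
      obtain ⟨g, hg, hmax⟩ := hc.exists_isMaxOn ⟨m, hm, hmw⟩
        (f := hs b (ContinuousLinearMap.id ℝ V)) (by unfold hs; fun_prop)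
      refine ⟨g, fun _ => ⟨hg.1, hg.2, fun g' h' hw' => hmax ⟨h', ?_⟩⟩⟩
      rw [Set.mem_ofPred_eq, hw']
      exact hg.2
    · exact ⟨0, fun h' => absurd h' h⟩
  choose m hmm using hex
  have hgood : ∀ᶠ t in 𝓝[≠] (0 : ℝ), m t ∈ isometries V ∧ w.compContinuousLinearMap (m t) = η t ∧
      ∀ g ∈ isometries V, w.compContinuousLinearMap g = w.compContinuousLinearMap (m t) →
          hs b (ContinuousLinearMap.id ℝ V) g ≤ hs b (ContinuousLinearMap.id ℝ V) (m t) :=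
    (hm.filter_mono nhdsWithin_le_nhds).mono fun t ht => hmm t ht
  have hηw : Tendsto η (𝓝[≠] (0 : ℝ)) (𝓝 w) := by
    have := hη.continuousAt.tendsto
    rw [h0] at this
    exact this.mono_left nhdsWithin_le_nhds
  have hm1 := tendsto_of_maximal b w (hgood.mono fun t ht => ht.1) (hgood.mono fun t ht => ht.2.2)
    (hηw.congr' (hgood.mono fun t ht => ht.2.1.symm))
  set e : ℝ → V →L[ℝ] V := fun t => m t - ContinuousLinearMap.id ℝ V with he
  have he0 : Tendsto e (𝓝[≠] (0 : ℝ)) (𝓝 0) := by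
    have := hm1.sub_const (ContinuousLinearMap.id ℝ V)
    rwa [sub_self] at this
  -- `a t` is the skew part of `m t - 1`. Maximality makes it transverse to the stabiliser algebra.
  set a : ℝ → V →L[ℝ] V := fun t => (1 / 2 : ℝ) • (e t - ContinuousLinearMap.adjoint (e t)) with ha
  have haskew : ∀ t, a t ∈ skew V := fun t x y => by
    simp only [ha, smul_apply, sub_apply, inner_smul_left, inner_smul_right, inner_sub_left,
      inner_sub_right, ContinuousLinearMap.adjoint_inner_left,
      ContinuousLinearMap.adjoint_inner_right]
    simp
    ring
  have hatrans : ∀ᶠ t in 𝓝[≠] (0 : ℝ), a t ∈ transverse b w := by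
    filter_upwards [hgood] with t ht
    refine ⟨haskew t, fun s h hs0 => ?_⟩
    have h1 := hs_maximal b w ht.1 ht.2.2 h hs0
    have h2 := hs_adjoint b h (g := e t) (g' := ContinuousLinearMap.adjoint (e t))
      fun x y => ContinuousLinearMap.adjoint_inner_left _ _ _
    have h3 : hs b s (e t) = 0 := by
      have h4 : ∀ i, inner ℝ (s (b i)) (b i) = (0 : ℝ) := fun i => by
        have := h (b i) (b i)
        rw [real_inner_comm (s (b i)) (b i)] at this
        linarith
      unfold hs at h1 ⊢
      simp only [he, sub_apply, inner_sub_right, Finset.sum_sub_distrib, h1,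
        ContinuousLinearMap.id_apply, h4]
      simp
    have h5 : hs b s (a t) = (1 / 2) * (hs b s (e t) - hs b s (ContinuousLinearMap.adjoint (e t))) := by
      unfold hs
      simp only [ha, smul_apply, sub_apply, inner_smul_right, inner_sub_right,
        Finset.sum_sub_distrib, ← Finset.mul_sum]
    rw [h5, h2, h3]
    simp
  -- Expanding `(1 + e)*(1 + e) = 1` shows that the symmetric part of `e` is `-½ e* e`, of second
  -- order.
  have hσ : ∀ᶠ t in 𝓝[≠] (0 : ℝ), ‖e t - a t‖ ≤ ‖e t‖ * ‖e t‖ := by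
    filter_upwards [hgood] with t ht
    have h1 : e t - a t = -((1 / 2 : ℝ) • (ContinuousLinearMap.adjoint (e t)).comp (e t)) := by
      refine ContinuousLinearMap.ext fun x => ext_inner_right ℝ fun y => ?_
      have h2 := ht.1 x y
      have h3 : m t = ContinuousLinearMap.id ℝ V + e t := by simp [he]
      rw [h3] at h2
      simp only [add_apply, inner_add_left, inner_add_right, ContinuousLinearMap.id_apply] at h2
      simp only [ha, sub_apply, neg_apply, smul_apply, ContinuousLinearMap.comp_apply,
        inner_sub_left, inner_smul_left, inner_neg_left,
        ContinuousLinearMap.adjoint_inner_left]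
      simp
      linarith
    rw [h1, norm_neg, norm_smul]
    have h4 := ContinuousLinearMap.opNorm_comp_le (ContinuousLinearMap.adjoint (e t)) (e t)
    rw [LinearIsometryEquiv.norm_map] at h4
    norm_num
    nlinarith [norm_nonneg (e t), norm_nonneg ((ContinuousLinearMap.adjoint (e t)).comp (e t))]
  have hσo : (fun t => e t - a t) =o[𝓝[≠] (0 : ℝ)] e := by
    have h1 : (fun t => e t - a t) =O[𝓝[≠] (0 : ℝ)] fun t => ‖e t‖ * ‖e t‖ :=
      IsBigO.of_bound 1 (hσ.mono fun t ht => by simpa using ht)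
    refine h1.trans_isLittleO ?_
    have h2 : (fun t => ‖e t‖) =o[𝓝[≠] (0 : ℝ)] fun _ => (1 : ℝ) := by
      rw [isLittleO_one_iff]
      simpa using he0.norm
    simpa using (h2.mul_isBigO (isBigO_refl (fun t => ‖e t‖) _)).trans_isBigO
      (by simpa using (isBigO_refl e _).norm_left)
  have hr : (fun t => η t - w - endAct (a t) w) =o[𝓝[≠] (0 : ℝ)] e := by
    have h1 := (comp_hasFDerivAt w (ContinuousLinearMap.id ℝ V)).isLittleO.comp_tendsto hm1
    have h2 : (fun t => endAct (e t - a t) w) =o[𝓝[≠] (0 : ℝ)] e := by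
      refine IsBigO.trans_isLittleO ?_ hσo
      have : (fun t => endAct (e t - a t) w) = fun t =>
        w.fderivCompContinuousLinearMap (ContinuousLinearMap.id ℝ V) (e t - a t) := by
        funext t; rw [endAct_eq_fderiv]
      rw [this]
      exact ContinuousLinearMap.isBigO_comp _ _ _
    refine (h1.add h2).congr' ?_ Filter.EventuallyEq.rfl
    filter_upwards [hgood] with t ht
    have h3 : w.compContinuousLinearMap (ContinuousLinearMap.id ℝ V) = w := rfl
    simp only [Function.comp_apply, ht.2.1, h3, ← endAct_eq_fderiv]
    change η t - w - endAct (e t) w + _ = _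
    rw [endAct_sub (e t) (a t)]
    abel
  obtain ⟨K, hK, hKa⟩ := exists_norm_le_endAct b w
  have hη0 : (fun t => η t - w) =O[𝓝[≠] (0 : ℝ)] fun t => t := by
    have := hη.isBigO_sub
    rw [h0] at this
    simpa using this.mono nhdsWithin_le_nhds
  -- Absorption: `‖e‖ ≤ ‖e - a‖ + ‖a‖ ≤ ¼‖e‖ + K‖η - w‖ + ¼‖e‖`, so `‖e‖ ≤ 2K‖η - w‖`, which is
  -- `O(t)`.
  have heO : e =O[𝓝[≠] (0 : ℝ)] fun t => t := by
    refine IsBigO.trans ?_ hη0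
    refine IsBigO.of_bound (2 * K) ?_
    filter_upwards [hr.bound (c := 1 / (4 * K)) (by positivity),
      hσo.bound (c := 1 / 4) (by norm_num), hatrans] with t h1 h2 h3
    have h4 := hKa _ h3
    have h5 : ‖endAct (a t) w‖ ≤ ‖η t - w‖ + ‖η t - w - endAct (a t) w‖ := by
      have := norm_sub_le (η t - w) (η t - w - endAct (a t) w)
      rwa [sub_sub_cancel] at this
    have h6 : ‖e t‖ ≤ ‖e t - a t‖ + ‖a t‖ := by
      have := norm_add_le (e t - a t) (a t)
      rwa [sub_add_cancel] at this
    have h7 : K * ‖endAct (a t) w‖ ≤ K * (‖η t - w‖ + 1 / (4 * K) * ‖e t‖) := by gcongr; linarith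
    have h8 : K * (‖η t - w‖ + 1 / (4 * K) * ‖e t‖) = K * ‖η t - w‖ + 1 / 4 * ‖e t‖ := by
      field_simp
    linarith
  have hfin : Tendsto (fun t => endAct (t⁻¹ • a t) w) (𝓝[≠] (0 : ℝ)) (𝓝 η') := by
    have h1 := hasDerivAt_iff_tendsto_slope_zero.1 hη
    have h2 := (hr.trans_isBigO heO).tendsto_inv_smul_nhds_zero
    have h3 := h1.sub h2
    rw [sub_zero] at h3
    refine h3.congr fun t => ?_
    rw [endAct_smul t⁻¹ (a t), zero_add, h0]
    generalize endAct (a t) w = z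
    module
  -- The quotients `t⁻¹ a t` need not converge themselves, but their actions on `w` do, and these
  -- stay in a finite-dimensional, hence closed, subspace.
  have hcl : IsClosed (((skew V).map (endActL w) : Submodule ℝ (V [⋀^Fin (n + 1)]→L[ℝ] ℝ)) :
      Set (V [⋀^Fin (n + 1)]→L[ℝ] ℝ)) := Submodule.closed_of_finiteDimensional _
  have hmem := hcl.mem_of_tendsto hfin (Filter.Eventually.of_forall fun t =>
    ⟨t⁻¹ • a t, Submodule.smul_mem _ _ (haskew t), rfl⟩)
  obtain ⟨c, hc, hc'⟩ := hmem
  exact ⟨c, hc, hc'.symm⟩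

end Orbit

/-! ### Smoothness and derivatives of form-valued maps. -/

section FormCalculus

variable {V : Type*} [NormedAddCommGroup V] [InnerProductSpace ℝ V] [FiniteDimensional ℝ V]

/-- The components of a form in an orthonormal basis. -/
def components (k : ℕ) : (V [⋀^Fin k]→L[ℝ] ℝ) →ₗ[ℝ]
    ((Fin k → Fin (Module.finrank ℝ V)) → ℝ) where
  toFun η i := η fun a => stdOrthonormalBasis ℝ V (i a)
  map_add' η ζ := by funext i; simp
  map_smul' c η := by funext i; simp

lemma components_injective (k : ℕ) : Function.Injective (components (V := V) k) := by
  intro η ζ h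
  refine ContinuousAlternatingMap.toAlternatingMap_injective
    ((stdOrthonormalBasis ℝ V).toBasis.ext_alternating fun i _ => ?_)
  simpa [components] using congrFun h i

instance formFinite (k : ℕ) : FiniteDimensional ℝ (V [⋀^Fin k]→L[ℝ] ℝ) :=
  FiniteDimensional.of_injective _ (components_injective k)

variable {E : Type*} [NormedAddCommGroup E] [NormedSpace ℝ E] {s : Set E} {n : ℕ∞ω} {k : ℕ}

/-- A form is a linear function of its finitely many components, through a left inverse of
`components`. -/
lemma contDiffOn_of_eval {f : E → V [⋀^Fin k]→L[ℝ] ℝ}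
    (h : ∀ v, ContDiffOn ℝ n (fun x => f x v) s) : ContDiffOn ℝ n f s := by
  obtain ⟨R, hR⟩ := LinearMap.exists_leftInverse_of_injective (components (V := V) k)
    (LinearMap.ker_eq_bot.2 (components_injective k))
  have h1 : ContDiffOn ℝ n (fun x => components k (f x)) s :=
    contDiffOn_pi.2 fun i => h _
  have h2 := (LinearMap.toContinuousLinearMap R).contDiff.comp_contDiffOn h1
  refine h2.congr fun x _ => ?_
  exact (LinearMap.congr_fun hR (f x)).symm

lemma contDiffOn_apply_const {f : E → V [⋀^Fin k]→L[ℝ] ℝ} (hf : ContDiffOn ℝ n f s)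
    (v : Fin k → V) : ContDiffOn ℝ n (fun x => f x v) s :=
  (ContinuousAlternatingMap.apply ℝ V ℝ v).contDiff.comp_contDiffOn hf

lemma apply_eq_sum {ι : Type*} [Fintype ι] (b : OrthonormalBasis ι ℝ V) (η : V [⋀^Fin k]→L[ℝ] ℝ)
    (v : Fin k → V) : η v = ∑ i : Fin k → ι, (∏ a, inner ℝ (b (i a)) (v a)) *
      η fun a => b (i a) := by
  conv_lhs => rw [show v = fun a => ∑ i, (inner ℝ (b i) (v a) : ℝ) • b i from
    funext fun a => (b.sum_repr' (v a)).symm]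
  have h := η.toMultilinearMap.map_sum fun (a : Fin k) (i : ι) => (inner ℝ (b i) (v a) : ℝ) • b i
  refine h.trans (Finset.sum_congr rfl fun i _ => ?_)
  exact η.toMultilinearMap.map_smul_univ (fun a => (inner ℝ (b (i a)) (v a) : ℝ)) _

lemma contDiffOn_apply {f : E → V [⋀^Fin k]→L[ℝ] ℝ} (hf : ContDiffOn ℝ n f s)
    {v : E → Fin k → V} (hv : ∀ a, ContDiffOn ℝ n (fun x => v x a) s) :
    ContDiffOn ℝ n (fun x => f x (v x)) s := by
  simp only [fun x => apply_eq_sum (stdOrthonormalBasis ℝ V) (f x) (v x)]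
  refine ContDiffOn.sum fun i _ => ContDiffOn.mul ?_ (contDiffOn_apply_const hf _)
  exact contDiffOn_prod fun a _ => contDiffOn_const.inner ℝ (hv a)

lemma contDiffOn_comp {f : E → V [⋀^Fin k]→L[ℝ] ℝ} (hf : ContDiffOn ℝ n f s)
    {g : E → V →L[ℝ] V} (hg : ContDiffOn ℝ n g s) :
    ContDiffOn ℝ n (fun x => (f x).compContinuousLinearMap (g x)) s :=
  contDiffOn_of_eval fun v => contDiffOn_apply hf (v := fun x => g x ∘ v)
    fun _ => hg.clm_apply contDiffOn_const

/-- The derivation action as a continuous bilinear map. -/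
def endActB (V : Type*) [NormedAddCommGroup V] [InnerProductSpace ℝ V] [FiniteDimensional ℝ V]
    (k : ℕ) : (V →L[ℝ] V) →L[ℝ] (V [⋀^Fin (k + 1)]→L[ℝ] ℝ) →L[ℝ] V [⋀^Fin (k + 1)]→L[ℝ] ℝ :=
  (ContinuousAlternatingMap.fderivCompContinuousLinearMapCLM ℝ (ContinuousLinearMap.id ℝ V)).flip

lemma endActB_apply (A : V →L[ℝ] V) (η : V [⋀^Fin (k + 1)]→L[ℝ] ℝ) :
    endActB V k A η = endAct A η := (endAct_eq_fderiv A η).symm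

/-- The triple contraction as a continuous bilinear map. -/
def tripleContrB (V : Type*) [NormedAddCommGroup V] [InnerProductSpace ℝ V]
    [FiniteDimensional ℝ V] :
    (V [⋀^Fin 4]→L[ℝ] ℝ) →L[ℝ] (V [⋀^Fin 4]→L[ℝ] ℝ) →L[ℝ] V [⋀^Fin 2]→L[ℝ] ℝ :=
  (tripleContrL (V := V)).toContinuousBilinearMap

lemma tripleContrB_apply (ξ κ : V [⋀^Fin 4]→L[ℝ] ℝ) : tripleContrB V ξ κ = tripleContr ξ κ := rfl

lemma contDiffOn_endAct {A : E → V →L[ℝ] V} {η : E → V [⋀^Fin (k + 1)]→L[ℝ] ℝ}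
    (hA : ContDiffOn ℝ n A s) (hη : ContDiffOn ℝ n η s) :
    ContDiffOn ℝ n (fun x => endAct (A x) (η x)) s := by
  simp only [← endActB_apply]
  exact ((endActB V k).contDiff.comp_contDiffOn hA).clm_apply hη

lemma contDiffOn_tripleContr {ξ κ : E → V [⋀^Fin 4]→L[ℝ] ℝ}
    (hξ : ContDiffOn ℝ n ξ s) (hκ : ContDiffOn ℝ n κ s) :
    ContDiffOn ℝ n (fun x => tripleContr (ξ x) (κ x)) s := by
  simp only [← tripleContrB_apply]
  exact ((tripleContrB V).contDiff.comp_contDiffOn hξ).clm_apply hκ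

lemma differentiableAt_endAct {A : E → V →L[ℝ] V} {η : E → V [⋀^Fin (k + 1)]→L[ℝ] ℝ} {x : E}
    (hA : DifferentiableAt ℝ A x) (hη : DifferentiableAt ℝ η x) :
    DifferentiableAt ℝ (fun x => endAct (A x) (η x)) x := by
  simp only [← endActB_apply]
  exact ((endActB V k).hasFDerivAt_of_bilinear hA.hasFDerivAt hη.hasFDerivAt).differentiableAt

lemma fderiv_endAct {A : E → V →L[ℝ] V} {η : E → V [⋀^Fin (k + 1)]→L[ℝ] ℝ} {x : E}
    (hA : DifferentiableAt ℝ A x) (hη : DifferentiableAt ℝ η x) (y : E) :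
    fderiv ℝ (fun x => endAct (A x) (η x)) x y
      = endAct (A x) (fderiv ℝ η x y) + endAct (fderiv ℝ A x y) (η x) := by
  have h := (endActB V k).hasFDerivAt_of_bilinear hA.hasFDerivAt hη.hasFDerivAt
  simp only [← endActB_apply]
  rw [h.fderiv]
  rfl

lemma differentiableAt_tripleContr {ξ κ : E → V [⋀^Fin 4]→L[ℝ] ℝ} {x : E}
    (hξ : DifferentiableAt ℝ ξ x) (hκ : DifferentiableAt ℝ κ x) :
    DifferentiableAt ℝ (fun x => tripleContr (ξ x) (κ x)) x :=
  ((tripleContrB V).hasFDerivAt_of_bilinear hξ.hasFDerivAt hκ.hasFDerivAt).differentiableAt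

lemma fderiv_tripleContr {ξ κ : E → V [⋀^Fin 4]→L[ℝ] ℝ} {x : E}
    (hξ : DifferentiableAt ℝ ξ x) (hκ : DifferentiableAt ℝ κ x) (y : E) :
    fderiv ℝ (fun x => tripleContr (ξ x) (κ x)) x y
      = tripleContr (ξ x) (fderiv ℝ κ x y) + tripleContr (fderiv ℝ ξ x y) (κ x) := by
  have h := (tripleContrB V).hasFDerivAt_of_bilinear hξ.hasFDerivAt hκ.hasFDerivAt
  change fderiv ℝ (fun x => tripleContrB V (ξ x) (κ x)) x y = _
  rw [h.fderiv]
  rfl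

/-- The derivative of a pullback along an endomorphism field `g` with `g' = a ∘ g`. -/
lemma fderiv_comp_left {f : E → V [⋀^Fin (k + 1)]→L[ℝ] ℝ} {g : E → V →L[ℝ] V} {x : E}
    (hf : DifferentiableAt ℝ f x) (hg : DifferentiableAt ℝ g x) {y : E} {a : V →L[ℝ] V}
    (ha : fderiv ℝ g x y = a.comp (g x)) :
    fderiv ℝ (fun x => (f x).compContinuousLinearMap (g x)) x y
      = (fderiv ℝ f x y + endAct a (f x)).compContinuousLinearMap (g x) := by
  rw [fderiv_continuousAlternatingMapCompContinuousLinearMap hf hg]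
  have h := fderivComp_mul (f x) a (g x)
  rw [← ha] at h
  refine ContinuousAlternatingMap.ext fun v => ?_
  have h' := congrArg (fun z => z v) h
  simp only [ContinuousAlternatingMap.compContinuousLinearMap_apply] at h'
  simp only [ContinuousAlternatingMap.compContinuousLinearMap_apply, add_apply,
    ContinuousAlternatingMap.add_apply, ContinuousLinearMap.comp_apply,
    ContinuousAlternatingMap.compContinuousLinearMapCLM_apply, h']

end FormCalculus

set_option maxSynthPendingDepth 3

/-! ### The Levi-Civita connection in a chart: Koszul's formula. -/

section Koszul

variable {V : Type*} [NormedAddCommGroup V] [NormedSpace ℝ V]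

/-- A continuous trilinear map, with continuity forgotten. -/
def trilinear (D : V →L[ℝ] V →L[ℝ] V →L[ℝ] ℝ) : V →ₗ[ℝ] V →ₗ[ℝ] V →ₗ[ℝ] ℝ :=
  LinearMap.mk₂ ℝ (fun w u => ((D w u : V →L[ℝ] ℝ) : V →ₗ[ℝ] ℝ))
    (fun w w' u => by rw [map_add, add_apply]; rfl)
    (fun c w u => by rw [map_smul, smul_apply]; rfl)
    (fun w u u' => by rw [map_add]; rfl)
    (fun c w u => by rw [map_smul]; rfl)

/-- Koszul's formula can be checked on a basis. -/
lemma koszul_of_basis {ι : Type*} (e : Module.Basis ι ℝ V) {C : V → V →L[ℝ] V}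
    (hadd : ∀ u v, C (u + v) = C u + C v) (hsmul : ∀ (r : ℝ) u, C (r • u) = r • C u)
    {G : V →L[ℝ] V →L[ℝ] ℝ} {D : V →L[ℝ] V →L[ℝ] V →L[ℝ] ℝ}
    (h : ∀ i j l, G (C (e i) (e j)) (e l)
      = 1 / 2 * (D (e i) (e j) (e l) + D (e j) (e i) (e l) - D (e l) (e i) (e j)))
    (w u v : V) :
    G (C w u) v = 1 / 2 * (D w u v + D u w v - D v w u) := by
  let L : V →ₗ[ℝ] V →ₗ[ℝ] V →ₗ[ℝ] ℝ := LinearMap.mk₂ ℝ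
    (fun w u => ((G (C w u) : V →L[ℝ] ℝ) : V →ₗ[ℝ] ℝ))
    (fun w w' u => by rw [hadd, add_apply, map_add]; rfl)
    (fun c w u => by rw [hsmul, smul_apply, map_smul]; rfl)
    (fun w u u' => by rw [map_add, map_add]; rfl)
    (fun c w u => by rw [map_smul, map_smul]; rfl)
  let T := trilinear D
  let T' : V →ₗ[ℝ] V →ₗ[ℝ] V →ₗ[ℝ] ℝ := LinearMap.mk₂ ℝ (fun w u => (T.flip w).flip u)
    (fun w w' u => by ext v; simp)
    (fun c w u => by ext v; simp)
    (fun w u u' => by ext v; simp)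
    (fun c w u => by ext v; simp)
  have hLR : L = (1 / 2 : ℝ) • (T + T.flip - T') :=
    e.ext fun i => e.ext fun j => e.ext fun l => h i j l
  exact congrFun (congrArg DFunLike.coe (congrFun (congrArg DFunLike.coe
    (congrFun (congrArg DFunLike.coe hLR) w)) u)) v

end Koszul

section Table

/-- The endomorphism-valued linear map with a given table of coefficients. -/
def connOf (c : Fin 8 → Fin 8 → Fin 8 → ℝ) (u : E8) : E8 →L[ℝ] E8 :=
  ∑ k, ∑ i, ∑ j, (c k i j * u i) •
    (EuclideanSpace.proj j : E8 →L[ℝ] ℝ).smulRight (EuclideanSpace.single k (1 : ℝ))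

lemma connOf_apply (c : Fin 8 → Fin 8 → Fin 8 → ℝ) (u v : E8) : connOf c u v
    = ∑ k, (∑ i, ∑ j, c k i j * u i * v j) • EuclideanSpace.single k (1 : ℝ) := by
  simp only [connOf, sum_apply, smul_apply, ContinuousLinearMap.smulRight_apply, smul_smul,
    Finset.sum_smul]
  rfl

set_option synthInstance.maxHeartbeats 200000 in
lemma connOf_add (c : Fin 8 → Fin 8 → Fin 8 → ℝ) (u v : E8) :
    connOf c (u + v) = connOf c u + connOf c v := by
  simp only [connOf, PiLp.add_apply, mul_add, add_smul, Finset.sum_add_distrib]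

set_option synthInstance.maxHeartbeats 200000 in
lemma connOf_smul (c : Fin 8 → Fin 8 → Fin 8 → ℝ) (r : ℝ) (u : E8) :
    connOf c (r • u) = r • connOf c u := by
  simp only [connOf, PiLp.smul_apply, smul_eq_mul, Finset.smul_sum, smul_smul, mul_left_comm]

lemma connOf_single (c : Fin 8 → Fin 8 → Fin 8 → ℝ) (i j : Fin 8) :
    connOf c (EuclideanSpace.single i 1) (EuclideanSpace.single j 1)
      = ∑ k, c k i j • EuclideanSpace.single k (1 : ℝ) := by
  rw [connOf_apply]
  refine Finset.sum_congr rfl fun k _ => ?_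
  congr 1
  rw [Finset.sum_eq_single i, Finset.sum_eq_single j] <;> simp +contextual

lemma sum_single (u : E8) : ∑ i, u i • EuclideanSpace.single i (1 : ℝ) = u := by
  simpa using (EuclideanSpace.basisFun (Fin 8) ℝ).sum_repr u

end Table

/-! ### The metric in a chart, and the defining properties of the Christoffel symbols. -/

section Chart

variable {M : Type*} [TopologicalSpace M] [ChartedSpace E8 M] [IsManifold 𝓘(ℝ, E8) ∞ M]

lemma isOpen_chart_target (p : M) : IsOpen (chart p).target := isOpen_extChartAt_target p

lemma mem_chart_target (p : M) : chart p p ∈ (chart p).target := mem_extChartAt_target p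

lemma coordVec_isInvertible (p : M) {x : E8} (hx : x ∈ (chart p).target) :
    (coordVec p x).IsInvertible := by
  have : IsManifold 𝓘(ℝ, E8) 1 M := IsManifold.of_le (n := ∞) (by simp)
  have h := isInvertible_mfderivWithin_extChartAt_symm (I := 𝓘(ℝ, E8)) (x := p) hx
  rw [ModelWithCorners.range_eq_univ, mfderivWithin_univ] at h
  exact h

lemma coordVec_injective (p : M) {x : E8} (hx : x ∈ (chart p).target) :
    Function.Injective (coordVec p x) :=
  (coordVec_isInvertible p hx).injective

/-- The tangent space at `p` is `ℝ⁸` through the preferred chart at `p`, so at its own centre that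
chart has identity differential. -/
lemma coordVec_self (p : M) : coordVec p (chart p p) = ContinuousLinearMap.id ℝ E8 := by
  have : IsManifold 𝓘(ℝ, E8) 1 M := IsManifold.of_le (n := ∞) (by simp)
  have h := mfderivWithin_range_extChartAt_symm (I := 𝓘(ℝ, E8)) (x := p)
  rw [ModelWithCorners.range_eq_univ, mfderivWithin_univ] at h
  exact h

variable [RiemannianBundle (fun p : M => TS p)]
  [IsContMDiffRiemannianBundle 𝓘(ℝ, E8) ∞ E8 (fun p : M => TS p)]

lemma contDiffOn_inner_coordVec (p : M) (u v : E8) : ContDiffOn ℝ ∞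
    (fun x => (inner ℝ (coordVec p x u) (coordVec p x v) : ℝ)) (chart p).target := by
  have h : ∀ u : E8, ContMDiffOn 𝓘(ℝ, E8) (𝓘(ℝ, E8).prod 𝓘(ℝ, E8)) ∞
      (fun x : E8 => (⟨(chart p).symm x, coordVec p x u⟩ : TotalSpace E8 (fun p : M => TS p)))
      (chart p).target := by
    intro u
    have h1 := (contMDiffOn_extChartAt_symm (I := 𝓘(ℝ, E8)) (n := ∞)
      p).contMDiffOn_tangentMapWithin (m := ∞) (by simp) (isOpen_chart_target p).uniqueMDiffOn
    have h2 : ContMDiffOn 𝓘(ℝ, E8) (𝓘(ℝ, E8).prod 𝓘(ℝ, E8)) ∞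
        (fun x : E8 => (⟨x, u⟩ : TangentBundle 𝓘(ℝ, E8) E8)) (chart p).target :=
      contMDiffOn_vectorSpace_iff_contDiffOn.2 contDiffOn_const
    refine (h1.comp h2 fun x hx => hx).congr fun x hx => ?_
    simp only [Function.comp_apply, tangentMapWithin, coordVec]
    rw [mfderivWithin_of_isOpen (isOpen_chart_target p) hx]
    rfl
  exact contMDiffOn_iff_contDiffOn.1 ((h u).inner_bundle (h v))

/-- The metric in the chart at `p`. -/
def metric (p : M) (x : E8) : E8 →L[ℝ] E8 →L[ℝ] ℝ :=
  (innerSL ℝ : TS ((chart p).symm x) →L[ℝ] TS ((chart p).symm x) →L[ℝ] ℝ).bilinearComp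
    (coordVec p x) (coordVec p x)

lemma metric_apply (p : M) (x u v : E8) :
    metric p x u v = inner ℝ (coordVec p x u) (coordVec p x v) := rfl

lemma metric_symm (p : M) (x u v : E8) : metric p x u v = metric p x v u := by
  rw [metric_apply, metric_apply, real_inner_comm]

lemma metric_self_pos (p : M) {x : E8} (hx : x ∈ (chart p).target) {u : E8} (hu : u ≠ 0) :
    0 < metric p x u u := by
  rw [metric_apply]
  refine real_inner_self_pos.2 fun h => hu (coordVec_injective p hx ?_)
  rw [h, map_zero]

lemma eq_of_metric (p : M) {x : E8} (hx : x ∈ (chart p).target) {u w : E8}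
    (h : ∀ v, metric p x u v = metric p x w v) : u = w := by
  by_contra hne
  have h1 := metric_self_pos p hx (sub_ne_zero.2 hne)
  have h2 : metric p x (u - w) = 0 := ContinuousLinearMap.ext fun v => by simp [h v]
  rw [h2, zero_apply] at h1
  exact lt_irrefl _ h1

lemma contDiffOn_metric (p : M) : ContDiffOn ℝ ∞ (metric p) (chart p).target :=
  contDiffOn_clm_apply.2 fun u => contDiffOn_clm_apply.2 fun v => contDiffOn_inner_coordVec p u v

lemma contDiffAt_metric (p : M) {x : E8} (hx : x ∈ (chart p).target) :
    ContDiffAt ℝ ∞ (metric p) x :=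
  (contDiffOn_metric p).contDiffAt ((isOpen_chart_target p).mem_nhds hx)

lemma fderiv_metric_apply (p : M) {x : E8} (hx : x ∈ (chart p).target) (w u v : E8) :
    fderiv ℝ (fun y => metric p y u v) x w = fderiv ℝ (metric p) x w u v := by
  have h := ((contDiffAt_metric p hx).differentiableAt (by simp)).hasFDerivAt
  have h1 := (h.clm_apply (hasFDerivAt_const u x)).clm_apply (hasFDerivAt_const v x)
  rw [h1.fderiv]
  simp

lemma fderiv_metric_symm (p : M) {x : E8} (hx : x ∈ (chart p).target) (w u v : E8) :
    fderiv ℝ (metric p) x w u v = fderiv ℝ (metric p) x w v u := by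
  rw [← fderiv_metric_apply p hx, ← fderiv_metric_apply p hx]
  simp only [metric_symm p _ u v]

lemma gram_eq (p : M) (x : E8) (i j : Fin 8) : gram p x i j =
    metric p x (EuclideanSpace.single i 1) (EuclideanSpace.single j 1) := rfl

lemma dGram_eq (p : M) {x : E8} (hx : x ∈ (chart p).target) (k i j : Fin 8) :
    dGram p x k i j = fderiv ℝ (metric p) x (EuclideanSpace.single k 1)
      (EuclideanSpace.single i 1) (EuclideanSpace.single j 1) := by
  rw [← fderiv_metric_apply p hx]; rfl

/-- A null vector of the Gram matrix would be orthogonal to everything, against positive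
definiteness. -/
lemma gram_det_ne_zero (p : M) {x : E8} (hx : x ∈ (chart p).target) : (gram p x).det ≠ 0 := by
  refine fun h => ?_
  obtain ⟨v, hv, hv0⟩ := Matrix.exists_mulVec_eq_zero_iff.2 h
  set u : E8 := ∑ j, v j • EuclideanSpace.single j (1 : ℝ) with hu
  have h1 : ∀ i, metric p x (EuclideanSpace.single i 1) u = 0 := fun i => by
    have := congrFun hv0 i
    rw [hu, map_sum]
    simp only [map_smul, smul_eq_mul, ← gram_eq]
    simpa [Matrix.mulVec, dotProduct, mul_comm] using this
  have h2 : u = 0 := eq_of_metric p hx fun w => by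
    rw [metric_symm, map_zero, zero_apply, ← sum_single w]
    simp only [map_sum, map_smul, sum_apply, smul_apply, h1]
    simp
  refine hv (funext fun j => ?_)
  have := congrArg (fun z : E8 => z j) h2
  simpa [hu, Pi.single_apply] using this

lemma sum_christoffel_gram (p : M) {x : E8} (hx : x ∈ (chart p).target) (i j l : Fin 8) :
    ∑ k, christoffel p x k i j * gram p x k l
      = 1 / 2 * (dGram p x i j l + dGram p x j i l - dGram p x l i j) := by
  have h1 : gram p x * (gram p x)⁻¹ = 1 :=
    Matrix.mul_nonsing_inv _ (isUnit_iff_ne_zero.2 (gram_det_ne_zero p hx))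
  have h2 : ∀ m, ∑ k, (gram p x)⁻¹ k m * gram p x k l = if l = m then 1 else 0 := fun m => by
    have := congrFun (congrFun h1 l) m
    rw [Matrix.mul_apply, Matrix.one_apply] at this
    rw [← this]
    refine Finset.sum_congr rfl fun k _ => ?_
    rw [gram_eq p x k l, metric_symm, ← gram_eq, mul_comm]
  have h3 : ∀ k, christoffel p x k i j * gram p x k l = ∑ m, (1 / 2) *
      (dGram p x i j m + dGram p x j i m - dGram p x m i j) *
        ((gram p x)⁻¹ k m * gram p x k l) := fun k => by
    rw [christoffel, Finset.mul_sum, Finset.sum_mul]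
    refine Finset.sum_congr rfl fun m _ => ?_
    ring
  simp only [h3]
  rw [Finset.sum_comm]
  simp only [← Finset.mul_sum, h2]
  simp

lemma conn_eq (p : M) (x : E8) : conn p x = connOf (christoffel p x) := rfl

lemma metric_conn (p : M) {x : E8} (hx : x ∈ (chart p).target) (w u v : E8) :
    metric p x (conn p x w u) v = 1 / 2 * (fderiv ℝ (metric p) x w u v
      + fderiv ℝ (metric p) x u w v - fderiv ℝ (metric p) x v w u) := by
  refine koszul_of_basis (EuclideanSpace.basisFun (Fin 8) ℝ).toBasis
    (connOf_add (christoffel p x)) (connOf_smul (christoffel p x)) (fun i j l => ?_) w u v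
  simp only [OrthonormalBasis.coe_toBasis, EuclideanSpace.basisFun_apply]
  rw [connOf_single]
  simp only [map_sum, map_smul, sum_apply, smul_apply, smul_eq_mul, ← gram_eq, ← dGram_eq p hx]
  exact sum_christoffel_gram p hx i j l

lemma conn_symm (p : M) {x : E8} (hx : x ∈ (chart p).target) (u v : E8) :
    conn p x u v = conn p x v u :=
  eq_of_metric p hx fun w => by
    rw [metric_conn p hx, metric_conn p hx, fderiv_metric_symm p hx w u v]
    ring

lemma fderiv_metric (p : M) {x : E8} (hx : x ∈ (chart p).target) (w u v : E8) :
    fderiv ℝ (metric p) x w u v = metric p x (conn p x w u) v + metric p x u (conn p x w v) := by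
  rw [metric_symm p x u, metric_conn p hx, metric_conn p hx, fderiv_metric_symm p hx w v u,
    fderiv_metric_symm p hx u w v, fderiv_metric_symm p hx v w u]
  ring

/-- A symmetric bilinear map that is compatible with the metric to first order is given by the
Christoffel symbols. -/
lemma conn_unique (p : M) {x : E8} (hx : x ∈ (chart p).target) (B : E8 → E8 → E8)
    (hs : ∀ u v, B u v = B v u)
    (hm : ∀ w u v, fderiv ℝ (metric p) x w u v = metric p x (B w u) v + metric p x u (B w v))
    (w u : E8) : B w u = conn p x w u :=
  eq_of_metric p hx fun v => by
    rw [metric_conn p hx, hm, hm, hm, hs u w, hs v w, hs v u, metric_symm p x u (B w v),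
      metric_symm p x w]
    ring

end Chart

/-! ### Smoothness of matrix inverses by Cramer's rule. -/

section Smooth

variable {E : Type*} [NormedAddCommGroup E] [NormedSpace ℝ E] {s : Set E} {n : ℕ∞ω}
  {ι : Type*} [Fintype ι] [DecidableEq ι]

lemma contDiffOn_det {A : E → Matrix ι ι ℝ} (hA : ∀ i j, ContDiffOn ℝ n (fun x => A x i j) s) :
    ContDiffOn ℝ n (fun x => (A x).det) s := by
  simp only [Matrix.det_apply']
  exact ContDiffOn.sum fun σ _ => contDiffOn_const.mul (contDiffOn_prod fun i _ => hA _ _)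

lemma contDiffOn_inv {A : E → Matrix ι ι ℝ} (hA : ∀ i j, ContDiffOn ℝ n (fun x => A x i j) s)
    (h0 : ∀ x ∈ s, (A x).det ≠ 0) (i j : ι) : ContDiffOn ℝ n (fun x => (A x)⁻¹ i j) s := by
  simp only [Matrix.inv_def, Ring.inverse_eq_inv', Matrix.smul_apply, smul_eq_mul]
  refine ((contDiffOn_det hA).inv h0).mul ?_
  simp only [Matrix.adjugate_apply]
  refine contDiffOn_det fun k l => ?_
  by_cases h : k = j
  · subst h
    simp only [Matrix.updateRow_self]
    exact contDiffOn_const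
  · simp only [Matrix.updateRow_ne h]
    exact hA k l

end Smooth

/-! ### Changes of chart for tangent vectors, forms and the metric. -/

section Chart

variable {M : Type*} [TopologicalSpace M] [ChartedSpace E8 M] [IsManifold 𝓘(ℝ, E8) ∞ M]

/-- The change of coordinates from the chart at `p` to the chart at `q`. -/
def transition (p q : M) (x : E8) : E8 := chart q ((chart p).symm x)

lemma eventually_symm_eq (p : M) {x : E8} (hx : x ∈ (chart p).target) (q : M)
    (hq : (chart p).symm x ∈ (chart q).source) :
    ∀ᶠ x' in 𝓝 x, (chart p).symm x' ∈ (chart q).source ∧ x' ∈ (chart p).target := by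
  have hc : ContinuousAt (chart p).symm x := continuousAt_extChartAt_symm'' hx
  exact (hc.eventually ((isOpen_extChartAt_source q).mem_nhds hq)).and
    ((isOpen_chart_target p).mem_nhds hx)

lemma contDiffAt_transition (p : M) {x : E8} (hx : x ∈ (chart p).target) (q : M)
    (hq : (chart p).symm x ∈ (chart q).source) : ContDiffAt ℝ ∞ (transition p q) x := by
  have h := contDiffOn_ext_coord_change (I := 𝓘(ℝ, E8)) (n := ∞) q p
  refine h.contDiffAt ?_
  filter_upwards [eventually_symm_eq p hx q hq] with x' hx'
  rw [PartialEquiv.trans_source, PartialEquiv.symm_source]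
  exact ⟨hx'.2, hx'.1⟩

lemma coordVec_transition (p : M) {x : E8} (hx : x ∈ (chart p).target) (q : M)
    (hq : (chart p).symm x ∈ (chart q).source) :
    (coordVec p x : E8 →L[ℝ] E8)
      = (coordVec q (transition p q x) : E8 →L[ℝ] E8).comp (fderiv ℝ (transition p q) x) := by
  have : IsManifold 𝓘(ℝ, E8) 1 M := IsManifold.of_le (n := ∞) (by simp)
  have h1 : (chart p).symm =ᶠ[𝓝 x] (chart q).symm ∘ transition p q := by
    filter_upwards [eventually_symm_eq p hx q hq] with x' hx'
    exact ((chart q).left_inv hx'.1).symm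
  have hq' : transition p q x ∈ (chart q).target := (chart q).map_source hq
  have h2 : MDifferentiableAt 𝓘(ℝ, E8) 𝓘(ℝ, E8) (chart q).symm (transition p q x) := by
    have := mdifferentiableWithinAt_extChartAt_symm (I := 𝓘(ℝ, E8)) hq'
    rwa [ModelWithCorners.range_eq_univ, mdifferentiableWithinAt_univ] at this
  have h3 := (contDiffAt_transition p hx q hq).differentiableAt (by simp)
  have h4 := h1.mfderiv_eq (I := 𝓘(ℝ, E8)) (I' := 𝓘(ℝ, E8))
  have h5 := mfderiv_comp x h2 h3.mdifferentiableAt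
  rw [mfderiv_eq_fderiv] at h5
  exact h4.trans h5

lemma inChart_transition {k : ℕ} (η : ∀ q : M, TS q [⋀^Fin k]→L[ℝ] ℝ) (p : M) {x : E8}
    (hx : x ∈ (chart p).target) (q : M) (hq : (chart p).symm x ∈ (chart q).source) :
    inChart η p x = (inChart η q (transition p q x)).compContinuousLinearMap
      (fderiv ℝ (transition p q) x) := by
  -- All tangent spaces are copies of `ℝ⁸`; reading `η` as a family with values in one fixed space
  -- lets the base point be rewritten.
  let η' : M → E8 [⋀^Fin k]→L[ℝ] ℝ := η
  change (η' _).compContinuousLinearMap (coordVec p x : E8 →L[ℝ] E8)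
    = ((η' _).compContinuousLinearMap (coordVec q (transition p q x) :
      E8 →L[ℝ] E8)).compContinuousLinearMap _
  rw [coordVec_transition p hx q hq, transition, (chart q).left_inv hq]
  rfl

variable [RiemannianBundle (fun p : M => TS p)]
  [IsContMDiffRiemannianBundle 𝓘(ℝ, E8) ∞ E8 (fun p : M => TS p)]

lemma metric_transition (p : M) {x : E8} (hx : x ∈ (chart p).target) (q : M)
    (hq : (chart p).symm x ∈ (chart q).source) (u v : E8) :
    metric p x u v = metric q (transition p q x) (fderiv ℝ (transition p q) x u)
      (fderiv ℝ (transition p q) x v) := by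
  let ip : M → E8 → E8 → ℝ := fun q => fun (u v : TS q) => inner ℝ u v
  have h1 : metric p x u v = ip ((chart p).symm x) ((coordVec p x : E8 →L[ℝ] E8) u)
    ((coordVec p x : E8 →L[ℝ] E8) v) := rfl
  have h2 : ∀ u v, metric q (transition p q x) u v = ip ((chart q).symm (transition p q x))
    ((coordVec q (transition p q x) : E8 →L[ℝ] E8) u)
    ((coordVec q (transition p q x) : E8 →L[ℝ] E8) v) := fun u v => rfl
  rw [h1, h2, coordVec_transition p hx q hq]
  have h3 : (chart q).symm (transition p q x) = (chart p).symm x := (chart q).left_inv hq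
  rw [h3]
  rfl

lemma contDiffOn_conn (p : M) (y : E8) :
    ContDiffOn ℝ ∞ (fun x => conn p x y) (chart p).target := by
  have hg : ∀ i j, ContDiffOn ℝ ∞ (fun x => gram p x i j) (chart p).target :=
    fun i j => contDiffOn_inner_coordVec p _ _
  have hd : ∀ k i j, ContDiffOn ℝ ∞ (fun x => dGram p x k i j) (chart p).target :=
    fun k i j => ((hg i j).fderiv_of_isOpen (isOpen_chart_target p) (by simp)).clm_apply
      contDiffOn_const
  have hc : ∀ k i j, ContDiffOn ℝ ∞ (fun x => christoffel p x k i j) (chart p).target :=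
    fun k i j => contDiffOn_const.mul (ContDiffOn.sum fun l _ =>
      (contDiffOn_inv hg (fun x hx => gram_det_ne_zero p hx) k l).mul
        (((hd i j l).add (hd j i l)).sub (hd l i j)))
  unfold conn
  exact ContDiffOn.sum fun k _ => ContDiffOn.sum fun i _ => ContDiffOn.sum fun j _ =>
    ((hc k i j).mul contDiffOn_const).smul contDiffOn_const

end Chart

/-! ### Derivatives of pulled-back metrics and forms. -/

section Pullback

variable {V : Type*} [NormedAddCommGroup V] [NormedSpace ℝ V]

lemma fderiv_pullback_metric {φ : V → V} {G : V → V →L[ℝ] V →L[ℝ] ℝ} {x : V}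
    (hφ : ContDiffAt ℝ ∞ φ x) (hG : DifferentiableAt ℝ G (φ x)) (w u v : V) :
    fderiv ℝ (fun z => G (φ z) (fderiv ℝ φ z u) (fderiv ℝ φ z v)) x w
      = fderiv ℝ G (φ x) (fderiv ℝ φ x w) (fderiv ℝ φ x u) (fderiv ℝ φ x v)
        + G (φ x) (fderiv ℝ (fderiv ℝ φ) x w u) (fderiv ℝ φ x v)
        + G (φ x) (fderiv ℝ φ x u) (fderiv ℝ (fderiv ℝ φ) x w v) := by
  have h1 := (hφ.differentiableAt (by simp)).hasFDerivAt
  have h2 := ((hφ.fderiv_right (m := ∞) (by simp)).differentiableAt (by simp)).hasFDerivAt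
  have h3 := hG.hasFDerivAt.comp x h1
  have h4 := (h3.clm_apply (h2.clm_apply (hasFDerivAt_const u x))).clm_apply
    (h2.clm_apply (hasFDerivAt_const v x))
  have h5 := congrArg (fun L => L w) h4.fderiv
  refine h5.trans ?_
  simp
  ring

end Pullback

section FormPullback

variable {V : Type*} [NormedAddCommGroup V] [InnerProductSpace ℝ V] [FiniteDimensional ℝ V]

lemma endAct_compContinuousLinearMap {k : ℕ} (η : V [⋀^Fin (k + 1)]→L[ℝ] ℝ) (A S : V →L[ℝ] V) :
    endAct S (η.compContinuousLinearMap A) = η.fderivCompContinuousLinearMap A (A.comp S) := by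
  ext v
  rw [ContinuousAlternatingMap.fderivCompContinuousLinearMap_apply, endAct_apply]
  refine Finset.sum_congr rfl fun a _ => ?_
  rw [ContinuousAlternatingMap.compContinuousLinearMap_apply]
  congr 1
  funext j
  rcases eq_or_ne j a with rfl | h <;> simp [*]

/-- The second derivative of `φ` produced by the product rule cancels the inhomogeneous term in the
transformation law `hS`. -/
lemma fderiv_comp_sub_endAct {k : ℕ} {φ : V → V} {η : V → V [⋀^Fin (k + 1)]→L[ℝ] ℝ} {x : V}
    (hφ : ContDiffAt ℝ ∞ φ x) (hη : DifferentiableAt ℝ η (φ x)) {S S' : V →L[ℝ] V} {y : V}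
    (hS : ∀ u, fderiv ℝ φ x (S u) = S' (fderiv ℝ φ x u) + fderiv ℝ (fderiv ℝ φ) x y u) :
    fderiv ℝ (fun z => (η (φ z)).compContinuousLinearMap (fderiv ℝ φ z)) x y
        - endAct S ((η (φ x)).compContinuousLinearMap (fderiv ℝ φ x))
      = (fderiv ℝ η (φ x) (fderiv ℝ φ x y)
        - endAct S' (η (φ x))).compContinuousLinearMap (fderiv ℝ φ x) := by
  have h1 := hφ.differentiableAt (n := ∞) (by simp)
  have h2 := (hφ.fderiv_right (m := ∞) (by simp)).differentiableAt (by simp)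
  have h3 : DifferentiableAt ℝ (fun z => η (φ z)) x := hη.comp x h1
  have h6 : fderiv ℝ (fun z => η (φ z)) x y = fderiv ℝ η (φ x) (fderiv ℝ φ x y) := by
    rw [fderiv_fun_comp x hη h1]; rfl
  have h4 : (fderiv ℝ φ x).comp S = S'.comp (fderiv ℝ φ x) + fderiv ℝ (fderiv ℝ φ) x y :=
    ContinuousLinearMap.ext fun u => hS u
  rw [fderiv_continuousAlternatingMapCompContinuousLinearMap h3 h2,
    endAct_compContinuousLinearMap, h4, map_add, fderivComp_mul]
  refine ContinuousAlternatingMap.ext fun v => ?_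
  simp only [add_apply, ContinuousAlternatingMap.sub_apply, ContinuousAlternatingMap.add_apply,
    ContinuousLinearMap.comp_apply, ContinuousAlternatingMap.compContinuousLinearMapCLM_apply,
    ContinuousAlternatingMap.compContinuousLinearMap_apply, h6]
  ring

end FormPullback

/-! ### Independence of the covariant derivative from the chart. -/

section Chart

variable {M : Type*} [TopologicalSpace M] [ChartedSpace E8 M] [IsManifold 𝓘(ℝ, E8) ∞ M]
variable [RiemannianBundle (fun p : M => TS p)]
  [IsContMDiffRiemannianBundle 𝓘(ℝ, E8) ∞ E8 (fun p : M => TS p)]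

/-- The transformation law of the Christoffel symbols. -/
lemma conn_transition (p : M) {x : E8} (hx : x ∈ (chart p).target) (q : M)
    (hq : (chart p).symm x ∈ (chart q).source) (w u : E8) :
    fderiv ℝ (transition p q) x (conn p x w u)
      = conn q (transition p q x) (fderiv ℝ (transition p q) x w) (fderiv ℝ (transition p q) x u)
        + fderiv ℝ (fderiv ℝ (transition p q)) x w u := by
  set φ := transition p q with hφ
  have hq' : φ x ∈ (chart q).target := (chart q).map_source hq
  have hsm := contDiffAt_transition p hx q hq
  have hinj : Function.Injective (fderiv ℝ φ x) := by
    have h := coordVec_injective p hx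
    have h' : Function.Injective (coordVec p x : E8 →L[ℝ] E8) := h
    rw [coordVec_transition p hx q hq] at h'
    exact Function.Injective.of_comp (f := (coordVec q (transition p q x) : E8 →L[ℝ] E8)) h'
  have hsurj : Function.Surjective (fderiv ℝ φ x) :=
    (LinearMap.injective_iff_surjective (f := (fderiv ℝ φ x : E8 →ₗ[ℝ] E8))).1 hinj
  have hsym : ∀ w u, fderiv ℝ (fderiv ℝ φ) x w u = fderiv ℝ (fderiv ℝ φ) x u w := fun w u =>
    (hsm.isSymmSndFDerivAt (by simp; exact ENat.LEInfty.out)).eq w u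
  -- `B` is the connection of the chart at `q` pulled back by `φ`. It is symmetric and compatible
  -- with the metric, so `conn_unique` identifies it.
  choose B hB using fun w u => hsurj (conn q (φ x) (fderiv ℝ φ x w) (fderiv ℝ φ x u)
        + fderiv ℝ (fderiv ℝ φ) x w u)
  have hm : ∀ w u v, fderiv ℝ (metric p) x w u v = metric p x (B w u) v + metric p x u (B w v) := by
    intro w u v
    have hev : (fun z => metric p z u v)
        =ᶠ[𝓝 x] fun z => metric q (φ z) (fderiv ℝ φ z u) (fderiv ℝ φ z v) := by
      filter_upwards [eventually_symm_eq p hx q hq] with z hz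
      exact metric_transition p hz.2 q hz.1 u v
    rw [← fderiv_metric_apply p hx, hev.fderiv_eq, fderiv_pullback_metric hsm
      ((contDiffAt_metric q hq').differentiableAt (by simp)), fderiv_metric q hq',
      metric_transition p hx q hq, metric_transition p hx q hq, ← hφ, hB, hB]
    simp only [map_add, add_apply]
    ring
  rw [← hB, conn_unique p hx B (fun w u => hinj ?_) hm]
  rw [hB, hB, hsym w u, conn_symm q hq']

/-- The covariant derivative of a field of forms, read in the chart at `p`. -/
def nablaAt {k : ℕ} (η : ∀ q : M, TS q [⋀^Fin (k + 1)]→L[ℝ] ℝ) (p : M) (x y : E8) :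
    E8 [⋀^Fin (k + 1)]→L[ℝ] ℝ :=
  fderiv ℝ (inChart η p) x y - endAct (conn p x y) (inChart η p x)

lemma nablaAt_transition {k : ℕ} {η : ∀ q : M, TS q [⋀^Fin (k + 1)]→L[ℝ] ℝ} (hη : IsSmoothForm η)
    (p : M) {x : E8} (hx : x ∈ (chart p).target) (q : M)
    (hq : (chart p).symm x ∈ (chart q).source) (y : E8) :
    nablaAt η p x y = (nablaAt η q (transition p q x)
      (fderiv ℝ (transition p q) x y)).compContinuousLinearMap (fderiv ℝ (transition p q) x) := by
  have hq' : transition p q x ∈ (chart q).target := (chart q).map_source hq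
  have hev : inChart η p =ᶠ[𝓝 x] fun z => (inChart η q (transition p q z)).compContinuousLinearMap
      (fderiv ℝ (transition p q) z) := by
    filter_upwards [eventually_symm_eq p hx q hq] with z hz
    exact inChart_transition η p hz.2 q hz.1
  have hd : DifferentiableAt ℝ (inChart η q) (transition p q x) :=
    ((hη q).contDiffAt ((isOpen_chart_target q).mem_nhds hq')).differentiableAt (by simp)
  rw [nablaAt, hev.fderiv_eq, inChart_transition η p hx q hq, nablaAt]
  exact fderiv_comp_sub_endAct (contDiffAt_transition p hx q hq) hd
    (conn_transition p hx q hq y)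

/-- `nablaForm` uses a different chart at every point. This expresses it in the fixed chart at `p`,
where it can be differentiated again. -/
lemma nablaForm_coordVec {k : ℕ} {η : ∀ q : M, TS q [⋀^Fin (k + 1)]→L[ℝ] ℝ} (hη : IsSmoothForm η)
    (p : M) {x : E8} (hx : x ∈ (chart p).target) (y : E8) :
    (nablaForm η ((chart p).symm x) (coordVec p x y)).compContinuousLinearMap (coordVec p x)
      = nablaAt η p x y := by
  have hq := mem_extChartAt_source (I := 𝓘(ℝ, E8)) ((chart p).symm x)
  have h1 : (coordVec p x : E8 →L[ℝ] E8) = fderiv ℝ (transition p ((chart p).symm x)) x := by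
    rw [coordVec_transition p hx _ hq, transition, coordVec_self]
    rfl
  rw [nablaAt_transition hη p hx ((chart p).symm x) hq, ← h1]
  rfl

end Chart

/-! ### Smooth isometric frames. -/

section SquareRoot

/-- Inverse function theorem at 1, where squaring has the invertible derivative `2`. -/
lemma exists_local_sqrt (R : Type*) [NormedRing R] [NormedAlgebra ℝ R] [CompleteSpace R] :
    ∃ g : OpenPartialHomeomorph R R, (∀ S, g S = S * S) ∧ 1 ∈ g.source ∧
      ContDiffAt ℝ ω g.symm 1 := by
  have hf : ContDiffAt ℝ ω (fun S : R => S * S) 1 := (contDiff_id.mul contDiff_id).contDiffAt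
  have hd : HasFDerivAt (fun S : R => S * S)
      ((ContinuousLinearEquiv.smulLeft (Units.mk0 (2 : ℝ) (by simp)) : R ≃L[ℝ] R) : R →L[ℝ] R)
      1 := by
    have h := (hasFDerivAt_id (𝕜 := ℝ) (1 : R)).mul' (hasFDerivAt_id (1 : R))
    refine h.congr_fderiv (ContinuousLinearMap.ext fun S => ?_)
    change (1 : R) * S + S * 1 = (2 : ℝ) • S
    rw [one_mul, mul_one, two_smul]
  refine ⟨hf.toOpenPartialHomeomorph _ hd (by simp), fun S => rfl,
    hf.mem_toOpenPartialHomeomorph_source hd (by simp), ?_⟩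
  have h := hf.to_localInverse hd (by simp)
  rw [mul_one] at h
  exact h

end SquareRoot

section Frame

variable {V : Type*} [NormedAddCommGroup V] [InnerProductSpace ℝ V] [FiniteDimensional ℝ V]

/-- A smooth square root near the identity, which preserves symmetry. -/
lemma exists_smooth_sqrt : ∃ r : (V →L[ℝ] V) → V →L[ℝ] V, ContDiffAt ℝ ω r 1 ∧
    ∀ᶠ P in 𝓝 (1 : V →L[ℝ] V), r P * r P = P ∧
      ((∀ u v, inner ℝ (P u) v = inner ℝ u (P v)) → ∀ u v, inner ℝ (r P u) v = inner ℝ u (r P v)) := by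
  have : CompleteSpace V := FiniteDimensional.complete ℝ V
  obtain ⟨g, hg, h1, hsm⟩ := exists_local_sqrt (V →L[ℝ] V)
  have hg1 : g 1 = 1 := by rw [hg, mul_one]
  have h1' : (1 : V →L[ℝ] V) ∈ g.target := hg1 ▸ g.map_source h1
  have hg1' : g.symm 1 = 1 := by
    conv_lhs => rw [← hg1]
    exact g.left_inv h1
  have hc : ContinuousAt g.symm 1 := g.continuousAt_symm h1'
  refine ⟨g.symm, hsm, ?_⟩
  have hadj : ContinuousAt (fun P => ContinuousLinearMap.adjoint (g.symm P)) 1 :=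
    ContinuousLinearMap.adjoint.continuous.continuousAt.comp hc
  have hadj1 : ContinuousLinearMap.adjoint (g.symm 1) = 1 := by
    rw [hg1']; exact star_one _
  have h2 := hadj.eventually_mem (hadj1 ▸ g.open_source.mem_nhds h1)
  filter_upwards [h2, g.open_target.mem_nhds h1'] with P hP hP'
  have hr : g.symm P * g.symm P = P := by
    rw [← hg, g.right_inv hP']
  refine ⟨hr, fun hsym => ?_⟩
  -- The adjoint is another square root of the symmetric `P` and still lies in the domain where
  -- squaring is injective.
  have h3 : ContinuousLinearMap.adjoint (g.symm P) = g.symm P := by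
    refine g.injOn hP (g.map_target hP') ?_
    rw [hg, hg]
    change star (g.symm P) * star (g.symm P) = g.symm P * g.symm P
    rw [← star_mul, hr]
    exact ((ContinuousLinearMap.eq_adjoint_iff P P).2 hsym).symm
  intro u v
  conv_rhs => rw [← h3]
  exact (ContinuousLinearMap.adjoint_inner_right _ _ _).symm

variable {E : Type*} [NormedAddCommGroup E] [NormedSpace ℝ E]

/-- A smooth field of inner products has smooth local isometric frames. -/
lemma exists_isometric_frame {G : E → V →L[ℝ] V →L[ℝ] ℝ} {s : Set E} (hs : IsOpen s)
    (hG : ContDiffOn ℝ ∞ G s) (hsym : ∀ x u v, G x u v = G x v u) {x₁ : E} (hx₁ : x₁ ∈ s)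
    {h₁ k₁ : V →L[ℝ] V} (hhk : h₁ * k₁ = 1) (hkh : k₁ * h₁ = 1)
    (hG₁ : ∀ u v, G x₁ u v = inner ℝ (h₁ u) (h₁ v)) :
    ∃ t ⊆ s, IsOpen t ∧ x₁ ∈ t ∧ ∃ h k : E → V →L[ℝ] V, ContDiffOn ℝ ∞ h t ∧ ContDiffOn ℝ ∞ k t ∧
      ∀ x ∈ t, h x * k x = 1 ∧ k x * h x = 1 ∧ ∀ u v, G x u v = inner ℝ (h x u) (h x v) := by
  have : CompleteSpace V := FiniteDimensional.complete ℝ V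
  obtain ⟨r, hr, hr'⟩ := exists_smooth_sqrt (V := V)
  let D : (V →L[ℝ] ℝ) →L[ℝ] V := LinearMap.toContinuousLinearMap
    { toFun := (InnerProductSpace.toDual ℝ V).symm
      map_add' := map_add _
      map_smul' := fun c f => by simp }
  have hD : ∀ f v, inner ℝ (D f) v = f v := fun f v =>
    InnerProductSpace.toDual_symm_apply (𝕜 := ℝ) (E := V)
  -- `P` is the operator of the metric relative to the frame `h₁` at `x₁`, so `P x₁ = 1` and nearby
  -- `√P ∘ h₁` is an isometric frame.
  let P : E → V →L[ℝ] V := fun x =>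
    (ContinuousLinearMap.adjoint k₁).comp ((D.comp (G x)).comp k₁)
  have hPi : ∀ x u v, inner ℝ (P x u) v = G x (k₁ u) (k₁ v) := fun x u v => by
    simp only [P, ContinuousLinearMap.comp_apply, ContinuousLinearMap.adjoint_inner_left, hD]
  have hP : ContDiffOn ℝ ∞ P s :=
    contDiffOn_const.clm_comp ((contDiffOn_const.clm_comp hG).clm_comp contDiffOn_const)
  have hk1 : ∀ u, h₁ (k₁ u) = u := fun u => congrArg (fun z => z u) hhk
  have hk2 : ∀ u, k₁ (h₁ u) = u := fun u => congrArg (fun z => z u) hkh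
  have hP1 : P x₁ = 1 := ContinuousLinearMap.ext fun u => ext_inner_right ℝ fun v => by
    rw [hPi, hG₁, hk1, hk1]; rfl
  have hPs : ∀ x u v, inner ℝ (P x u) v = inner ℝ u (P x v) := fun x u v => by
    rw [hPi, hsym, ← hPi, real_inner_comm]
  have hr1 : ∀ᶠ Q in 𝓝 (1 : V →L[ℝ] V), ContDiffAt ℝ ω r Q := hr.eventually (by simp)
  have hu : ∀ᶠ Q in 𝓝 (1 : V →L[ℝ] V), IsUnit Q := Units.nhds (1 : (V →L[ℝ] V)ˣ)
  obtain ⟨W, hW, hWo, hW1⟩ := eventually_nhds_iff.1 (hr1.and (hr'.and hu))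
  have hPc : ContinuousOn P s := hP.continuousOn
  refine ⟨s ∩ P ⁻¹' W, Set.inter_subset_left, hPc.isOpen_inter_preimage hs hWo,
    ⟨hx₁, by simpa [hP1] using hW1⟩, fun x => r (P x) * h₁,
    fun x => k₁ * Ring.inverse (r (P x)), ?_, ?_, ?_⟩
  all_goals
    have hrP : ContDiffOn ℝ ∞ (fun x => r (P x)) (s ∩ P ⁻¹' W) := fun x hx =>
      ((hW _ hx.2).1.of_le (by simp)).comp_contDiffWithinAt x
        ((hP x hx.1).mono Set.inter_subset_left)
    have hun : ∀ x ∈ s ∩ P ⁻¹' W, IsUnit (r (P x)) := fun x hx => by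
      have h := (hW _ hx.2).2.2
      rw [← (hW _ hx.2).2.1.1] at h
      exact (isUnit_pow_iff two_ne_zero).1 (by rwa [sq])
  · exact hrP.clm_comp contDiffOn_const
  · refine contDiffOn_const.clm_comp fun x hx => ?_
    obtain ⟨w, hw⟩ := hun x hx
    have h := contDiffAt_ringInverse ℝ (n := ∞) w
    rw [hw] at h
    exact h.comp_contDiffWithinAt x (hrP x hx)
  · intro x hx
    have h1 := Ring.mul_inverse_cancel _ (hun x hx)
    have h2 := Ring.inverse_mul_cancel _ (hun x hx)
    refine ⟨?_, ?_, fun u v => ?_⟩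
    · rw [mul_assoc, ← mul_assoc h₁, hhk, one_mul, h1]
    · rw [mul_assoc, ← mul_assoc _ _ h₁, h2, one_mul, hkh]
    · have h3 : r (P x) (r (P x) (h₁ u)) = P x (h₁ u) :=
        congrArg (fun z => z (h₁ u)) (hW _ hx.2).2.1.1
      have h4 := (hW _ hx.2).2.1.2 (hPs x) (r (P x) (h₁ u)) (h₁ v)
      rw [h3, hPi, hk2, hk2] at h4
      exact h4

end Frame

/-! ### Covariant differentiation in an isometric frame. -/

section FrameCalculus

variable {V : Type*} [NormedAddCommGroup V] [InnerProductSpace ℝ V] [FiniteDimensional ℝ V]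
  {E : Type*} [NormedAddCommGroup E] [NormedSpace ℝ E] {h k : E → V →L[ℝ] V} {x y : E}

lemma fderiv_frame (hkh : k x * h x = 1) (hhk : h x * k x = 1) :
    fderiv ℝ h x y = (h x * (k x * fderiv ℝ h x y) * k x).comp (h x) := by
  change fderiv ℝ h x y = h x * (k x * fderiv ℝ h x y) * k x * h x
  rw [mul_assoc, hkh, mul_one, ← mul_assoc, hhk, one_mul]

lemma fderiv_inverse_frame (hh : DifferentiableAt ℝ h x) (hk : DifferentiableAt ℝ k x)
    (hkh : ∀ᶠ z in 𝓝 x, k z * h z = 1) (hhk : h x * k x = 1) :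
    fderiv ℝ k x y = (-(k x * fderiv ℝ h x y)).comp (k x) := by
  have h1 := (hk.hasFDerivAt.mul' hh.hasFDerivAt).fderiv
  have h0 : k * h =ᶠ[𝓝 x] fun _ => (1 : V →L[ℝ] V) := hkh
  rw [h0.fderiv_eq] at h1
  have h2 := congrArg (fun L => L y) h1
  rw [fderiv_const_apply] at h2
  have h3 : k x * fderiv ℝ h x y + fderiv ℝ k x y * h x = 0 := h2.symm
  have h4 : fderiv ℝ k x y * h x = -(k x * fderiv ℝ h x y) := eq_neg_of_add_eq_zero_right h3
  change fderiv ℝ k x y = -(k x * fderiv ℝ h x y) * k x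
  rw [← h4, mul_assoc, hhk, mul_one]

/-- Differentiation of a field of inner products in an isometric frame. -/
lemma fderiv_frame_metric {G : E → V →L[ℝ] V →L[ℝ] ℝ} (hG : DifferentiableAt ℝ G x)
    (hh : DifferentiableAt ℝ h x) (hhk : h x * k x = 1)
    (hGh : ∀ᶠ z in 𝓝 x, ∀ u v, G z u v = inner ℝ (h z u) (h z v)) (u v : V) :
    fderiv ℝ G x y u v = G x ((k x * fderiv ℝ h x y) u) v + G x u ((k x * fderiv ℝ h x y) v) := by
  have h1 := (hG.hasFDerivAt.clm_apply (hasFDerivAt_const u x)).clm_apply (hasFDerivAt_const v x)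
  have h2 := (hh.hasFDerivAt.clm_apply (hasFDerivAt_const u x)).inner ℝ
    (hh.hasFDerivAt.clm_apply (hasFDerivAt_const v x))
  have h3 := congrArg (fun L => L y) (h1.fderiv.symm.trans
    ((EventuallyEq.fderiv_eq (hGh.mono fun z hz => hz u v)).trans h2.fderiv))
  have h4 : ∀ u, h x (k x u) = u := fun u => congrArg (fun z => z u) hhk
  have h5 := hGh.self_of_nhds
  simp only [mul_apply_eq_comp, h5, h4]
  simpa [add_comm] using h3

/-- The covariant derivative of a triple contraction computed in an isometric frame. -/
lemma fderiv_tripleContr_frame {N η : E → V [⋀^Fin 4]→L[ℝ] ℝ} (hN : DifferentiableAt ℝ N x)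
    (hη : DifferentiableAt ℝ η x) (hh : DifferentiableAt ℝ h x) (hk : DifferentiableAt ℝ k x)
    (hkh : ∀ᶠ z in 𝓝 x, k z * h z = 1) (hhk : h x * k x = 1) {Γ : V →L[ℝ] V}
    (hΓ : ∀ u v, inner ℝ (h x ((k x * fderiv ℝ h x y - Γ) u)) (h x v)
      = -(inner ℝ (h x u) (h x ((k x * fderiv ℝ h x y - Γ) v)) : ℝ)) :
    fderiv ℝ (fun z => (tripleContr ((N z).compContinuousLinearMap (k z))
        ((η z).compContinuousLinearMap (k z))).compContinuousLinearMap (h z)) x y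
      - endAct Γ ((tripleContr ((N x).compContinuousLinearMap (k x))
        ((η x).compContinuousLinearMap (k x))).compContinuousLinearMap (h x))
    = (tripleContr ((fderiv ℝ N x y - endAct Γ (N x)).compContinuousLinearMap (k x))
          ((η x).compContinuousLinearMap (k x))
        + tripleContr ((N x).compContinuousLinearMap (k x))
          ((fderiv ℝ η x y - endAct Γ (η x)).compContinuousLinearMap (k x))
      ).compContinuousLinearMap (h x) := by
  have hkx := hkh.self_of_nhds
  have dk := fderiv_inverse_frame (y := y) hh hk hkh hhk
  have dh := fderiv_frame (y := y) hkx hhk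
  generalize k x * fderiv ℝ h x y = ρ at *
  have hk1 : ∀ u, h x (k x u) = u := fun u => congrArg (fun z => z u) hhk
  have hk2 : ∀ u, k x (h x u) = u := fun u => congrArg (fun z => z u) hkx
  have dNk := hN.continuousAlternatingMapCompContinuousLinearMap hk
  have dηk := hη.continuousAlternatingMapCompContinuousLinearMap hk
  have hdN := fderiv_comp_left hN hk dk
  have hdη := fderiv_comp_left hη hk dk
  have dZ := differentiableAt_tripleContr dNk dηk
  rw [fderiv_comp_left dZ hh dh, fderiv_tripleContr dNk dηk, hdN, hdη,
    endAct_comp Γ (h x * Γ * k x) (h x) fun v => by simp [hk2]]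
  set Nk := (N x).compContinuousLinearMap (k x) with hNk
  set ηk := (η x).compContinuousLinearMap (k x) with hηk
  -- `S` is the skew connection form of the frame. It measures the gap between the derivative of the
  -- frame and `Γ`, and its contributions cancel by equivariance of the triple contraction.
  set S := h x * (ρ - Γ) * k x with hS
  have hS1 : h x * ρ * k x = S + h x * Γ * k x := by rw [hS]; noncomm_ring
  have hskew : ∀ u v, inner ℝ (S u) v = -(inner ℝ u (S v) : ℝ) := fun u v => by
    have := hΓ (k x u) (k x v)
    rwa [hk1, hk1] at this
  have hSc : ∀ ζ : V [⋀^Fin 4]→L[ℝ] ℝ, endAct S (ζ.compContinuousLinearMap (k x))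
      = (endAct (ρ - Γ) ζ).compContinuousLinearMap (k x) := fun ζ =>
    endAct_comp S (ρ - Γ) (k x) (fun v => by simp [hS, hk2]) ζ
  have hL : ∀ (A : V [⋀^Fin 4]→L[ℝ] ℝ) (ζ : V [⋀^Fin 4]→L[ℝ] ℝ),
      (A + endAct (-ρ) ζ).compContinuousLinearMap (k x)
        = (A - endAct Γ ζ).compContinuousLinearMap (k x)
          - endAct S (ζ.compContinuousLinearMap (k x)) := fun A ζ => by
    rw [hSc, endAct_neg, endAct_sub]
    ext v
    simp only [ContinuousAlternatingMap.compContinuousLinearMap_apply,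
      ContinuousAlternatingMap.add_apply, ContinuousAlternatingMap.sub_apply,
      ContinuousAlternatingMap.neg_apply]
    ring
  rw [hL, hL, hS1, endAct_add, endAct_tripleContr hskew, ← hNk, ← hηk]
  simp only [← tripleContrL_apply, map_sub, LinearMap.sub_apply]
  ext v
  simp only [ContinuousAlternatingMap.compContinuousLinearMap_apply,
    ContinuousAlternatingMap.add_apply, ContinuousAlternatingMap.sub_apply]
  ring

/-- Two frames for the same metric differ by an isometry. -/
lemma exists_isometry_of_frame {W : Type*} [NormedAddCommGroup W] [InnerProductSpace ℝ W]
    {c : V →L[ℝ] W} (hc : Function.Bijective c) {h k : V →L[ℝ] V} (hhk : h * k = 1)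
    (hkh : k * h = 1) (hi : ∀ u v, inner ℝ (c u) (c v) = (inner ℝ (h u) (h v) : ℝ)) :
    ∃ j : W ≃ₗᵢ[ℝ] V, ∀ u, j (c u) = h u := by
  have h1 : ∀ u, h (k u) = u := fun u => congrArg (fun z => z u) hhk
  have h2 : ∀ u, k (h u) = u := fun u => congrArg (fun z => z u) hkh
  let eh : V ≃ₗ[ℝ] V := LinearEquiv.ofBijective (h : V →ₗ[ℝ] V)
    ⟨Function.LeftInverse.injective h2, Function.RightInverse.surjective h1⟩
  let ec : V ≃ₗ[ℝ] W := LinearEquiv.ofBijective (c : V →ₗ[ℝ] W) hc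
  have hec : ∀ u, (ec.symm.trans eh) (c u) = h u := fun u =>
    congrArg eh (ec.symm_apply_apply u)
  refine ⟨(ec.symm.trans eh).isometryOfInner fun w w' => ?_, hec⟩
  obtain ⟨u, rfl⟩ := hc.2 w
  obtain ⟨v, rfl⟩ := hc.2 w'
  rw [hec, hec, hi]

/-- The derivative of a field of forms lying in one orbit of the isometry group, in an isometric
frame. -/
lemma exists_skew_frame {n : ℕ} {η : E → V [⋀^Fin (n + 1)]→L[ℝ] ℝ} {ψ : V [⋀^Fin (n + 1)]→L[ℝ] ℝ}
    (hη : DifferentiableAt ℝ η x) (hh : DifferentiableAt ℝ h x) (hk : DifferentiableAt ℝ k x)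
    (hkh : ∀ᶠ z in 𝓝 x, k z * h z = 1) (hhk : h x * k x = 1)
    (horb : ∀ᶠ z in 𝓝 x, ∃ m : V ≃ₗᵢ[ℝ] V, (η z).compContinuousLinearMap (k z)
      = ψ.compContinuousLinearMap (m : V →L[ℝ] V)) {Γ : V →L[ℝ] V}
    (hΓ : ∀ u v, inner ℝ (h x ((k x * fderiv ℝ h x y - Γ) u)) (h x v)
      = -(inner ℝ (h x u) (h x ((k x * fderiv ℝ h x y - Γ) v)) : ℝ)) :
    ∃ A : V →L[ℝ] V, fderiv ℝ η x y - endAct Γ (η x) = endAct A (η x) ∧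
      ∀ u v, inner ℝ (h x (A u)) (h x v) = -(inner ℝ (h x u) (h x (A v)) : ℝ) := by
  have hkx := hkh.self_of_nhds
  have dk := fderiv_inverse_frame (y := y) hh hk hkh hhk
  generalize k x * fderiv ℝ h x y = ρ at *
  have hk1 : ∀ u, h x (k x u) = u := fun u => congrArg (fun z => z u) hhk
  have hk2 : ∀ u, k x (h x u) = u := fun u => congrArg (fun z => z u) hkx
  have dηk := hη.continuousAlternatingMapCompContinuousLinearMap hk
  have hdη := fderiv_comp_left hη hk dk
  obtain ⟨m₀, hm₀⟩ := horb.self_of_nhds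
  have hline : HasDerivAt (fun t : ℝ => x + t • y) y 0 := by
    simpa using ((hasDerivAt_id (0 : ℝ)).smul_const y).const_add x
  have h0 : x + (0 : ℝ) • y = x := by simp
  have hder := HasFDerivAt.comp_hasDerivAt_of_eq (0 : ℝ) dηk.hasFDerivAt hline h0.symm
  rw [hdη] at hder
  obtain ⟨a, ha, hae⟩ := exists_skew_of_orbit (w := (η x).compContinuousLinearMap (k x)) hder
    (by simp) (by
      have hc : Tendsto (fun t : ℝ => x + t • y) (𝓝 0) (𝓝 x) := by
        simpa [h0] using hline.continuousAt.tendsto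
      filter_upwards [hc.eventually horb] with t ⟨m, hm⟩
      -- The orbit is rebased from `ψ` to the form at `x` by composing with the inverse of the
      -- isometry at `x`.
      refine ⟨((m.trans m₀.symm : V ≃ₗᵢ[ℝ] V) : V →L[ℝ] V), fun u v => ?_, ?_⟩
      · exact (m.trans m₀.symm).inner_map_map u v
      · rw [hm₀]
        refine Eq.trans ?_ hm.symm
        ext v
        simp only [ContinuousAlternatingMap.compContinuousLinearMap_apply]
        congr 1
        funext i
        simp)
  -- The skew generator `a` found in the frame is carried back and corrected by the connection form,
  -- which is skew for the metric as well.
  refine ⟨ρ - Γ + k x * a * h x, ?_, fun u v => ?_⟩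
  · have h1 := endAct_comp a (k x * a * h x) (k x) (fun v => by simp [hk1]) (η x)
    rw [h1] at hae
    have h2 : fderiv ℝ η x y + endAct (-ρ) (η x) = endAct (k x * a * h x) (η x) := by
      ext v
      have h3 := congrArg (fun z => z fun i => h x (v i)) hae
      simpa only [ContinuousAlternatingMap.compContinuousLinearMap_apply, Function.comp_def, hk2]
        using h3
    rw [endAct_neg] at h2
    rw [endAct_add, endAct_sub, ← h2]
    abel
  · simp only [add_apply, map_add, inner_add_left, inner_add_right, hΓ u v,
      mul_apply_eq_comp, hk1]
    rw [ha]
    ring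

end FrameCalculus

section FrameForms

variable {V : Type*} [NormedAddCommGroup V] [InnerProductSpace ℝ V] [FiniteDimensional ℝ V]
  {W : Type*} [NormedAddCommGroup W] [InnerProductSpace ℝ W] [FiniteDimensional ℝ W]

/-- The triple contraction of the variable space `W` becomes the one of the fixed space `V`, so that
it can be differentiated as a constant bilinear map. -/
lemma tripleContr_frame {c : V →L[ℝ] W} (hc : Function.Bijective c) {h k : V →L[ℝ] V}
    (hhk : h * k = 1) (hkh : k * h = 1)
    (hi : ∀ u v, inner ℝ (c u) (c v) = (inner ℝ (h u) (h v) : ℝ)) (ξ κ : W [⋀^Fin 4]→L[ℝ] ℝ) :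
    (tripleContr ((ξ.compContinuousLinearMap c).compContinuousLinearMap k)
      ((κ.compContinuousLinearMap c).compContinuousLinearMap k)).compContinuousLinearMap h
      = (tripleContr ξ κ).compContinuousLinearMap c := by
  obtain ⟨j, hj⟩ := exists_isometry_of_frame hc hhk hkh hi
  have h1 : ∀ u, h (k u) = u := fun u => congrArg (fun z => z u) hhk
  have h2 : ∀ u, c (k u) = j.symm u := fun u => by
    rw [LinearIsometryEquiv.eq_symm_apply, hj, h1]
  have h3 : ∀ ξ : W [⋀^Fin 4]→L[ℝ] ℝ, (ξ.compContinuousLinearMap c).compContinuousLinearMap k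
      = ξ.compContinuousLinearMap (j.symm : V →L[ℝ] W) := fun ξ => by
    ext v
    simp only [ContinuousAlternatingMap.compContinuousLinearMap_apply]
    exact congrArg ξ (funext fun i => h2 _)
  rw [h3, h3, tripleContr_comp]
  ext v
  simp only [ContinuousAlternatingMap.compContinuousLinearMap_apply]
  refine congrArg _ (funext fun i => ?_)
  change j.symm (h (v i)) = c (v i)
  rw [← hj, j.symm_apply_apply]

end FrameForms

/-! ### Isometric frames over the manifold. -/

section Chart

variable {M : Type*} [TopologicalSpace M] [ChartedSpace E8 M] [IsManifold 𝓘(ℝ, E8) ∞ M]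
variable [RiemannianBundle (fun p : M => TS p)]
  [IsContMDiffRiemannianBundle 𝓘(ℝ, E8) ∞ E8 (fun p : M => TS p)]

/-- A smooth isometric frame over an open set of the chart at `p`. -/
structure IsFrame (p : M) (t : Set E8) (h k : E8 → E8 →L[ℝ] E8) : Prop where
  subset : t ⊆ (chart p).target
  isOpen : IsOpen t
  smooth : ContDiffOn ℝ ∞ h t
  smooth_inv : ContDiffOn ℝ ∞ k t
  mul_inv : ∀ x ∈ t, h x * k x = 1
  inv_mul : ∀ x ∈ t, k x * h x = 1
  metric_eq : ∀ x ∈ t, ∀ u v, metric p x u v = inner ℝ (h x u) (h x v)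

lemma coordVec_bijective (p : M) {x : E8} (hx : x ∈ (chart p).target) :
    Function.Bijective (coordVec p x) :=
  (coordVec_isInvertible p hx).bijective

lemma exists_isFrame (hM : ∀ q : M, Nonempty (TS q ≃ₗᵢ[ℝ] E8)) (p : M) {x : E8}
    (hx : x ∈ (chart p).target) : ∃ t h k, IsFrame p t h k ∧ x ∈ t := by
  obtain ⟨j⟩ := hM ((chart p).symm x)
  let h₁ : E8 →L[ℝ] E8 := (j : TS ((chart p).symm x) →L[ℝ] E8).comp (coordVec p x)
  have hb : Function.Bijective h₁ := j.bijective.comp (coordVec_bijective p hx)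
  obtain ⟨w, hw⟩ := ContinuousLinearMap.isUnit_iff_bijective.2 hb
  have h1 : h₁ * ((w⁻¹ : (E8 →L[ℝ] E8)ˣ) : E8 →L[ℝ] E8) = 1 := by rw [← hw, Units.mul_inv]
  have h2 : ((w⁻¹ : (E8 →L[ℝ] E8)ˣ) : E8 →L[ℝ] E8) * h₁ = 1 := by rw [← hw, Units.inv_mul]
  obtain ⟨t, ht, hto, hxt, h, k, hh, hk, hhk⟩ := exists_isometric_frame (isOpen_chart_target p)
    (contDiffOn_metric p) (metric_symm p) hx h1 h2 (fun u v =>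
      (metric_apply p x u v).trans (j.inner_map_map _ _).symm)
  exact ⟨t, h, k, ⟨ht, hto, hh, hk, fun x hx => (hhk x hx).1, fun x hx => (hhk x hx).2.1,
    fun x hx => (hhk x hx).2.2⟩, hxt⟩

variable {p : M} {t : Set E8} {h k : E8 → E8 →L[ℝ] E8} {x : E8}

lemma IsFrame.differentiableAt (F : IsFrame p t h k) (hx : x ∈ t) : DifferentiableAt ℝ h x :=
  (F.smooth.contDiffAt (F.isOpen.mem_nhds hx)).differentiableAt (by simp)

lemma IsFrame.differentiableAt_inv (F : IsFrame p t h k) (hx : x ∈ t) : DifferentiableAt ℝ k x :=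
  (F.smooth_inv.contDiffAt (F.isOpen.mem_nhds hx)).differentiableAt (by simp)

lemma IsFrame.eventually_inv_mul (F : IsFrame p t h k) (hx : x ∈ t) :
    ∀ᶠ z in 𝓝 x, k z * h z = 1 := by
  filter_upwards [F.isOpen.mem_nhds hx] with z hz using F.inv_mul z hz

/-- The connection form in an isometric frame is skew. -/
lemma IsFrame.skew (F : IsFrame p t h k) (hx : x ∈ t) (y u v : E8) :
    inner ℝ (h x ((k x * fderiv ℝ h x y - conn p x y) u)) (h x v)
      = -(inner ℝ (h x u) (h x ((k x * fderiv ℝ h x y - conn p x y) v)) : ℝ) := by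
  have h1 := fderiv_frame_metric (y := y) ((contDiffAt_metric p (F.subset hx)).differentiableAt
    (by simp)) (F.differentiableAt hx) (F.mul_inv x hx)
    (by filter_upwards [F.isOpen.mem_nhds hx] with z hz using F.metric_eq z hz) u v
  rw [fderiv_metric p (F.subset hx)] at h1
  rw [← F.metric_eq x hx, ← F.metric_eq x hx]
  simp only [sub_apply, map_sub]
  linarith

lemma metric_self (p : M) (u v : TS p) : metric p (chart p p) u v = inner ℝ u v := by
  let ip : M → E8 → E8 → ℝ := fun q => fun (u v : TS q) => inner ℝ u v
  have h1 : metric p (chart p p) u v = ip ((chart p).symm (chart p p))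
    ((coordVec p (chart p p) : E8 →L[ℝ] E8) u) ((coordVec p (chart p p) : E8 →L[ℝ] E8) v) := rfl
  rw [h1, coordVec_self, extChartAt_to_inv]
  rfl

lemma inChart_self {n : ℕ} (η : ∀ q : M, TS q [⋀^Fin n]→L[ℝ] ℝ) (p : M) :
    inChart η p (chart p p) = η p := by
  let η' : M → E8 [⋀^Fin n]→L[ℝ] ℝ := η
  change (η' _).compContinuousLinearMap (coordVec p (chart p p) : E8 →L[ℝ] E8) = η' p
  rw [coordVec_self, extChartAt_to_inv]
  rfl

lemma differentiableAt_inChart {n : ℕ} {η : ∀ q : M, TS q [⋀^Fin n]→L[ℝ] ℝ} (hη : IsSmoothForm η)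
    (hx : x ∈ (chart p).target) : DifferentiableAt ℝ (inChart η p) x :=
  ((hη p).contDiffAt ((isOpen_chart_target p).mem_nhds hx)).differentiableAt (by simp)

lemma IsFrame.exists_isometry (F : IsFrame p t h k) (hx : x ∈ t) :
    ∃ j : TS ((chart p).symm x) ≃ₗᵢ[ℝ] E8, ∀ u, j (coordVec p x u) = h x u :=
  exists_isometry_of_frame (coordVec_bijective p (F.subset hx)) (F.mul_inv x hx) (F.inv_mul x hx)
    (F.metric_eq x hx)

/-- The derivation action does not depend on the inner product. -/
lemma endAct_tangent {n : ℕ} (A : E8 →L[ℝ] E8) (η : E8 [⋀^Fin (n + 1)]→L[ℝ] ℝ) (p : M) :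
    (endAct A η : E8 [⋀^Fin (n + 1)]→L[ℝ] ℝ)
      = endAct (V := TS p) (A : TS p →L[ℝ] TS p) (η : TS p [⋀^Fin (n + 1)]→L[ℝ] ℝ) := by
  refine ContinuousAlternatingMap.ext fun v => ?_
  rw [endAct_apply]
  exact (endAct_apply (V := TS p) A η v).symm

end Chart

section Scaling

variable {V : Type*} [NormedAddCommGroup V] [InnerProductSpace ℝ V] [FiniteDimensional ℝ V]
  {E : Type*} [NormedAddCommGroup E] [NormedSpace ℝ E]

lemma fderiv_sub_endAct_smul {n : ℕ} {f Z : E → V [⋀^Fin (n + 1)]→L[ℝ] ℝ} {x : E} (c : ℝ)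
    (hf : f =ᶠ[𝓝 x] fun z => c • Z z) (hZ : DifferentiableAt ℝ Z x) (y : E) (A : V →L[ℝ] V) :
    fderiv ℝ f x y - endAct A (f x) = c • (fderiv ℝ Z x y - endAct A (Z x)) := by
  rw [hf.fderiv_eq, hf.self_of_nhds, fderiv_fun_const_smul hZ, endAct_form_smul, smul_sub]
  rfl

end Scaling

/-! ### Existence, uniqueness, smoothness and covariant derivative of the torsion. -/

section Torsion

variable {M : Type*} [TopologicalSpace M] [ChartedSpace E8 M] [IsManifold 𝓘(ℝ, E8) ∞ M]
variable [RiemannianBundle (fun p : M => TS p)]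
  [IsContMDiffRiemannianBundle 𝓘(ℝ, E8) ∞ E8 (fun p : M => TS p)]
variable {Ω : ∀ q : M, TS q [⋀^Fin 4]→L[ℝ] ℝ}

lemma IsSp2Sp1Structure.nonempty_isometry (hΩ : IsSp2Sp1Structure Ω) (q : M) :
    Nonempty (TS q ≃ₗᵢ[ℝ] E8) :=
  let ⟨u, _⟩ := hΩ.model q
  ⟨u⟩

lemma IsFrame.exists_orbit {p : M} {t : Set E8} {h k : E8 → E8 →L[ℝ] E8} {x : E8}
    (F : IsFrame p t h k) (hx : x ∈ t) (hΩ : IsSp2Sp1Structure Ω) :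
    ∃ m : E8 ≃ₗᵢ[ℝ] E8, (inChart Ω p x).compContinuousLinearMap (k x)
      = modelForm.compContinuousLinearMap (m : E8 →L[ℝ] E8) := by
  obtain ⟨j, hj⟩ := F.exists_isometry hx
  obtain ⟨u, hu⟩ := hΩ.model ((chart p).symm x)
  refine ⟨j.symm.trans u, ?_⟩
  have h1 : ∀ v, h x (k x v) = v := fun v => congrArg (fun z => z v) (F.mul_inv x hx)
  have h2 : ∀ v, coordVec p x (k x v) = j.symm v := fun v => by
    rw [LinearIsometryEquiv.eq_symm_apply, hj, h1]
  rw [inChart, hu]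
  ext v
  simp only [ContinuousAlternatingMap.compContinuousLinearMap_apply]
  exact congrArg modelForm (funext fun i => congrArg u (h2 (v i)))

/-- The covariant derivative of the structure form is tangent to the orbit of the orthogonal
group. -/
lemma exists_nablaForm_eq_endAct (hΩ : IsSp2Sp1Structure Ω) (p : M) (X : TS p) :
    ∃ A : TS p →L[ℝ] TS p, (∀ u v, inner ℝ (A u) v = -(inner ℝ u (A v) : ℝ)) ∧
      nablaForm Ω p X = endAct A (Ω p) := by
  have hx := mem_chart_target p
  obtain ⟨t, h, k, F, hxt⟩ := exists_isFrame hΩ.nonempty_isometry p hx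
  obtain ⟨A, hA, hAs⟩ := exists_skew_frame (ψ := modelForm) (y := X)
    (differentiableAt_inChart hΩ.smooth hx) (F.differentiableAt hxt) (F.differentiableAt_inv hxt)
    (F.eventually_inv_mul hxt) (F.mul_inv _ hxt)
    (by filter_upwards [F.isOpen.mem_nhds hxt] with z hz using F.exists_orbit hz hΩ)
    (F.skew hxt X)
  refine ⟨A, fun u v => ?_, ?_⟩
  · have h1 : ∀ u v : E8, metric p (chart p p) (A u) v = -metric p (chart p p) u (A v) :=
      fun u v => by rw [F.metric_eq _ hxt, F.metric_eq _ hxt, hAs]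
    rw [← metric_self, ← metric_self]
    exact h1 u v
  · refine hA.trans ?_
    rw [inChart_self]
    exact endAct_tangent A (Ω p) p

lemma exists_nablaForm_eq_diamond (hΩ : IsSp2Sp1Structure Ω) (p : M) (X : TS p) :
    ∃ κ : TS p [⋀^Fin 2]→L[ℝ] ℝ, nablaForm Ω p X = diamond κ (Ω p) := by
  obtain ⟨A, hA, h⟩ := exists_nablaForm_eq_endAct hΩ p X
  refine ⟨formOfEnd (-A), ?_⟩
  rw [diamond_eq, endOf_formOfEnd (fun u v => by simp [hA u v]), endAct_neg, neg_neg, h]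

lemma nablaForm_add {n : ℕ} (η : ∀ q : M, TS q [⋀^Fin (n + 1)]→L[ℝ] ℝ) (p : M) (X Y : TS p) :
    nablaForm η p (X + Y) = nablaForm η p X + nablaForm η p Y := by
  have h : ∀ x y : E8, nablaAt η p (chart p p) (x + y)
      = nablaAt η p (chart p p) x + nablaAt η p (chart p p) y := fun x y => by
    simp only [nablaAt, conn_eq, connOf_add, endAct_add, map_add]
    abel
  exact h X Y

lemma nablaForm_smul {n : ℕ} (η : ∀ q : M, TS q [⋀^Fin (n + 1)]→L[ℝ] ℝ) (p : M) (c : ℝ)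
    (X : TS p) : nablaForm η p (c • X) = c • nablaForm η p X := by
  have h : ∀ x : E8, nablaAt η p (chart p p) (c • x) = c • nablaAt η p (chart p p) x := fun x => by
    simp only [nablaAt, conn_eq, connOf_smul, endAct_smul, map_smul, smul_sub]
  exact h X

/-- The intrinsic torsion `T(X) = (1/32) (∇_X Ω) ⌟₃ Ω`. -/
def torsion (Ω : ∀ q : M, TS q [⋀^Fin 4]→L[ℝ] ℝ) (p : M) :
    TS p →ₗ[ℝ] TS p [⋀^Fin 2]→L[ℝ] ℝ where
  toFun X := (1 / 32 : ℝ) • tripleContr (nablaForm Ω p X) (Ω p)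
  map_add' X Y := by
    rw [nablaForm_add, ← tripleContrL_apply, map_add, LinearMap.add_apply, smul_add]
    rfl
  map_smul' c X := by
    rw [nablaForm_smul, ← tripleContrL_apply, map_smul, LinearMap.smul_apply, smul_comm]
    rfl

lemma torsion_apply (p : M) (X : TS p) :
    torsion Ω p X = (1 / 32 : ℝ) • tripleContr (nablaForm Ω p X) (Ω p) := rfl

lemma torsion_isIntrinsicTorsion (hΩ : IsSp2Sp1Structure Ω) : IsIntrinsicTorsion Ω (torsion Ω) := by
  intro p X
  obtain ⟨b, hb⟩ := exists_isAdapted (hΩ.model p)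
  obtain ⟨κ, hκ⟩ := exists_nablaForm_eq_diamond hΩ p X
  have h : torsion Ω p X = proj15 b κ := by
    rw [torsion_apply, hκ, tripleContr_diamond hb, smul_smul]
    norm_num
  rw [h, hb.mem_lambda15, proj15_proj15, diamond_proj15 hb]
  exact ⟨rfl, hκ⟩

/-- Contracting `∇_X Ω = T(X) ◇ Ω` with `Ω` returns `32 T(X)`. -/
lemma IsIntrinsicTorsion.eq_torsion (hΩ : IsSp2Sp1Structure Ω)
    {T : ∀ q : M, TS q →ₗ[ℝ] TS q [⋀^Fin 2]→L[ℝ] ℝ} (hT : IsIntrinsicTorsion Ω T) :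
    T = torsion Ω := by
  funext p
  refine LinearMap.ext fun X => ?_
  obtain ⟨b, hb⟩ := exists_isAdapted (hΩ.model p)
  obtain ⟨h1, h2⟩ := hT p X
  rw [hb.mem_lambda15] at h1
  rw [torsion_apply, h2, tripleContr_diamond hb, h1, smul_smul]
  norm_num

lemma IsFrame.inChartOneTwo_torsion (hΩ : IsSp2Sp1Structure Ω) {p : M} {t : Set E8}
    {h k : E8 → E8 →L[ℝ] E8} (F : IsFrame p t h k) {x : E8} (hx : x ∈ t) (y : E8) :
    inChartOneTwo (torsion Ω) p y x = (1 / 32 : ℝ) •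
      (tripleContr ((nablaAt Ω p x y).compContinuousLinearMap (k x))
        ((inChart Ω p x).compContinuousLinearMap (k x))).compContinuousLinearMap (h x) := by
  have hx' := F.subset hx
  rw [← nablaForm_coordVec hΩ.smooth p hx' y, inChart, tripleContr_frame
    (coordVec_bijective p hx') (F.mul_inv x hx) (F.inv_mul x hx) (F.metric_eq x hx)]
  rfl

lemma contDiffOn_nablaAt {n : ℕ} {η : ∀ q : M, TS q [⋀^Fin (n + 1)]→L[ℝ] ℝ}
    (hη : IsSmoothForm η) (p : M) (y : E8) :
    ContDiffOn ℝ ∞ (fun x => nablaAt η p x y) (chart p).target := by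
  have h1 : ContDiffOn ℝ ∞ (fun x => fderiv ℝ (inChart η p) x y) (chart p).target :=
    ((hη p).fderiv_of_isOpen (isOpen_chart_target p) (by simp)).clm_apply contDiffOn_const
  exact h1.sub (contDiffOn_endAct (contDiffOn_conn p y) (hη p))

lemma torsion_isSmoothOneTwo (hΩ : IsSp2Sp1Structure Ω) : IsSmoothOneTwo (torsion Ω) := by
  intro p y x hx
  obtain ⟨t, h, k, F, hxt⟩ := exists_isFrame hΩ.nonempty_isometry p hx
  have h1 : ContDiffOn ℝ ∞ (fun x => (nablaAt Ω p x y).compContinuousLinearMap (k x)) t :=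
    contDiffOn_comp ((contDiffOn_nablaAt hΩ.smooth p y).mono F.subset) F.smooth_inv
  have h2 : ContDiffOn ℝ ∞ (fun x => (inChart Ω p x).compContinuousLinearMap (k x)) t :=
    contDiffOn_comp ((hΩ.smooth p).mono F.subset) F.smooth_inv
  have h3 := contDiffOn_comp (contDiffOn_tripleContr h1 h2) F.smooth
  have h4 : ContDiffOn ℝ ∞ (inChartOneTwo (torsion Ω) p y) t :=
    (h3.const_smul (1 / 32 : ℝ)).congr fun z hz => F.inChartOneTwo_torsion hΩ hz y
  exact (h4.contDiffAt (F.isOpen.mem_nhds hxt)).contDiffWithinAt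

/-- The covariant derivative of the torsion. -/
lemma nablaOneTwo_torsion (hΩ : IsSp2Sp1Structure Ω) (p : M) (X Y : TS p) :
    nablaOneTwo (torsion Ω) p X Y = (1 / 32 : ℝ) •
      (tripleContr (V := TS p) (fderiv ℝ (fun x => nablaAt Ω p x Y) (chart p p) X
          - endAct (conn p (chart p p) X) (nablaAt Ω p (chart p p) Y)) (Ω p)
        + tripleContr (nablaForm Ω p Y) (nablaForm Ω p X))
      - torsion Ω p (conn p (chart p p) X Y) := by
  have hx := mem_chart_target p
  obtain ⟨t, h, k, F, hxt⟩ := exists_isFrame hΩ.nonempty_isometry p hx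
  set x := chart p p with hx0
  have hev : inChartOneTwo (torsion Ω) p Y =ᶠ[𝓝 x] fun z => (1 / 32 : ℝ) •
      (tripleContr ((nablaAt Ω p z Y).compContinuousLinearMap (k z))
        ((inChart Ω p z).compContinuousLinearMap (k z))).compContinuousLinearMap (h z) := by
    filter_upwards [F.isOpen.mem_nhds hxt] with z hz using F.inChartOneTwo_torsion hΩ hz Y
  have dN : DifferentiableAt ℝ (fun x => nablaAt Ω p x Y) x :=
    ((contDiffOn_nablaAt hΩ.smooth p Y).contDiffAt
      ((isOpen_chart_target p).mem_nhds hx)).differentiableAt (by simp)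
  have key := fderiv_tripleContr_frame (y := X) dN (differentiableAt_inChart hΩ.smooth hx)
    (F.differentiableAt hxt) (F.differentiableAt_inv hxt) (F.eventually_inv_mul hxt)
    (F.mul_inv _ hxt) (F.skew hxt X)
  -- At the centre of the chart the frame turns the Euclidean contraction into that of the metric on
  -- the tangent space at `p`.
  have hs : ∀ ξ κ : E8 [⋀^Fin 4]→L[ℝ] ℝ, (tripleContr (ξ.compContinuousLinearMap (k x))
      (κ.compContinuousLinearMap (k x))).compContinuousLinearMap (h x)
      = tripleContr (V := TS p) ξ κ := fun ξ κ =>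
    tripleContr_frame (V := E8) (W := TS p) (c := (ContinuousLinearMap.id ℝ E8 : E8 →L[ℝ] E8))
      Function.bijective_id (F.mul_inv _ hxt) (F.inv_mul _ hxt) (fun u v => by
        rw [← F.metric_eq _ hxt]
        exact (metric_self p u v).symm) ξ κ
  have h1 : covDerivChart p (inChartOneTwo (torsion Ω) p Y) X
      = (1 / 32 : ℝ) • (tripleContr (V := TS p) (fderiv ℝ (fun x => nablaAt Ω p x Y) x X
          - endAct (conn p x X) (nablaAt Ω p x Y)) (Ω p)
        + tripleContr (V := TS p) (nablaForm Ω p Y) (nablaForm Ω p X)) := by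
    have dZ := (differentiableAt_tripleContr
      (dN.continuousAlternatingMapCompContinuousLinearMap (F.differentiableAt_inv hxt))
      ((differentiableAt_inChart hΩ.smooth hx).continuousAlternatingMapCompContinuousLinearMap
        (F.differentiableAt_inv hxt))).continuousAlternatingMapCompContinuousLinearMap
      (F.differentiableAt hxt)
    refine (fderiv_sub_endAct_smul (1 / 32) hev dZ X _).trans (congrArg _ (key.trans ?_))
    exact congrArg₂ (· + ·) ((hs _ _).trans (congrArg (tripleContr (V := TS p) _)
      (inChart_self Ω p))) (hs _ _)
  unfold nablaOneTwo
  rw [h1]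

/-- The Ricci identity. -/
lemma ricci_identity {η : ∀ q : M, TS q [⋀^Fin 4]→L[ℝ] ℝ}
    (hη : IsSmoothForm η) (p : M) (X Y : TS p) :
    (fderiv ℝ (fun x => nablaAt η p x Y) (chart p p) X
        - endAct (conn p (chart p p) X) (nablaAt η p (chart p p) Y))
      - (fderiv ℝ (fun x => nablaAt η p x X) (chart p p) Y
        - endAct (conn p (chart p p) Y) (nablaAt η p (chart p p) X))
      = -endAct (V := TS p) (curvature p X Y) (η p) := by
  have hx := mem_chart_target p
  have hd : ContDiffAt ℝ ∞ (inChart η p) (chart p p) :=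
    (hη p).contDiffAt ((isOpen_chart_target p).mem_nhds hx)
  have hd2 := ((hd.fderiv_right (m := ∞) (by simp)).differentiableAt (by simp))
  have hsym := (hd.isSymmSndFDerivAt (by simp; exact ENat.LEInfty.out)).eq
  have hc : ∀ y, DifferentiableAt ℝ (fun x => conn p x y) (chart p p) := fun y =>
    ((contDiffOn_conn p y).contDiffAt ((isOpen_chart_target p).mem_nhds hx)).differentiableAt
      (by simp)
  -- In the difference the second derivatives cancel by symmetry and the mixed first-order terms
  -- cancel in pairs. What remains are the derivatives of `Γ` and the commutator of the actions of
  -- `Γ`, that is the curvature.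
  have hn : ∀ x y : E8, fderiv ℝ (fun z => nablaAt η p z y) (chart p p) x
      = fderiv ℝ (fderiv ℝ (inChart η p)) (chart p p) x y
        - (endAct (conn p (chart p p) y) (fderiv ℝ (inChart η p) (chart p p) x)
          + endAct (fderiv ℝ (fun z => conn p z y) (chart p p) x) (inChart η p (chart p p))) :=
    fun x y => by
    have h1 : HasFDerivAt (fun z => fderiv ℝ (inChart η p) z y) _ (chart p p) :=
      hd2.hasFDerivAt.clm_apply (hasFDerivAt_const y _)
    have h2 := differentiableAt_endAct (hc y) (hd.differentiableAt (by simp))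
    have h3 := h1.fun_sub h2.hasFDerivAt
    refine (congrArg (fun L => L x) h3.fderiv).trans ?_
    rw [sub_apply, fderiv_endAct (hc y) (hd.differentiableAt (by simp))]
    congr 1
    simp
  have key : ∀ x y : E8, (fderiv ℝ (fun z => nablaAt η p z y) (chart p p) x
        - endAct (conn p (chart p p) x) (nablaAt η p (chart p p) y))
      - (fderiv ℝ (fun z => nablaAt η p z x) (chart p p) y
        - endAct (conn p (chart p p) y) (nablaAt η p (chart p p) x))
      = -endAct (fderiv ℝ (fun z => conn p z y) (chart p p) x
          - fderiv ℝ (fun z => conn p z x) (chart p p) y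
          + (conn p (chart p p) x).comp (conn p (chart p p) y)
          - (conn p (chart p p) y).comp (conn p (chart p p) x)) (inChart η p (chart p p)) :=
    fun x y => by
    have h := endAct_comm_four (conn p (chart p p) x) (conn p (chart p p) y)
      (inChart η p (chart p p))
    rw [endAct_sub] at h
    rw [hn, hn, hsym x y, nablaAt, nablaAt, endAct_form_sub, endAct_form_sub, endAct_sub,
      endAct_add, endAct_sub]
    rw [← sub_eq_zero] at h ⊢
    refine Eq.trans ?_ h
    abel
  refine (key X Y).trans ?_
  rw [inChart_self]
  exact congrArg (fun z : E8 [⋀^Fin 4]→L[ℝ] ℝ => -z) (endAct_tangent _ (η p) p)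

end Torsion

/-! ### The curvature terms and the two final identities. -/

section Curvature

variable {M : Type*} [TopologicalSpace M] [ChartedSpace E8 M] [IsManifold 𝓘(ℝ, E8) ∞ M]
variable [RiemannianBundle (fun p : M => TS p)]
  [IsContMDiffRiemannianBundle 𝓘(ℝ, E8) ∞ E8 (fun p : M => TS p)]
variable {Ω : ∀ q : M, TS q [⋀^Fin 4]→L[ℝ] ℝ}

/-- Metric compatibility is differentiated once more; symmetry of the second derivatives of the
metric gives the claim. Skewness is needed because `formOfEnd` keeps only the skew part of an
endomorphism. -/
lemma curvature_skew (p : M) (X Y u v : TS p) :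
    inner ℝ (curvature p X Y u) v = -(inner ℝ u (curvature p X Y v) : ℝ) := by
  have hx := mem_chart_target p
  have hd := contDiffAt_metric p hx
  have hG := (hd.differentiableAt (by simp)).hasFDerivAt
  have hd2 := ((hd.fderiv_right (m := ∞) (by simp)).differentiableAt (by simp)).hasFDerivAt
  have hsym := (hd.isSymmSndFDerivAt (by simp; exact ENat.LEInfty.out)).eq
  have hc : ∀ y, HasFDerivAt (fun x => conn p x y) _ (chart p p) := fun y =>
    (((contDiffOn_conn p y).contDiffAt ((isOpen_chart_target p).mem_nhds hx)).differentiableAt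
      (by simp)).hasFDerivAt
  have hf := fderiv_metric p hx
  have h2 : ∀ x y u v : E8, fderiv ℝ (fderiv ℝ (metric p)) (chart p p) x y u v
      = metric p (chart p p) (conn p (chart p p) x (conn p (chart p p) y u)) v
        + metric p (chart p p) (conn p (chart p p) y u) (conn p (chart p p) x v)
        + metric p (chart p p) (fderiv ℝ (fun z => conn p z y) (chart p p) x u) v
        + (metric p (chart p p) (conn p (chart p p) x u) (conn p (chart p p) y v)
        + metric p (chart p p) u (conn p (chart p p) x (conn p (chart p p) y v))
        + metric p (chart p p) u (fderiv ℝ (fun z => conn p z y) (chart p p) x v)) :=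
    fun x y u v => by
    have h1 := ((hd2.clm_apply (hasFDerivAt_const y _)).clm_apply
      (hasFDerivAt_const u _)).clm_apply (hasFDerivAt_const v _)
    have h3 := (hG.clm_apply ((hc y).clm_apply (hasFDerivAt_const u _))).clm_apply
      (hasFDerivAt_const v _)
    have h4 := (hG.clm_apply (hasFDerivAt_const u _)).clm_apply
      ((hc y).clm_apply (hasFDerivAt_const v _))
    have hev : (fun z => fderiv ℝ (metric p) z y u v) =ᶠ[𝓝 (chart p p)] fun z =>
        metric p z (conn p z y u) v + metric p z u (conn p z y v) := by
      filter_upwards [(isOpen_chart_target p).mem_nhds hx] with z hz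
      exact fderiv_metric p hz y u v
    have h5 := congrArg (fun L => L x)
      (h1.fderiv.symm.trans (hev.fderiv_eq.trans (h3.fun_add h4).fderiv))
    clear hd hG hd2 hsym hc h1 h3 h4 hev
    generalize chart p p = x₀ at h5 hf ⊢
    simp at h5
    rw [hf, hf] at h5
    linarith
  have key : ∀ x y u v : E8, metric p (chart p p) ((fderiv ℝ (fun z => conn p z y) (chart p p) x
          - fderiv ℝ (fun z => conn p z x) (chart p p) y
          + (conn p (chart p p) x).comp (conn p (chart p p) y)
          - (conn p (chart p p) y).comp (conn p (chart p p) x)) u) v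
      = -metric p (chart p p) u ((fderiv ℝ (fun z => conn p z y) (chart p p) x
          - fderiv ℝ (fun z => conn p z x) (chart p p) y
          + (conn p (chart p p) x).comp (conn p (chart p p) y)
          - (conn p (chart p p) y).comp (conn p (chart p p) x)) v) := fun x y u v => by
    have h := h2 x y u v
    rw [hsym x y, h2 y x u v] at h
    simp only [add_apply, sub_apply, ContinuousLinearMap.comp_apply, map_add, map_sub]
    linarith
  rw [← metric_self, ← metric_self]
  exact key X Y u v

lemma diamond_curvForm (p : M) (X Y : TS p) :
    diamond (curvForm p X Y) (Ω p) = -endAct (curvature p X Y) (Ω p) := by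
  rw [curvForm, diamond_eq, endOf_formOfEnd (curvature_skew p X Y)]

/-- The antisymmetrised covariant derivative of the torsion. -/
lemma nablaOneTwo_torsion_sub (hΩ : IsSp2Sp1Structure Ω) (p : M) (X Y : TS p) :
    nablaOneTwo (torsion Ω) p X Y - nablaOneTwo (torsion Ω) p Y X
      = pi15 (Ω p) (curvForm p X Y) + (1 / 32 : ℝ) •
        (tripleContr (nablaForm Ω p Y) (nablaForm Ω p X)
          - tripleContr (nablaForm Ω p X) (nablaForm Ω p Y)) := by
  obtain ⟨b, hb⟩ := exists_isAdapted (hΩ.model p)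
  have hR := ricci_identity hΩ.smooth p X Y
  rw [← diamond_curvForm] at hR
  -- Vanishing torsion of the connection makes the two terms `T(∇_X Y)` and `T(∇_Y X)` cancel.
  have hc : conn p (chart p p) X Y = conn p (chart p p) Y X := conn_symm p (mem_chart_target p) X Y
  have h1 := tripleContr_diamond hb (curvForm p X Y)
  rw [nablaOneTwo_torsion hΩ, nablaOneTwo_torsion hΩ, hc, hb.pi15_eq]
  have h2 : ∀ A B C : TS p [⋀^Fin 4]→L[ℝ] ℝ, A - B = C →
      tripleContr A (Ω p) = tripleContr B (Ω p) + tripleContr C (Ω p) := by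
    rintro A B _ rfl
    simp only [← tripleContrL_apply, map_sub, LinearMap.sub_apply]
    abel
  rw [h2 _ _ _ hR, h1]
  module

/-- Both derivatives of `Ω` have the form `κ ◇ Ω` with `κ` in `Λ²₁₅`, so `proj15_tripleContr_sub`
removes the quadratic term. -/
lemma pi15_nablaOneTwo_torsion_sub (hΩ : IsSp2Sp1Structure Ω) (p : M) (X Y : TS p) :
    pi15 (Ω p) (nablaOneTwo (torsion Ω) p X Y - nablaOneTwo (torsion Ω) p Y X)
      = pi15 (Ω p) (curvForm p X Y) := by
  obtain ⟨b, hb⟩ := exists_isAdapted (hΩ.model p)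
  obtain ⟨hX, hX'⟩ := torsion_isIntrinsicTorsion hΩ p X
  obtain ⟨hY, hY'⟩ := torsion_isIntrinsicTorsion hΩ p Y
  rw [hb.mem_lambda15] at hX hY
  rw [nablaOneTwo_torsion_sub hΩ, hb.pi15_eq, map_add, map_smul, proj15_proj15, hX', hY',
    proj15_tripleContr_sub hb hX hY, smul_zero, add_zero]

end Curvature

end QK

end

theorem mainTheorem12 {M : Type*} [TopologicalSpace M] [ChartedSpace QK.E8 M]
    [IsManifold 𝓘(ℝ, QK.E8) ∞ M]
    [RiemannianBundle (fun p : M => TangentSpace 𝓘(ℝ, QK.E8) p)]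
    [IsContMDiffRiemannianBundle 𝓘(ℝ, QK.E8) ∞ QK.E8 (fun p : M => TangentSpace 𝓘(ℝ, QK.E8) p)]
    (Ω : ∀ p : M, QK.TS p [⋀^Fin 4]→L[ℝ] ℝ) (hΩ : QK.IsSp2Sp1Structure Ω) :
    (∃! T : ∀ p : M, QK.TS p →ₗ[ℝ] QK.TS p [⋀^Fin 2]→L[ℝ] ℝ, QK.IsIntrinsicTorsion Ω T) ∧
    ∀ T : ∀ p : M, QK.TS p →ₗ[ℝ] QK.TS p [⋀^Fin 2]→L[ℝ] ℝ, QK.IsIntrinsicTorsion Ω T →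
      QK.IsSmoothOneTwo T ∧
      ∀ (p : M) (X Y : QK.TS p),
        QK.nablaOneTwo T p X Y - QK.nablaOneTwo T p Y X
          = QK.pi15 (Ω p) (QK.curvForm p X Y)
            + (1 / 32 : ℝ) •
              (QK.tripleContr (QK.nablaForm Ω p Y) (QK.nablaForm Ω p X)
                - QK.tripleContr (QK.nablaForm Ω p X) (QK.nablaForm Ω p Y)) ∧
        QK.pi15 (Ω p) (QK.nablaOneTwo T p X Y - QK.nablaOneTwo T p Y X)
          = QK.pi15 (Ω p) (QK.curvForm p X Y) := by
  refine ⟨⟨QK.torsion Ω, QK.torsion_isIntrinsicTorsion hΩ, fun T hT => hT.eq_torsion hΩ⟩,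
    fun T hT => ?_⟩
  obtain rfl := hT.eq_torsion hΩ
  exact ⟨QK.torsion_isSmoothOneTwo hΩ, fun p X Y =>
    ⟨QK.nablaOneTwo_torsion_sub hΩ p X Y, QK.pi15_nablaOneTwo_torsion_sub hΩ p X Y⟩⟩
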